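/- **Setting.** Let $A\in\mathbb R^{n\times n}$, $B\in\mathbb R^{n\times m}$, $C\in\mathbb R^{r\times n}$, $D\in\mathbb R^{r\times m}$ with $m\ge 1$, and $$x_{t+1}=Ax_t+Bu_t+w_t,\qquad y_t=Cx_t+Du_t,\qquad t=0,1,2,\dots$$ Let $k\ge 2$, let $G^*=[D\ CB\ CAB\ \cdots\ CA^{k-2}B]\in\mathbb R^{r\times mk}$ be the Markov parameter matrix of order $k$, let $\mathcal H_{0,\infty}=(CA^{i+j}B)_{i,j\ge 0}$ be the infinite block Hankel matrix, and let $\mathbf U_t^{(k)}=[u_t^T\ u_{t-1}^T\ \cdots\ u_{t-k+1}^T]^T$. $\|\cdot\|_2$ is the Euclidean norm of a vector and the spectral norm of a matrix (for infinite matrices the operator norm on $\ell^2$), and $\|\cdot\|_F$ is the Frobenius norm. **Assumptions.** 1. There are $\psi>0$ and $0\le\rho<1$ with $\|A^t\|_2\le\psi\rho^t$ for all $t\ge 0$. 2. With $\mathcal F_t=\sigma(x_0,w_0,\dots,w_{t-1})$ and some $\eta>0$: $\mathbb E[e^{\|x_0\|_2^2/\eta^2}]\le 2$, and $\mathbb E[e^{\|w_t\|_2^2/\eta^2}\mid\mathcal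 F_t]\le 2$ almost surely for all $t\ge 0$ (that is, $\big\|\|x_0\|_2\big\|_{\psi_2}\le\eta$ and, conditionally on $\mathcal F_t$, $\big\|\|w_t\|_2\big\|_{\psi_2}\le\eta$). 3. There are independent Bernoulli$(p)$ variables $\xi_0,\xi_1,\dots$ with $0\le p<\frac1{2(k-1)}$ and $\{\xi_t=0\}\subseteq\{w_t=0\}$ for all $t$. Put $q=1-(1-p)^{k-1}$, so that $q<\frac12$. 4. The inputs $u_t\sim N(0,\sigma^2I_m)$, $\sigma>0$, are independent, the sequence $(u_t)$ is independent of the sequence $(\xi_t)$, and for every $t$ the family $(u_s,\xi_s)_{s\ge t}$ is independent of $x_0,(w_s,u_s,\xi_s)_{s<t}$. (The attack $w_t$ may depend on the whole past and on $u_t,\xi_t$.) 5. $R>0$ is known with $\|G^*\|_F\le R$, and $\beta>\frac{\sqrt{2\pi}R}{\kappa\sigma}$ for some $\kappa>0$ with $\kappa\le 1-2q$ (one may take $\kappa=1-2q$). **Algorithm.** *Streaming estimate.* Put $G^{(0)}=0$. For $t=0,k,2k,\dots$ let $f_t(G)=\|y_{t+k-1}-G\mathbf U^{(k)}_{t+k-1}\|_2$,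 select any $g^{(t)}\in\partial f_t(G^{(t)})$ that is a measurable function of the variables $x_0$ and $w_s,u_s,\xi_s$, $s\le t+k-1$ (in particular any measurable function of the inputs and observations up to time $t+k-1$), and let $G^{(t+k)}$ be the Frobenius projection of $G^{(t)}-\frac{k\beta}{t+k}g^{(t)}$ onto $\{G:\|G\|_F\le R\}$. For $t$ not a multiple of $k$ let $G^{(t)}=G^{(k\lfloor t/k\rfloor)}$. *Batch estimate.* $\hat G^*_T$ is any minimizer over $G\in\mathbb R^{r\times mk}$ of $\sum_{t=k-1}^{T+k-2}\|y_t-G\mathbf U^{(k)}_t\|_2$. *Hybrid algorithm.* Given a recovery time $T^*$, use $\tilde G^{(t)}=G^{(t)}$ for $1\le t<T^*$ and $\tilde G^{(T^*)}=\hat G^*_{T^*}$. Let $\hat D^{(t)}$ be the first $r\times m$ block of $\tilde G^{(t)}$, and let $\hat{\mathcal H}^{(t)}$ be obtained from $\mathcal H_{0,\infty}$ by replacing the blocks $CB,\dots,CA^{k-2}B$ by the corresponding blocks of $\tilde G^{(t)}$, and the blocks $CA^{k-1}B,CA^kB,\dots$ by $0$. **Theorem.** There is an absolute constant $c_0>0$,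 and there is a constant $K>0$ that depends only on $m,\sigma,\eta,\psi,R,\beta,\kappa$ and on upper bounds for $\|B\|_2$ and $\|C\|_2$ (hence not on $\rho$, $k$, $t$), such that the following holds for every $\delta\in(0,1]$ and every integer $$T^*\ \ge\ c_0\,\frac{k}{(1-2q)^2}\Big[mk\log\Big(\frac{mk}{1-2q}\Big)+\log\Big(\frac1\delta\Big)\Big].$$ For every $1\le t<T^*$, $$\mathbb E\big[\|D-\hat D^{(t)}\|_2\big]\le K\Big(\frac{k^{1/4}\rho^{(k-1)/2}}{\sqrt{1-\rho}}+\frac{k}{\sqrt t}\Big),\qquad \mathbb E\big[\|\mathcal H_{0,\infty}-\hat{\mathcal H}^{(t)}\|_2\big]\le K\Big(\frac{\rho^{k/2}}{1-\rho^2}+\frac{k^{3/4}\rho^{(k-1)/2}}{\sqrt{1-\rho}}+\frac{k^{3/2}}{\sqrt t}\Big).$$ At $t=T^*$, with probability at least $1-\delta$, both $$\|D-\hat D^{(T^*)}\|_2\le K\,\frac{\rho^{k-1}}{1-\rho}\qquad\text{and}\qquad \|\mathcal H_{0,\infty}-\hat{\mathcal H}^{(T^*)}\|_2\le K\Big(\frac{\rho^{k/2}}{1-\rho^2}+\frac{k^{1/2}\rho^{k-1}}{1-\rho}\Big).$$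 -/

import Mathlib

open MeasureTheory ProbabilityTheory
open scoped ENNReal

noncomputable section

namespace SysId

/-! ### Norms -/

/-- Euclidean norm of a finite real vector. -/
def vecNorm {ι : Type*} [Fintype ι] (v : ι → ℝ) : ℝ :=
  ‖(WithLp.toLp 2 v : EuclideanSpace ℝ ι)‖

/-- Spectral norm of a finite real matrix, i.e. its operator norm between Euclidean spaces. -/
def specNorm {ι κ : Type*} [Fintype ι] [Fintype κ] [DecidableEq κ] (M : Matrix ι κ ℝ) : ℝ :=
  ‖LinearMap.toContinuousLinearMap (Matrix.toEuclideanLin M)‖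

/-- Frobenius inner product. -/
def frobInner {ι κ : Type*} [Fintype ι] [Fintype κ] (M N : Matrix ι κ ℝ) : ℝ :=
  ∑ i, ∑ j, M i j * N i j

/-- Frobenius norm. -/
def frobNorm {ι κ : Type*} [Fintype ι] [Fintype κ] (M : Matrix ι κ ℝ) : ℝ :=
  Real.sqrt (frobInner M M)

/-- Spectral norm of an infinite matrix, i.e. its operator norm from `ℓ²(κ)` to `ℓ²(ι)`, with
value `∞` if the matrix does not define a bounded operator. The supremum runs over the finitely
supported vectors of the unit ball, which are dense in it. -/
def infSpecNorm {ι κ : Type*} (M : Matrix ι κ ℝ) : ℝ≥0∞ :=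
  ⨆ (x : κ →₀ ℝ) (_ : (x.sum fun _ a => a ^ 2) ≤ 1),
    (∑' i : ι, ENNReal.ofReal ((x.sum fun j a => M i j * a) ^ 2)) ^ (1 / 2 : ℝ)

/-! ### The linear system -/

/-- The matrices `(A, B, C, D)` of a linear system with state dimension `n`, input dimension `m`
and output dimension `r`. -/
structure LinSys (n m r : ℕ) where
  A : Matrix (Fin n) (Fin n) ℝ
  B : Matrix (Fin n) (Fin m) ℝ
  C : Matrix (Fin r) (Fin n) ℝ
  D : Matrix (Fin r) (Fin m) ℝ

namespace LinSys

variable {n m r : ℕ} (S : LinSys n m r)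

/-- The states: `x_{t+1} = A x_t + B u_t + w_t`. -/
def state (x₀ : Fin n → ℝ) (u : ℕ → Fin m → ℝ) (w : ℕ → Fin n → ℝ) : ℕ → Fin n → ℝ
  | 0 => x₀
  | t + 1 => S.A.mulVec (state x₀ u w t) + S.B.mulVec (u t) + w t

/-- The observations: `y_t = C x_t + D u_t`. -/
def output (x₀ : Fin n → ℝ) (u : ℕ → Fin m → ℝ) (w : ℕ → Fin n → ℝ) (t : ℕ) : Fin r → ℝ :=
  S.C.mulVec (S.state x₀ u w t) + S.D.mulVec (u t)

/-- The Markov parameter matrix of order `k`, `[D  CB  CAB  ⋯  C A^{k-2} B]`. Its columns are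
indexed by a block `j < k` and an input coordinate. -/
def markov (k : ℕ) : Matrix (Fin r) (Fin k × Fin m) ℝ := fun i c =>
  if (c.1 : ℕ) = 0 then S.D i c.2 else (S.C * S.A ^ ((c.1 : ℕ) - 1) * S.B) i c.2

/-- The infinite Hankel matrix `H_{0,∞}`: its block in position `(i, j)` is `C A^{i+j} B`. -/
def hankel : Matrix (ℕ × Fin r) (ℕ × Fin m) ℝ := fun a b =>
  (S.C * S.A ^ (a.1 + b.1) * S.B) a.2 b.2

end LinSys

/-! ### Quantities read off from an (estimated) Markov parameter matrix -/

/-- The `j`-th `r × m` block of `G`; it is zero for `j ≥ k`. -/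
def block {k m r : ℕ} (G : Matrix (Fin r) (Fin k × Fin m) ℝ) (j : ℕ) :
    Matrix (Fin r) (Fin m) ℝ := fun i a => if h : j < k then G i (⟨j, h⟩, a) else 0

/-- The estimate of `D`: the first block. -/
def estD {k m r : ℕ} (G : Matrix (Fin r) (Fin k × Fin m) ℝ) : Matrix (Fin r) (Fin m) ℝ :=
  block G 0

/-- The estimated Hankel matrix: `C A^{i+j} B` is replaced by block number `i + j + 1` of `G`, and
by zero where `G` has no such block, i.e. for `i + j + 1 ≥ k`. -/
def estHankel {k m r : ℕ} (G : Matrix (Fin r) (Fin k × Fin m) ℝ) :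
    Matrix (ℕ × Fin r) (ℕ × Fin m) ℝ := fun a b => block G (a.1 + b.1 + 1) a.2 b.2

/-! ### Estimators -/

/-- The stacked inputs `U_t^{(k)} = (u_t, u_{t-1}, …, u_{t-k+1})`; used for `t ≥ k - 1` only. -/
def stackedInput {m : ℕ} (k : ℕ) (u : ℕ → Fin m → ℝ) (t : ℕ) : Fin k × Fin m → ℝ :=
  fun c => u (t - (c.1 : ℕ)) c.2

/-- The loss of the single sample at time `t`: `‖y_t - G U_t^{(k)}‖₂`. -/
def sampleLoss {k m r : ℕ} (u : ℕ → Fin m → ℝ) (y : ℕ → Fin r → ℝ) (t : ℕ)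
    (G : Matrix (Fin r) (Fin k × Fin m) ℝ) : ℝ :=
  vecNorm (y t - G.mulVec (stackedInput k u t))

/-- `G` is a minimizer of the `ℓ₂`-norm estimator `∑_{t=k-1}^{T+k-2} ‖y_t - G U_t^{(k)}‖₂`. -/
def IsL2Estimate {k m r : ℕ} (u : ℕ → Fin m → ℝ) (y : ℕ → Fin r → ℝ) (T : ℕ)
    (G : Matrix (Fin r) (Fin k × Fin m) ℝ) : Prop :=
  ∀ H : Matrix (Fin r) (Fin k × Fin m) ℝ,
    ∑ s ∈ Finset.range T, sampleLoss u y (s + (k - 1)) G ≤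
      ∑ s ∈ Finset.range T, sampleLoss u y (s + (k - 1)) H

/-- `g` is a subgradient of `f` at `G`, with respect to the Frobenius inner product. -/
def IsSubgradient {ι κ : Type*} [Fintype ι] [Fintype κ] (f : Matrix ι κ ℝ → ℝ)
    (G g : Matrix ι κ ℝ) : Prop :=
  ∀ H, f G + frobInner g (H - G) ≤ f H

/-- `P` is a Frobenius-nearest point to `X` in the set `Q`. -/
def IsProjection {ι κ : Type*} [Fintype ι] [Fintype κ] (Q : Set (Matrix ι κ ℝ))
    (X P : Matrix ι κ ℝ) : Prop :=
  P ∈ Q ∧ ∀ H ∈ Q, frobNorm (X - P) ≤ frobNorm (X - H)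

/-! ### The random data -/

/-- The random objects: initial state, inputs, attacks, and attack-time indicators. -/
structure Data (Ω : Type*) (n m : ℕ) where
  x₀ : Ω → Fin n → ℝ
  u : ℕ → Ω → Fin m → ℝ
  w : ℕ → Ω → Fin n → ℝ
  ξ : ℕ → Ω → Bool

namespace Data

variable {Ω : Type*} {n m r : ℕ} (Z : Data Ω n m)

/-- The input trajectory at the outcome `ω`. -/
def input (ω : Ω) : ℕ → Fin m → ℝ := fun t => Z.u t ω

/-- The observation trajectory at the outcome `ω`. -/
def obs (S : LinSys n m r) (ω : Ω) : ℕ → Fin r → ℝ :=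
  S.output (Z.x₀ ω) (fun t => Z.u t ω) (fun t => Z.w t ω)

/-- `F_t = σ(x₀, w_0, …, w_{t-1})`. -/
@[reducible] def attackFiltration (t : ℕ) : MeasurableSpace Ω :=
  MeasurableSpace.comap Z.x₀ inferInstance ⊔
    ⨆ (s : ℕ) (_ : s < t), MeasurableSpace.comap (Z.w s) inferInstance

/-- Everything that has happened before time `t`. -/
@[reducible] def history (t : ℕ) : MeasurableSpace Ω :=
  MeasurableSpace.comap Z.x₀ inferInstance ⊔
    ⨆ (s : ℕ) (_ : s < t), (MeasurableSpace.comap (Z.w s) inferInstance ⊔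
      MeasurableSpace.comap (Z.u s) inferInstance ⊔ MeasurableSpace.comap (Z.ξ s) inferInstance)

/-- The inputs and attack indicators from time `t` on. -/
@[reducible] def future (t : ℕ) : MeasurableSpace Ω :=
  ⨆ (s : ℕ) (_ : t ≤ s), (MeasurableSpace.comap (Z.u s) inferInstance ⊔
    MeasurableSpace.comap (Z.ξ s) inferInstance)

end Data

/-- The sub-Gaussian norm of the random vector `X`, conditioned on the `σ`-algebra `F`, is at most
`η`: `E[exp(‖X‖₂² / η²) | F] ≤ 2` almost surely. With `F = ⊥` this is the unconditional
`‖X‖_{ψ₂} = inf {t > 0 : E exp(‖X‖₂² / t²) ≤ 2} ≤ η`. Integrability is part of the bound. -/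
def SubGaussianNormLE {Ω : Type*} [MeasurableSpace Ω] (μ : Measure Ω) (F : MeasurableSpace Ω)
    {n : ℕ} (X : Ω → Fin n → ℝ) (η : ℝ) : Prop :=
  Integrable (fun ω => Real.exp (vecNorm (X ω) ^ 2 / η ^ 2)) μ ∧
    μ[fun ω => Real.exp (vecNorm (X ω) ^ 2 / η ^ 2) | F] ≤ᵐ[μ] fun _ => 2

/-- The standing assumptions on the random data: measurability; Gaussian independent inputs;
sub-Gaussian initial state and attacks; attacks only at times with `ξ_t = 1`, where the `ξ_t` are
independent Bernoulli(`p`) variables. The last two fields say that the inputs are independent of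
the attack times, and that nobody anticipates: inputs and attack indicators from time `t` on are
independent of all that happened before. The attack `w_t` may depend on the whole past and on
`u_t`, `ξ_t`. -/
structure DataAssumptions {Ω : Type*} [MeasurableSpace Ω] (μ : Measure Ω) {n m : ℕ}
    (Z : Data Ω n m) (σ η p : ℝ) : Prop where
  meas_x₀ : Measurable Z.x₀
  meas_u : ∀ t, Measurable (Z.u t)
  meas_w : ∀ t, Measurable (Z.w t)
  meas_ξ : ∀ t, Measurable (Z.ξ t)
  subGaussian_x₀ : SubGaussianNormLE μ ⊥ Z.x₀ η
  subGaussian_w : ∀ t, SubGaussianNormLE μ (Z.attackFiltration t) (Z.w t) η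
  gaussian_u : ∀ t, μ.map (Z.u t) = Measure.pi fun _ => gaussianReal 0 (Real.toNNReal (σ ^ 2))
  indep_u : iIndepFun Z.u μ
  bernoulli_ξ : ∀ t, μ {ω | Z.ξ t ω = true} = ENNReal.ofReal p
  indep_ξ : iIndepFun Z.ξ μ
  attack_off : ∀ t ω, Z.ξ t ω = false → Z.w t ω = 0
  indep_u_ξ : Indep (⨆ t, MeasurableSpace.comap (Z.u t) inferInstance)
    (⨆ t, MeasurableSpace.comap (Z.ξ t) inferInstance) μ
  nonanticipating : ∀ t, Indep (Z.history t) (Z.future t) μ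

/-- A run of the stochastic projected subgradient descent algorithm on the data: `G j` is the
estimate at time `t = j k`, started at `0`; `g j` is the subgradient of the loss of the sample at
time `t + k - 1` selected at `G j`; the step size is `k β / (t + k)`, and the projection is onto the
Frobenius ball of radius `R`. The selection of `g j` may be any measurable function of what has
happened up to time `t + k - 1`. -/
structure IsStreamingRun {Ω : Type*} {n m r k : ℕ} (S : LinSys n m r) (Z : Data Ω n m) (R β : ℝ)
    (G g : ℕ → Ω → Matrix (Fin r) (Fin k × Fin m) ℝ) : Prop where
  init : ∀ ω, G 0 ω = 0
  subgradient : ∀ j ω,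
    IsSubgradient (sampleLoss (Z.input ω) (Z.obs S ω) (j * k + (k - 1))) (G j ω) (g j ω)
  adapted : ∀ j i c, Measurable[Z.history (j * k + k)] fun ω => g j ω i c
  step : ∀ j ω, IsProjection {H | frobNorm H ≤ R}
    (G j ω - ((k : ℝ) * β / (((j * k : ℕ) : ℝ) + k)) • g j ω) (G (j + 1) ω)

/-- The estimate of the Markov parameter matrix used at time `t` by the hybrid algorithm with
recovery time `Tstar`: the current streaming estimate for `t < Tstar` (the one computed at the last
multiple of `k`), and the `ℓ₂`-norm estimate at `t = Tstar`. -/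
def hybridEstimate {Ω : Type*} {m r k : ℕ} (Tstar : ℕ)
    (G : ℕ → Ω → Matrix (Fin r) (Fin k × Fin m) ℝ) (Gbatch : Ω → Matrix (Fin r) (Fin k × Fin m) ℝ)
    (t : ℕ) (ω : Ω) : Matrix (Fin r) (Fin k × Fin m) ℝ :=
  if t < Tstar then G (t / k) ω else Gbatch ω

/-- The probability `q = 1 - (1 - p)^{k-1}` of at least one attack time among `k - 1`. -/
def attackProb (k : ℕ) (p : ℝ) : ℝ := 1 - (1 - p) ^ (k - 1)

/-- The order of the recovery time:
`k / (1-2q)² · [m k log (m k / (1-2q)) + log (1/δ)]`. -/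
def recoveryTime (m k : ℕ) (q δ : ℝ) : ℝ :=
  k / (1 - 2 * q) ^ 2 * (m * k * Real.log (m * k / (1 - 2 * q)) + Real.log (1 / δ))

end SysId

end

/-!
Everything reduces to the Frobenius error `‖M - G‖_F` of the estimate `G` of the Markov parameter
matrix `M`. The error of `D` is the norm of one block of `M - G`. For the Hankel matrix the
operator norm is bounded by the Hilbert–Schmidt norm of the matrix of block norms: each estimated
block occurs at most `k` times, which costs a factor `√k`, and the neglected blocks decay
geometrically (`infSpecNorm_sub_estHankel_le`).

Fix a window of `k` consecutive times starting at `s`, with stacked input `U_s`, and let `τ_s = 1`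
if none of its first `k - 1` times is an attack time and `τ_s = -1` otherwise. The observation at
the end of the window is `M U_s`, plus the attacks inside the window, plus a remainder of size
`c ρ^(k-1) X_s`, where `X_s` dominates the state at time `s`. By the triangle inequality, the loss
of this sample at `G` exceeds its loss at `M` by at least `τ_s ‖(M - G) U_s‖ - 2 c ρ^(k-1) X_s`,
whatever the attacks are (`sampleLoss_sub_ge`). The sign `τ_s` is independent of `U_s` and has mean
`θ = 1 - 2q > 0`, and the mean of `‖M' U_s‖` is at least `√(2/π) σ ‖M'‖_F` for every matrix `M'`.
Hence the loss grows linearly away from `M` in expectation.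

*Streaming estimate.* The windows of successive steps are disjoint, and nobody anticipates, so the
current estimate is independent of the next window. A projected subgradient step with step size
`β / (j + 1)` thus decreases the mean of the squared error by at least a multiple of the mean error
itself, up to the remainder and the squared length of the step. Since the error is at most `2R`,
this is a multiple `2 / (j + 1)` of the squared error (`integral_streaming_step_le`; this is where
the lower bound on `β` enters), and the resulting recursion gives
`E ‖M - G_j‖_F² ≲ ρ^(k-1) / (1 - ρ) + k / j` (`integral_streaming_le`).

*Batch estimate.* For a fixed direction `z`, the sum of `τ_s |⟨z, U_s⟩|` over `s < T` is at least
of order `θ σ ‖z‖ T` except with probability `exp (-θ² / 16) ^ ⌊T / k⌋`: split the windows into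
residue classes modulo `k`, inside which they are independent, and combine the classes by convexity
of the exponential (`DataAssumptions.measure_sum_window_le`). A union bound over a grid of
`O(mk / θ) ^ (mk)` points makes this uniform in `z`; this is what the recovery time pays for.
Writing `‖v‖` as a multiple of the mean of `|⟨v, g⟩|`, with `g` standard Gaussian, passes from
vectors `z` to matrices with any number of rows (`lower_bound_matrix`). On an event where in
addition the total size of inputs and attacks is `O(T)`, the minimality of the batch estimate
forces its error to be of order `ρ^(k-1) / (1 - ρ)` (`frobNorm_markov_sub_batch_le`).
-/

noncomputable section

namespace SysId

/-! ### Vector and matrix norms -/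

section Norms

variable {ι κ : Type*} [Fintype ι] [Fintype κ]

theorem vecNorm_nonneg (v : ι → ℝ) : 0 ≤ vecNorm v := norm_nonneg _

theorem vecNorm_sq (v : ι → ℝ) : vecNorm v ^ 2 = ∑ i, v i ^ 2 := by
  rw [vecNorm, EuclideanSpace.norm_sq_eq]; simp

theorem vecNorm_add_le (v w : ι → ℝ) : vecNorm (v + w) ≤ vecNorm v + vecNorm w := by
  simpa [vecNorm] using norm_add_le (WithLp.toLp 2 v : EuclideanSpace ℝ ι) (WithLp.toLp 2 w)

theorem vecNorm_neg (v : ι → ℝ) : vecNorm (-v) = vecNorm v := by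
  simp [vecNorm]

theorem vecNorm_sub_le (v w : ι → ℝ) : vecNorm (v - w) ≤ vecNorm v + vecNorm w := by
  simpa [sub_eq_add_neg, vecNorm_neg] using vecNorm_add_le v (-w)

theorem vecNorm_smul (a : ℝ) (v : ι → ℝ) : vecNorm (a • v) = |a| * vecNorm v := by
  simp [vecNorm, norm_smul]

@[simp] theorem vecNorm_zero : vecNorm (0 : ι → ℝ) = 0 := by simp [vecNorm]

theorem vecNorm_sum_le {α : Type*} (s : Finset α) (v : α → ι → ℝ) :
    vecNorm (∑ a ∈ s, v a) ≤ ∑ a ∈ s, vecNorm (v a) :=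
  Finset.le_sum_of_subadditive vecNorm vecNorm_zero.le vecNorm_add_le s v

theorem abs_apply_le_vecNorm (v : ι → ℝ) (i : ι) : |v i| ≤ vecNorm v := by
  refine abs_le_of_sq_le_sq ?_ (vecNorm_nonneg v)
  rw [vecNorm_sq]
  exact Finset.single_le_sum (f := fun i => v i ^ 2) (fun i _ => sq_nonneg _) (Finset.mem_univ i)

theorem vecNorm_eq_zero {v : ι → ℝ} (h : vecNorm v = 0) : v = 0 := by
  funext i
  simpa [h] using abs_apply_le_vecNorm v i

theorem abs_dotProduct_le (v w : ι → ℝ) : |v ⬝ᵥ w| ≤ vecNorm v * vecNorm w := by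
  refine abs_le_of_sq_le_sq ?_ (mul_nonneg (vecNorm_nonneg v) (vecNorm_nonneg w))
  rw [mul_pow, vecNorm_sq, vecNorm_sq, dotProduct]
  exact Finset.sum_mul_sq_le_sq_mul_sq _ _ _

theorem vecNorm_le_sum_abs (v : ι → ℝ) : vecNorm v ≤ ∑ i, |v i| := by
  apply le_of_sq_le_sq _ (Finset.sum_nonneg fun i _ => abs_nonneg _)
  rw [vecNorm_sq]
  simpa using Finset.sum_sq_le_sq_sum_of_nonneg (s := Finset.univ) (f := fun i => |v i|)
    (fun i _ => abs_nonneg _)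

theorem measurable_vecNorm : Measurable (vecNorm : (ι → ℝ) → ℝ) := by
  have : (vecNorm : (ι → ℝ) → ℝ) = fun v => Real.sqrt (∑ i, v i ^ 2) := by
    funext v; rw [← vecNorm_sq, Real.sqrt_sq (vecNorm_nonneg v)]
  rw [this]; fun_prop

/-- A matrix as a vector of the Euclidean space whose norm is the Frobenius norm. -/
def flatten (M : Matrix ι κ ℝ) : EuclideanSpace ℝ (ι × κ) := WithLp.toLp 2 fun p => M p.1 p.2

theorem flatten_sub {ι κ : Type*} (M N : Matrix ι κ ℝ) :
    flatten (M - N) = flatten M - flatten N := rfl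

theorem flatten_smul {ι κ : Type*} (a : ℝ) (M : Matrix ι κ ℝ) :
    flatten (a • M) = a • flatten M := rfl

theorem frobInner_eq_inner (M N : Matrix ι κ ℝ) :
    frobInner M N = inner ℝ (flatten M) (flatten N) := by
  simp [frobInner, flatten, PiLp.inner_apply, Fintype.sum_prod_type, mul_comm]

theorem frobNorm_eq_norm (M : Matrix ι κ ℝ) : frobNorm M = ‖flatten M‖ := by
  rw [frobNorm, frobInner_eq_inner, real_inner_self_eq_norm_sq, Real.sqrt_sq (norm_nonneg _)]

theorem frobNorm_nonneg (M : Matrix ι κ ℝ) : 0 ≤ frobNorm M := Real.sqrt_nonneg _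

theorem frobNorm_sq (M : Matrix ι κ ℝ) : frobNorm M ^ 2 = ∑ i, ∑ j, M i j ^ 2 := by
  rw [frobNorm, Real.sq_sqrt]
  · simp [frobInner, pow_two]
  · exact Finset.sum_nonneg fun i _ => Finset.sum_nonneg fun j _ => mul_self_nonneg _

theorem frobNorm_sq_rows (M : Matrix ι κ ℝ) : frobNorm M ^ 2 = ∑ i, vecNorm (M i) ^ 2 := by
  simp [frobNorm_sq, vecNorm_sq]

@[simp] theorem frobNorm_zero : frobNorm (0 : Matrix ι κ ℝ) = 0 := by
  simp [frobNorm, frobInner]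

theorem frobNorm_sub_le (M N : Matrix ι κ ℝ) : frobNorm (M - N) ≤ frobNorm M + frobNorm N := by
  simp only [frobNorm_eq_norm, flatten_sub]; exact norm_sub_le _ _

theorem frobNorm_sub_comm (M N : Matrix ι κ ℝ) : frobNorm (M - N) = frobNorm (N - M) := by
  simp only [frobNorm_eq_norm, flatten_sub]; exact norm_sub_rev _ _

theorem vecNorm_mulVec_le_frobNorm (M : Matrix ι κ ℝ) (v : κ → ℝ) :
    vecNorm (M.mulVec v) ≤ frobNorm M * vecNorm v := by
  apply le_of_sq_le_sq _ (mul_nonneg (frobNorm_nonneg M) (vecNorm_nonneg v))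
  rw [mul_pow, vecNorm_sq, frobNorm_sq_rows, Finset.sum_mul]
  refine Finset.sum_le_sum fun i _ => ?_
  rw [← mul_pow, ← sq_abs]
  exact pow_le_pow_left₀ (abs_nonneg _) (abs_dotProduct_le _ _) 2

variable [DecidableEq κ]

theorem specNorm_nonneg (M : Matrix ι κ ℝ) : 0 ≤ specNorm M := norm_nonneg _

theorem vecNorm_mulVec_le (M : Matrix ι κ ℝ) (v : κ → ℝ) :
    vecNorm (M.mulVec v) ≤ specNorm M * vecNorm v := by
  simpa [specNorm, vecNorm, Matrix.toLpLin_toLp] using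
    (LinearMap.toContinuousLinearMap (Matrix.toEuclideanLin M)).le_opNorm (WithLp.toLp 2 v)

theorem specNorm_le_of_forall (M : Matrix ι κ ℝ) {a : ℝ} (ha : 0 ≤ a)
    (h : ∀ v, vecNorm (M.mulVec v) ≤ a * vecNorm v) : specNorm M ≤ a := by
  refine ContinuousLinearMap.opNorm_le_bound _ ha fun v => ?_
  simpa [vecNorm, Matrix.toLpLin_apply] using h v.ofLp

theorem specNorm_le_frobNorm (M : Matrix ι κ ℝ) : specNorm M ≤ frobNorm M :=
  specNorm_le_of_forall M (frobNorm_nonneg M) (vecNorm_mulVec_le_frobNorm M)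

theorem specNorm_mul_le {γ : Type*} [Fintype γ] [DecidableEq γ] (M : Matrix ι κ ℝ)
    (N : Matrix κ γ ℝ) : specNorm (M * N) ≤ specNorm M * specNorm N := by
  refine specNorm_le_of_forall _ (mul_nonneg (specNorm_nonneg M) (specNorm_nonneg N)) fun v => ?_
  rw [← Matrix.mulVec_mulVec, mul_assoc]
  exact (vecNorm_mulVec_le _ _).trans
    (mul_le_mul_of_nonneg_left (vecNorm_mulVec_le _ _) (specNorm_nonneg M))

end Norms

/-! ### Operator norm of infinite block matrices -/

/-- The operator norm of a block matrix is at most the Hilbert–Schmidt norm of the matrix of the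
norms of its blocks. -/
theorem infSpecNorm_le_of_blocks {r m : ℕ} (M : Matrix (ℕ × Fin r) (ℕ × Fin m) ℝ)
    (N : ℕ → ℕ → ℝ)
    (h : ∀ i j, specNorm (fun a b => M (i, a) (j, b) : Matrix (Fin r) (Fin m) ℝ) ≤ N i j) :
    infSpecNorm M ≤ (∑' i, ∑' j, ENNReal.ofReal (N i j ^ 2)) ^ (1 / 2 : ℝ) := by
  refine iSup₂_le fun x hx => ENNReal.rpow_le_rpow ?_ (by norm_num)
  set s : Finset ℕ := x.support.image Prod.fst
  have hsub : x.support ⊆ s ×ˢ Finset.univ := fun p hp => by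
    simpa [s] using ⟨p.2, Finsupp.mem_support_iff.1 hp⟩
  have hx' : ∑ j ∈ s, vecNorm (fun b => x (j, b)) ^ 2 ≤ 1 := by
    rw [Finsupp.sum_of_support_subset x hsub _ (by simp), Finset.sum_product] at hx
    simpa [vecNorm_sq] using hx
  rw [ENNReal.tsum_prod']
  refine ENNReal.tsum_le_tsum fun i => ?_
  rw [tsum_fintype, ← ENNReal.ofReal_sum_of_nonneg fun _ _ => sq_nonneg _]
  refine le_trans ?_ (ENNReal.sum_le_tsum s)
  rw [← ENNReal.ofReal_sum_of_nonneg fun _ _ => sq_nonneg _]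
  refine ENNReal.ofReal_le_ofReal ?_
  have hrow : ∀ a : Fin r, (x.sum fun q v => M (i, a) q * v) =
      (∑ j ∈ s, Matrix.mulVec (fun a b => M (i, a) (j, b) : Matrix (Fin r) (Fin m) ℝ)
        (fun b => x (j, b))) a := fun a => by
    rw [Finsupp.sum_of_support_subset x hsub _ (by simp), Finset.sum_product, Finset.sum_apply]
    rfl
  simp_rw [hrow]
  rw [← vecNorm_sq]
  have h1 : vecNorm (∑ j ∈ s, Matrix.mulVec
      (fun a b => M (i, a) (j, b) : Matrix (Fin r) (Fin m) ℝ) (fun b => x (j, b))) ≤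
      ∑ j ∈ s, N i j * vecNorm (fun b => x (j, b)) :=
    (vecNorm_sum_le _ _).trans (Finset.sum_le_sum fun j _ =>
      (vecNorm_mulVec_le _ _).trans (mul_le_mul_of_nonneg_right (h i j) (vecNorm_nonneg _)))
  calc _ ≤ (∑ j ∈ s, N i j * vecNorm (fun b => x (j, b))) ^ 2 :=
        pow_le_pow_left₀ (vecNorm_nonneg _) h1 2
    _ ≤ (∑ j ∈ s, N i j ^ 2) * ∑ j ∈ s, vecNorm (fun b => x (j, b)) ^ 2 :=
        Finset.sum_mul_sq_le_sq_mul_sq _ _ _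
    _ ≤ _ := mul_le_of_le_one_right (Finset.sum_nonneg fun _ _ => sq_nonneg _) hx'

theorem tsum_tsum_add (f : ℕ → ℝ≥0∞) :
    ∑' i, ∑' j, f (i + j) = ∑' l : ℕ, ((l : ℝ≥0∞) + 1) * f l := by
  rw [← ENNReal.tsum_prod (f := fun i j => f (i + j)),
    ← Finset.HasAntidiagonal.sigmaAntidiagonalEquivProd.tsum_eq (fun p : ℕ × ℕ => f (p.1 + p.2)),
    ENNReal.tsum_sigma']
  refine tsum_congr fun l => ?_
  rw [tsum_fintype, Finset.sum_congr rfl (g := fun _ => f l)]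
  · simp
  · rintro ⟨p, hp⟩ -
    simp [Finset.HasAntidiagonal.mem_antidiagonal.1 hp]

theorem rpow_half_le_ofReal_add {x : ℝ≥0∞} {P Q : ℝ} (hP : 0 ≤ P) (hQ : 0 ≤ Q)
    (h : x ≤ ENNReal.ofReal (Q ^ 2) + ENNReal.ofReal (P ^ 2)) :
    x ^ (1 / 2 : ℝ) ≤ ENNReal.ofReal (P + Q) := by
  have hroot : ENNReal.ofReal ((P + Q) ^ 2) ^ (1 / 2 : ℝ) = ENNReal.ofReal (P + Q) := by
    rw [ENNReal.ofReal_rpow_of_nonneg (sq_nonneg _) (by norm_num), ← Real.sqrt_eq_rpow,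
      Real.sqrt_sq (add_nonneg hP hQ)]
  rw [← hroot]
  refine ENNReal.rpow_le_rpow (h.trans ?_) (by norm_num)
  rw [← ENNReal.ofReal_add (sq_nonneg _) (sq_nonneg _)]
  exact ENNReal.ofReal_le_ofReal (by nlinarith)

theorem natCast_add_one_mul_ofReal (l : ℕ) (x : ℝ) : ((l : ℝ≥0∞) + 1) * ENNReal.ofReal x =
    ENNReal.ofReal (((l : ℝ) + 1) * x) := by
  rw [ENNReal.ofReal_mul (by positivity), ENNReal.ofReal_add (by positivity) zero_le_one,
    ENNReal.ofReal_natCast, ENNReal.ofReal_one]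

theorem tsum_tsum_add_eq (f : ℕ → ℝ≥0∞) (N : ℕ) : ∑' i, ∑' j, f (i + j) =
    ∑ l ∈ Finset.range N, ((l : ℝ≥0∞) + 1) * f l +
      ∑' l : ℕ, (((l + N : ℕ) : ℝ≥0∞) + 1) * f (l + N) := by
  rw [tsum_tsum_add]
  exact (Summable.sum_add_tsum_nat_add' (f := fun l : ℕ => ((l : ℝ≥0∞) + 1) * f l) (k := N)
    ENNReal.summable).symm

/-- The squared Hilbert–Schmidt norm of the tail `(ρ ^ (i + j))`, `i + j ≥ k - 1`. -/
theorem tsum_geometric_tail_le {ρ : ℝ} (h0 : 0 ≤ ρ) (h1 : ρ < 1) {k : ℕ} (hk : 2 ≤ k) :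
    ∑' l : ℕ, ENNReal.ofReal ((((l + (k - 1) : ℕ) : ℝ) + 1) * (ρ ^ (l + (k - 1))) ^ 2) ≤
      ENNReal.ofReal ((3 * ρ ^ ((k : ℝ) / 2) / (1 - ρ ^ 2)) ^ 2) := by
  obtain ⟨d, rfl⟩ : ∃ d, k = d + 2 := ⟨k - 2, by omega⟩
  have hx0 : 0 ≤ ρ ^ 2 := sq_nonneg ρ
  have hx1 : ρ ^ 2 < 1 := by nlinarith
  have hpos : 0 < 1 - ρ ^ 2 := by linarith
  have hg := (hasSum_geometric_of_lt_one hx0 hx1).mul_left ((d + 2 : ℝ) * (ρ ^ 2) ^ (d + 1))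
  have hg' := (hasSum_coe_mul_geometric_of_norm_lt_one (r := ρ ^ 2)
    (by rwa [Real.norm_of_nonneg hx0])).mul_left ((ρ ^ 2) ^ (d + 1))
  have hs : HasSum (fun l : ℕ => (((l + (d + 2 - 1) : ℕ) : ℝ) + 1) * (ρ ^ (l + (d + 2 - 1))) ^ 2)
      ((d + 2 : ℝ) * (ρ ^ 2) ^ (d + 1) * (1 - ρ ^ 2)⁻¹ +
        (ρ ^ 2) ^ (d + 1) * (ρ ^ 2 / (1 - ρ ^ 2) ^ 2)) := by
    have e := hg.add hg'
    refine (funext fun l => ?_ : (fun l : ℕ => _) = _) ▸ e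
    rw [show d + 2 - 1 = d + 1 from rfl]
    push_cast
    ring
  rw [← ENNReal.ofReal_tsum_of_nonneg (fun l => by positivity) hs.summable, hs.tsum_eq]
  refine ENNReal.ofReal_le_ofReal ?_
  have hr : (ρ ^ (((d + 2 : ℕ) : ℝ) / 2)) ^ 2 = ρ ^ (d + 2) := by
    rw [← Real.rpow_mul_natCast h0, ← Real.rpow_natCast ρ (d + 2)]
    congr 1; push_cast; ring
  -- `d ρ^d ≤ 1 + ρ + ⋯ + ρ^(d-1) ≤ 1 / (1 - ρ)`, so the factor `d` costs no power of `1 - ρ²`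
  have hd : (d : ℝ) * ρ ^ d * (1 - ρ) ≤ 1 := by
    have hgs := mul_neg_geom_sum ρ d
    have : (d : ℝ) * ρ ^ d ≤ ∑ i ∈ Finset.range d, ρ ^ i := by
      simpa using Finset.card_nsmul_le_sum (Finset.range d) (fun i => ρ ^ i) (ρ ^ d)
        fun i hi => pow_le_pow_of_le_one h0 h1.le (Finset.mem_range.1 hi).le
    have hp : 0 ≤ ρ ^ d := by positivity
    nlinarith
  have hp0 : 0 ≤ ρ ^ d := by positivity
  have hp1 : ρ ^ d ≤ 1 := pow_le_one₀ h0 h1.le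
  have key : ρ ^ d * ((d + 2) * (1 - ρ ^ 2) + ρ ^ 2) ≤ 9 := by
    have e : ρ ^ d * ((d + 2) * (1 - ρ ^ 2) + ρ ^ 2) =
      (d * ρ ^ d * (1 - ρ)) * (1 + ρ) + ρ ^ d * (2 - ρ ^ 2) := by ring
    have a1 : (d * ρ ^ d * (1 - ρ)) * (1 + ρ) ≤ 1 * 2 :=
      mul_le_mul hd (by linarith) (by linarith) (by norm_num)
    have a2 : ρ ^ d * (2 - ρ ^ 2) ≤ 1 * 2 :=
      mul_le_mul hp1 (by linarith) (by linarith) (by norm_num)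
    linarith
  calc _ = ρ ^ (d + 2) * (ρ ^ d * ((d + 2) * (1 - ρ ^ 2) + ρ ^ 2)) / (1 - ρ ^ 2) ^ 2 := by
        field_simp; ring
    _ ≤ ρ ^ (d + 2) * 9 / (1 - ρ ^ 2) ^ 2 := by gcongr
    _ = _ := by rw [div_pow, mul_pow, hr]; ring

section Blocks

variable {n m r k : ℕ}

theorem sum_frobNorm_block_sq (G : Matrix (Fin r) (Fin k × Fin m) ℝ) :
    ∑ j ∈ Finset.range k, frobNorm (block G j) ^ 2 = frobNorm G ^ 2 := by
  rw [← Fin.sum_univ_eq_sum_range (fun j => frobNorm (block G j) ^ 2)]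
  simp only [frobNorm_sq, block, Fin.is_lt, dite_true, Fintype.sum_prod_type, Fin.eta]
  rw [Finset.sum_comm]

theorem frobNorm_block_le (G : Matrix (Fin r) (Fin k × Fin m) ℝ) {j : ℕ} (hj : j < k) :
    frobNorm (block G j) ≤ frobNorm G := by
  apply le_of_sq_le_sq _ (frobNorm_nonneg G)
  rw [← sum_frobNorm_block_sq G]
  exact Finset.single_le_sum (f := fun j => frobNorm (block G j) ^ 2) (fun _ _ => sq_nonneg _)
    (Finset.mem_range.2 hj)

theorem specNorm_sub_estD_le (S : LinSys n m r) (hk : 0 < k)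
    (G : Matrix (Fin r) (Fin k × Fin m) ℝ) :
    specNorm (S.D - estD G) ≤ frobNorm (S.markov k - G) := by
  have : S.D - estD G = block (S.markov k - G) 0 := by
    ext i a
    simp [estD, block, hk, LinSys.markov]
  rw [this]
  exact (specNorm_le_frobNorm _).trans (frobNorm_block_le _ hk)

theorem sum_succ_mul_block_le (F : Matrix (Fin r) (Fin k × Fin m) ℝ) (hk : 0 < k) :
    ∑ l ∈ Finset.range (k - 1), ((l : ℝ) + 1) * frobNorm (block F (l + 1)) ^ 2 ≤
      (Real.sqrt k * frobNorm F) ^ 2 := by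
  rw [mul_pow, Real.sq_sqrt (by positivity), ← sum_frobNorm_block_sq F]
  have e : ∑ j ∈ Finset.range k, frobNorm (block F j) ^ 2 =
      ∑ j ∈ Finset.range (k - 1), frobNorm (block F (j + 1)) ^ 2 + frobNorm (block F 0) ^ 2 := by
    rw [← Finset.sum_range_succ' (fun j => frobNorm (block F j) ^ 2), Nat.sub_add_cancel hk]
  rw [e, mul_add, Finset.mul_sum]
  refine le_add_of_le_of_nonneg (Finset.sum_le_sum fun l hl => ?_) (by positivity)
  refine mul_le_mul_of_nonneg_right ?_ (sq_nonneg _)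
  have := Finset.mem_range.1 hl
  exact_mod_cast (by omega : l + 1 ≤ k)

theorem specNorm_hankel_block_le (S : LinSys n m r) {ψ ρ b c : ℝ}
    (hA : ∀ t : ℕ, specNorm (S.A ^ t) ≤ ψ * ρ ^ t) (hB : specNorm S.B ≤ b)
    (hC : specNorm S.C ≤ c) (l : ℕ) :
    specNorm (S.C * S.A ^ l * S.B) ≤ c * ψ * b * ρ ^ l := by
  have hb : 0 ≤ b := (specNorm_nonneg _).trans hB
  have hc : 0 ≤ c := (specNorm_nonneg _).trans hC
  calc specNorm (S.C * S.A ^ l * S.B)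
      ≤ specNorm S.C * specNorm (S.A ^ l) * specNorm S.B :=
        (specNorm_mul_le _ _).trans
          (mul_le_mul_of_nonneg_right (specNorm_mul_le _ _) (specNorm_nonneg _))
    _ ≤ c * (ψ * ρ ^ l) * b :=
        mul_le_mul (mul_le_mul hC (hA l) (specNorm_nonneg _) hc) hB (specNorm_nonneg _)
          (mul_nonneg hc ((specNorm_nonneg _).trans (hA l)))
    _ = _ := by ring

/-- The error of the estimated Hankel matrix: the neglected blocks contribute the first summand,
the estimated ones the second, since a block of the Markov parameter matrix occurs at most `k`
times in the Hankel matrix. -/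
theorem infSpecNorm_sub_estHankel_le (S : LinSys n m r) {ψ ρ b c : ℝ} (hψ : 0 ≤ ψ) (h0 : 0 ≤ ρ)
    (h1 : ρ < 1) (hA : ∀ t : ℕ, specNorm (S.A ^ t) ≤ ψ * ρ ^ t) (hB : specNorm S.B ≤ b)
    (hC : specNorm S.C ≤ c) (hk : 2 ≤ k) (G : Matrix (Fin r) (Fin k × Fin m) ℝ) :
    infSpecNorm (S.hankel - estHankel G) ≤
      ENNReal.ofReal (3 * (c * ψ * b) * (ρ ^ ((k : ℝ) / 2) / (1 - ρ ^ 2))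
        + Real.sqrt k * frobNorm (S.markov k - G)) := by
  have hb : 0 ≤ b := (specNorm_nonneg _).trans hB
  have hc : 0 ≤ c := (specNorm_nonneg _).trans hC
  obtain ⟨F, hF⟩ : ∃ F, F = S.markov k - G := ⟨_, rfl⟩
  rw [← hF]
  obtain ⟨a, ha⟩ : ∃ a, a = c * ψ * b := ⟨_, rfl⟩
  have ha0 : 0 ≤ a := by rw [ha]; positivity
  -- `h (i + j)` bounds the norm of the block in position `(i, j)`
  obtain ⟨h, hh⟩ : ∃ h : ℕ → ℝ, h = fun l => if l < k - 1 then frobNorm (block F (l + 1)) else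
    a * ρ ^ l := ⟨_, rfl⟩
  have hlt : ∀ l, l < k - 1 → h l = frobNorm (block F (l + 1)) := fun l hl => by
    rw [hh]; exact if_pos hl
  have hge : ∀ l, ¬ l < k - 1 → h l = a * ρ ^ l := fun l hl => by
    rw [hh]; exact if_neg hl
  have hblocks : ∀ i j, specNorm (fun a b => (S.hankel - estHankel G) (i, a) (j, b) :
      Matrix (Fin r) (Fin m) ℝ) ≤ h (i + j) := by
    intro i j
    by_cases hl : i + j < k - 1
    · rw [hlt _ hl]
      refine le_of_eq_of_le ?_ (specNorm_le_frobNorm _)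
      congr 1
      ext a b
      simp [hF, block, LinSys.hankel, estHankel, LinSys.markov, show i + j + 1 < k by omega]
    · rw [hge _ hl, ha]
      have e : (fun a b => (S.hankel - estHankel G) (i, a) (j, b) : Matrix (Fin r) (Fin m) ℝ) =
          S.C * S.A ^ (i + j) * S.B := by
        ext a b
        simp [block, LinSys.hankel, estHankel, show ¬ (i + j + 1 < k) by omega]
      rw [e]
      exact specNorm_hankel_block_le S hA hB hC _
  refine (infSpecNorm_le_of_blocks _ (fun i j => h (i + j)) hblocks).trans ?_
  rw [← ha]
  obtain ⟨P, hP⟩ : ∃ P, P = 3 * a * (ρ ^ ((k : ℝ) / 2) / (1 - ρ ^ 2)) := ⟨_, rfl⟩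
  obtain ⟨Q, hQ⟩ : ∃ Q, Q = Real.sqrt k * frobNorm F := ⟨_, rfl⟩
  rw [← hP, ← hQ]
  have hP0 : 0 ≤ P := by
    have : 0 ≤ 1 - ρ ^ 2 := by nlinarith
    rw [hP]; positivity
  have hQ0 : 0 ≤ Q := hQ ▸ mul_nonneg (Real.sqrt_nonneg _) (frobNorm_nonneg _)
  refine rpow_half_le_ofReal_add hP0 hQ0 ?_
  refine (tsum_tsum_add_eq (fun l => ENNReal.ofReal (h l ^ 2)) (k - 1)).le.trans
    (add_le_add ?_ ?_)
  · simp_rw [natCast_add_one_mul_ofReal]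
    rw [← ENNReal.ofReal_sum_of_nonneg fun _ _ => by positivity, hQ]
    refine ENNReal.ofReal_le_ofReal (le_of_eq_of_le (Finset.sum_congr rfl fun l hl => ?_)
      (sum_succ_mul_block_le F (by omega)))
    rw [hlt l (Finset.mem_range.1 hl)]
  · have e : ∀ l : ℕ, (((l + (k - 1) : ℕ) : ℝ≥0∞) + 1) *
        ENNReal.ofReal (h (l + (k - 1)) ^ 2) = ENNReal.ofReal (a ^ 2) *
          ENNReal.ofReal ((((l + (k - 1) : ℕ) : ℝ) + 1) * (ρ ^ (l + (k - 1))) ^ 2) := by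
      intro l
      rw [natCast_add_one_mul_ofReal, hge _ (by omega), ← ENNReal.ofReal_mul (sq_nonneg _)]
      congr 1
      ring
    rw [tsum_congr e, ENNReal.tsum_mul_left]
    refine (mul_le_mul_right (tsum_geometric_tail_le h0 h1 hk) _).trans ?_
    rw [← ENNReal.ofReal_mul (sq_nonneg _), ← mul_pow]
    refine ENNReal.ofReal_le_ofReal (le_of_eq ?_)
    rw [hP]; ring

end Blocks

/-! ### Trajectories -/

section Trajectory

variable {n m r k : ℕ} (S : LinSys n m r) (x₀ : Fin n → ℝ) (u : ℕ → Fin m → ℝ)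
  (w : ℕ → Fin n → ℝ)

theorem state_add (s l : ℕ) : S.state x₀ u w (s + l) = (S.A ^ l).mulVec (S.state x₀ u w s) +
    ∑ i ∈ Finset.range l, (S.A ^ (l - 1 - i)).mulVec (S.B.mulVec (u (s + i)) + w (s + i)) := by
  induction l with
  | zero => simp
  | succ l ih =>
    have e : ∑ i ∈ Finset.range l,
        (S.A ^ (l - i)).mulVec (S.B.mulVec (u (s + i)) + w (s + i)) =
        S.A.mulVec (∑ i ∈ Finset.range l,
          (S.A ^ (l - 1 - i)).mulVec (S.B.mulVec (u (s + i)) + w (s + i))) := by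
      rw [Matrix.mulVec_sum]
      refine Finset.sum_congr rfl fun i hi => ?_
      have := Finset.mem_range.1 hi
      rw [Matrix.mulVec_mulVec, ← pow_succ', show l - 1 - i + 1 = l - i by omega]
    rw [← add_assoc, LinSys.state, ih, Finset.sum_range_succ, Nat.add_sub_cancel, e,
      Matrix.mulVec_add, Matrix.mulVec_mulVec, ← pow_succ', Nat.sub_self, pow_zero,
      Matrix.one_mulVec]
    abel

theorem markov_mulVec_stackedInput (hk : 0 < k) (s : ℕ) :
    (S.markov k).mulVec (stackedInput k u (s + (k - 1))) = S.D.mulVec (u (s + (k - 1))) +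
      S.C.mulVec (∑ i ∈ Finset.range (k - 1),
        (S.A ^ (k - 1 - 1 - i)).mulVec (S.B.mulVec (u (s + i)))) := by
  obtain ⟨l, rfl⟩ : ∃ l, k = l + 1 := ⟨k - 1, by omega⟩
  rw [Nat.add_sub_cancel, ← Finset.sum_range_reflect, Matrix.mulVec_sum]
  have e : ∀ j ∈ Finset.range l, S.C.mulVec ((S.A ^ (l - 1 - (l - 1 - j))).mulVec
      (S.B.mulVec (u (s + (l - 1 - j))))) = (S.C * S.A ^ j * S.B).mulVec (u (s + l - (j + 1))) := by
    intro j hj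
    have := Finset.mem_range.1 hj
    rw [Matrix.mulVec_mulVec, Matrix.mulVec_mulVec, show l - 1 - (l - 1 - j) = j by omega,
      show s + (l - 1 - j) = s + l - (j + 1) by omega]
  rw [Finset.sum_congr rfl e]
  ext i
  simp only [Matrix.mulVec, dotProduct, Fintype.sum_prod_type, Fin.sum_univ_succ, Pi.add_apply,
    Finset.sum_apply, LinSys.markov, stackedInput]
  simp [← Fin.sum_univ_eq_sum_range
    (fun j => ∑ a, (S.C * S.A ^ j * S.B) i a * u (s + l - (j + 1)) a)]

/-- The part of the observation at time `s + k - 1` that the last `k` inputs do not account for: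
the contributions of the state at time `s` and of the attacks since then. -/
def residual (k s : ℕ) : Fin r → ℝ :=
  S.C.mulVec ((S.A ^ (k - 1)).mulVec (S.state x₀ u w s) +
    ∑ i ∈ Finset.range (k - 1), (S.A ^ (k - 1 - 1 - i)).mulVec (w (s + i)))

theorem output_eq (hk : 0 < k) (s : ℕ) : S.output x₀ u w (s + (k - 1)) =
    (S.markov k).mulVec (stackedInput k u (s + (k - 1))) + residual S x₀ u w k s := by
  rw [LinSys.output, state_add, markov_mulVec_stackedInput S u hk, residual]
  simp only [Matrix.mulVec_add, Finset.sum_add_distrib]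
  abel

/-- A scalar recursion that dominates the norm of the state if `‖A ^ t‖ ≤ ψ ρ ^ t` and `‖B‖ ≤ b`,
with `X`, `U t`, `W t` the norms of the initial state, the inputs and the attacks. -/
def stateBound (ψ ρ b X : ℝ) (U W : ℕ → ℝ) : ℕ → ℝ
  | 0 => ψ * X
  | t + 1 => ρ * stateBound ψ ρ b X U W t + ψ * (b * U t + W t)

theorem stateBound_nonneg {ψ ρ b X : ℝ} {U W : ℕ → ℝ} (hψ : 0 ≤ ψ) (h0 : 0 ≤ ρ) (hb : 0 ≤ b)
    (hX : 0 ≤ X) (hU : ∀ t, 0 ≤ U t) (hW : ∀ t, 0 ≤ W t) (t : ℕ) :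
    0 ≤ stateBound ψ ρ b X U W t := by
  induction t with
  | zero => exact mul_nonneg hψ hX
  | succ t ih =>
    have := hU t
    have := hW t
    rw [stateBound]; positivity

theorem sum_stateBound_le {ψ ρ b X : ℝ} {U W : ℕ → ℝ} (hψ : 0 ≤ ψ) (h0 : 0 ≤ ρ) (h1 : ρ < 1)
    (hb : 0 ≤ b) (hX : 0 ≤ X) (hU : ∀ t, 0 ≤ U t) (hW : ∀ t, 0 ≤ W t) (T : ℕ) :
    ∑ t ∈ Finset.range T, stateBound ψ ρ b X U W t ≤
      ψ * (X + (b * ∑ t ∈ Finset.range T, U t + ∑ t ∈ Finset.range T, W t)) / (1 - ρ) := by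
  have key : (1 - ρ) * ∑ t ∈ Finset.range T, stateBound ψ ρ b X U W t +
      stateBound ψ ρ b X U W T =
      ψ * (X + (b * ∑ t ∈ Finset.range T, U t + ∑ t ∈ Finset.range T, W t)) := by
    induction T with
    | zero => simp [stateBound]
    | succ T ih =>
      simp only [Finset.sum_range_succ, stateBound]
      linear_combination ih
  have := stateBound_nonneg hψ h0 hb hX hU hW T
  rw [le_div_iff₀ (by linarith)]
  linarith

variable {S} {x₀ u w}

/-- Bounding `A ^ j x_s` for all `j` at once keeps the constant `ψ` from being compounded in the
induction on `s`. -/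
theorem vecNorm_pow_mulVec_state_le {ψ ρ b : ℝ}
    (hA : ∀ t : ℕ, specNorm (S.A ^ t) ≤ ψ * ρ ^ t) (hB : specNorm S.B ≤ b) (s j : ℕ) :
    vecNorm ((S.A ^ j).mulVec (S.state x₀ u w s)) ≤
      ρ ^ j * stateBound ψ ρ b (vecNorm x₀) (fun t => vecNorm (u t))
        (fun t => vecNorm (w t)) s := by
  induction s generalizing j with
  | zero =>
    refine (vecNorm_mulVec_le _ _).trans ?_
    rw [LinSys.state, stateBound]
    calc _ ≤ ψ * ρ ^ j * vecNorm x₀ := mul_le_mul_of_nonneg_right (hA j) (vecNorm_nonneg _)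
      _ = _ := by ring
  | succ s ih =>
    have e : (S.A ^ j).mulVec (S.state x₀ u w (s + 1)) =
        (S.A ^ (j + 1)).mulVec (S.state x₀ u w s) +
          (S.A ^ j).mulVec (S.B.mulVec (u s) + w s) := by
      rw [LinSys.state, add_assoc, Matrix.mulVec_add, Matrix.mulVec_mulVec, ← pow_succ]
    have h2 : vecNorm (S.B.mulVec (u s) + w s) ≤ b * vecNorm (u s) + vecNorm (w s) :=
      (vecNorm_add_le _ _).trans (add_le_add ((vecNorm_mulVec_le _ _).trans
        (mul_le_mul_of_nonneg_right hB (vecNorm_nonneg _))) le_rfl)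
    have h3 : vecNorm ((S.A ^ j).mulVec (S.B.mulVec (u s) + w s)) ≤
        ψ * ρ ^ j * (b * vecNorm (u s) + vecNorm (w s)) :=
      (vecNorm_mulVec_le _ _).trans
        (mul_le_mul (hA j) h2 (vecNorm_nonneg _) ((specNorm_nonneg _).trans (hA j)))
    rw [e, stateBound]
    refine (vecNorm_add_le _ _).trans ((add_le_add (ih (j + 1)) h3).trans (le_of_eq ?_))
    ring

theorem sampleLoss_eq (hk : 0 < k) (s : ℕ) (G : Matrix (Fin r) (Fin k × Fin m) ℝ) :
    sampleLoss u (S.output x₀ u w) (s + (k - 1)) G =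
      vecNorm ((S.markov k - G).mulVec (stackedInput k u (s + (k - 1))) +
        residual S x₀ u w k s) := by
  rw [sampleLoss, output_eq S x₀ u w hk, Matrix.sub_mulVec]
  congr 1
  abel

/-- On an attack-free window the loss grows with the distance from the true parameters up to the
contribution of the old state, and on any window it decreases at most at that rate. -/
theorem sampleLoss_sub_ge {ψ ρ b c : ℝ} (hψ : 0 ≤ ψ) (h0 : 0 ≤ ρ)
    (hA : ∀ t : ℕ, specNorm (S.A ^ t) ≤ ψ * ρ ^ t) (hB : specNorm S.B ≤ b)
    (hC : specNorm S.C ≤ c) (hk : 0 < k) (s : ℕ) (G : Matrix (Fin r) (Fin k × Fin m) ℝ) {τ : ℝ}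
    (hτ : τ = -1 ∨ (τ = 1 ∧ ∀ i < k - 1, w (s + i) = 0)) :
    τ * vecNorm ((S.markov k - G).mulVec (stackedInput k u (s + (k - 1)))) -
        2 * (c * ρ ^ (k - 1) * stateBound ψ ρ b (vecNorm x₀) (fun t => vecNorm (u t))
          (fun t => vecNorm (w t)) s) ≤
      sampleLoss u (S.output x₀ u w) (s + (k - 1)) G -
        sampleLoss u (S.output x₀ u w) (s + (k - 1)) (S.markov k) := by
  have hb : 0 ≤ b := (specNorm_nonneg _).trans hB
  have hc : 0 ≤ c := (specNorm_nonneg _).trans hC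
  rw [sampleLoss_eq hk, sampleLoss_eq hk, sub_self, Matrix.zero_mulVec, zero_add]
  set v := (S.markov k - G).mulVec (stackedInput k u (s + (k - 1)))
  have hSB := stateBound_nonneg hψ h0 hb (vecNorm_nonneg x₀) (fun t => vecNorm_nonneg (u t))
    (fun t => vecNorm_nonneg (w t)) s
  have hpos := mul_nonneg (mul_nonneg hc (pow_nonneg h0 (k - 1))) hSB
  rcases hτ with rfl | ⟨rfl, hw⟩
  · have := vecNorm_sub_le (v + residual S x₀ u w k s) v
    rw [add_sub_cancel_left] at this
    linarith
  · have hres : vecNorm (residual S x₀ u w k s) ≤ c * ρ ^ (k - 1) *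
        stateBound ψ ρ b (vecNorm x₀) (fun t => vecNorm (u t)) (fun t => vecNorm (w t)) s := by
      rw [residual, Finset.sum_eq_zero (fun i hi => by
        rw [hw i (Finset.mem_range.1 hi), Matrix.mulVec_zero]), add_zero, mul_assoc]
      exact (vecNorm_mulVec_le _ _).trans (mul_le_mul hC (vecNorm_pow_mulVec_state_le hA hB s _)
        (vecNorm_nonneg _) hc)
    have := vecNorm_sub_le (v + residual S x₀ u w k s) (residual S x₀ u w k s)
    rw [add_sub_cancel_right] at this
    linarith

end Trajectory

/-! ### Projected subgradient steps -/

section Subgradient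

variable {ι κ : Type*} [Fintype ι] [Fintype κ]

/-- A subgradient of a function with Lipschitz constant `L` has norm at most `L`. -/
theorem frobNorm_le_of_isSubgradient {f : Matrix ι κ ℝ → ℝ} {G g : Matrix ι κ ℝ} {L : ℝ}
    (hL : 0 ≤ L) (hg : IsSubgradient f G g)
    (hf : ∀ H, f (G + H) - f G ≤ L * frobNorm H) : frobNorm g ≤ L := by
  have h := hg (G + g)
  rw [add_sub_cancel_left] at h
  have e : frobInner g g = frobNorm g ^ 2 := by
    rw [frobNorm_eq_norm, frobInner_eq_inner, real_inner_self_eq_norm_sq]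
  have := hf g
  have := frobNorm_nonneg g
  by_contra! hlt
  nlinarith

theorem frobNorm_le_of_isSubgradient_sampleLoss {k m r : ℕ} {u : ℕ → Fin m → ℝ}
    {y : ℕ → Fin r → ℝ} {t : ℕ} {G g : Matrix (Fin r) (Fin k × Fin m) ℝ}
    (hg : IsSubgradient (sampleLoss u y t) G g) : frobNorm g ≤ vecNorm (stackedInput k u t) := by
  refine frobNorm_le_of_isSubgradient (vecNorm_nonneg _) hg fun H => ?_
  have h := vecNorm_sub_le (y t - G.mulVec (stackedInput k u t)) (H.mulVec (stackedInput k u t))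
  have h' := vecNorm_mulVec_le_frobNorm H (stackedInput k u t)
  rw [sub_sub, ← Matrix.add_mulVec] at h
  simp only [sampleLoss]
  linarith

/-- The Frobenius-nearest point to `X` in the ball of radius `R`. The explicit formula serves to
show that the iterates are measurable. -/
def ballProj (R : ℝ) (X : Matrix ι κ ℝ) : Matrix ι κ ℝ :=
  if frobNorm X ≤ R then X else (R / frobNorm X) • X

theorem eq_ballProj_of_isProjection {R : ℝ} (hR : 0 ≤ R) {X P : Matrix ι κ ℝ}
    (h : IsProjection {H | frobNorm H ≤ R} X P) : P = ballProj R X := by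
  obtain ⟨hP, hmin⟩ := h
  have inj : ∀ M : Matrix ι κ ℝ, frobNorm M ≤ 0 → M = 0 := by
    intro M hM
    rw [frobNorm_eq_norm, norm_le_zero_iff] at hM
    ext i j
    simpa [flatten] using congrArg (fun v : EuclideanSpace ℝ (ι × κ) => v (i, j)) hM
  rw [ballProj]
  split_ifs with hX
  · have := hmin X hX
    rw [sub_self, frobNorm_zero] at this
    exact (sub_eq_zero.1 (inj _ this)).symm
  · push Not at hX
    have hXpos : 0 < frobNorm X := hR.trans_lt hX
    rw [← sub_eq_zero]
    apply inj
    have hX0 := hmin ((R / frobNorm X) • X) (by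
      simp only [Set.mem_ofPred_eq, frobNorm_eq_norm, flatten_smul, norm_smul]
      rw [← frobNorm_eq_norm, Real.norm_of_nonneg (by positivity)]
      exact (div_mul_cancel₀ _ hXpos.ne').le)
    simp only [Set.mem_ofPred_eq, frobNorm_eq_norm, flatten_sub, flatten_smul] at *
    set x := flatten X
    set p := flatten P
    have e : ‖x - (R / ‖x‖) • x‖ = ‖x‖ - R := by
      have : x - (R / ‖x‖) • x = (1 - R / ‖x‖) • x := by rw [sub_smul, one_smul]
      rw [this, norm_smul, Real.norm_of_nonneg
        (by rw [sub_nonneg, div_le_one hXpos]; exact hX.le)]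
      field_simp
    rw [e] at hX0
    have h1 : ‖x - p‖ ^ 2 ≤ (‖x‖ - R) ^ 2 := pow_le_pow_left₀ (norm_nonneg _) hX0 2
    rw [norm_sub_sq_real] at h1
    have h2 : ‖p - (R / ‖x‖) • x‖ ^ 2 = ‖p‖ ^ 2 - 2 * (R / ‖x‖) * inner ℝ x p + R ^ 2 := by
      rw [norm_sub_sq_real, inner_smul_right, norm_smul, Real.norm_of_nonneg (by positivity),
        div_mul_cancel₀ _ hXpos.ne', real_inner_comm]
      ring
    have hR1 : R / ‖x‖ ≤ 1 := (div_le_one hXpos).2 hX.le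
    have hR0 : 0 ≤ R / ‖x‖ := by positivity
    have hRx : R / ‖x‖ * ‖x‖ = R := div_mul_cancel₀ _ hXpos.ne'
    have hp : ‖p‖ ^ 2 ≤ R ^ 2 := pow_le_pow_left₀ (norm_nonneg _) hP 2
    have h3 : ‖p - (R / ‖x‖) • x‖ ^ 2 ≤ 0 := by
      rw [h2]
      have h4 : R / ‖x‖ * (2 * R * ‖x‖ + ‖p‖ ^ 2 - R ^ 2) ≤ R / ‖x‖ * (2 * inner ℝ x p) :=
        mul_le_mul_of_nonneg_left (by linarith) hR0
      have h5 : (‖p‖ ^ 2 - R ^ 2) * (1 - R / ‖x‖) ≤ 0 :=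
        mul_nonpos_of_nonpos_of_nonneg (by linarith) (by linarith)
      nlinarith
    nlinarith [norm_nonneg (p - (R / ‖x‖) • x)]

theorem frobNorm_ballProj_sub_le {R : ℝ} {X P H : Matrix ι κ ℝ}
    (h : IsProjection {H | frobNorm H ≤ R} X P) (hH : frobNorm H ≤ R) :
    frobNorm (P - H) ≤ frobNorm (X - H) := by
  obtain ⟨hP, hmin⟩ := h
  simp only [Set.mem_ofPred_eq, frobNorm_eq_norm, flatten_sub] at *
  set x := flatten X
  set p := flatten P
  set y := flatten H
  have hinner : inner ℝ (x - p) (y - p) ≤ 0 := by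
    by_contra! hpos
    -- moving from `p` a little towards `y` would bring the point closer to `x`
    have hyp : 0 < ‖y - p‖ ^ 2 := by
      have : y - p ≠ 0 := fun h => by simp [h] at hpos
      positivity
    set a := inner ℝ (x - p) (y - p)
    set θ := min 1 (a / ‖y - p‖ ^ 2)
    have hθ0 : 0 < θ := lt_min one_pos (div_pos hpos hyp)
    have hθ1 : θ ≤ 1 := min_le_left _ _
    have hθ : θ * ‖y - p‖ ^ 2 ≤ a :=
      (le_div_iff₀ hyp).1 (min_le_right _ _)
    have hq := hmin ((1 - θ) • P + θ • H) (by
      have : flatten ((1 - θ) • P + θ • H) = (1 - θ) • p + θ • y := rfl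
      rw [this]
      refine (norm_add_le _ _).trans ?_
      rw [norm_smul, norm_smul, Real.norm_of_nonneg (by linarith), Real.norm_of_nonneg hθ0.le]
      nlinarith)
    have e : flatten ((1 - θ) • P + θ • H) = p + θ • (y - p) := by
      have : flatten ((1 - θ) • P + θ • H) = (1 - θ) • p + θ • y := rfl
      rw [this]; module
    rw [e, ← sub_sub] at hq
    have hq2 := pow_le_pow_left₀ (norm_nonneg _) hq 2
    rw [norm_sub_sq_real (x - p), inner_smul_right, norm_smul, Real.norm_of_nonneg hθ0.le] at hq2
    nlinarith
  have e : x - y = (x - p) - (y - p) := by abel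
  have h2 : ‖x - y‖ ^ 2 = ‖x - p‖ ^ 2 - 2 * inner ℝ (x - p) (y - p) + ‖y - p‖ ^ 2 := by
    rw [e, norm_sub_sq_real]
  rw [norm_sub_rev p y]
  apply le_of_sq_le_sq _ (norm_nonneg _)
  nlinarith [sq_nonneg ‖x - p‖]

/-- One projected subgradient step with step size `α`. -/
theorem frobNorm_step_sq_le {R α : ℝ} (hα : 0 ≤ α) {f : Matrix ι κ ℝ → ℝ}
    {G g P H : Matrix ι κ ℝ}
    (hg : IsSubgradient f G g) (hP : IsProjection {H | frobNorm H ≤ R} (G - α • g) P)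
    (hH : frobNorm H ≤ R) :
    frobNorm (P - H) ^ 2 ≤ frobNorm (G - H) ^ 2 - 2 * α * (f G - f H) + α ^ 2 * frobNorm g ^ 2 := by
  refine (pow_le_pow_left₀ (frobNorm_nonneg _) (frobNorm_ballProj_sub_le hP hH) 2).trans ?_
  have h := hg H
  rw [frobInner_eq_inner, flatten_sub] at h
  simp only [frobNorm_eq_norm, flatten_sub, flatten_smul]
  rw [sub_right_comm, norm_sub_sq_real, inner_smul_right, norm_smul, Real.norm_of_nonneg hα,
    real_inner_comm]
  have e : inner ℝ (flatten g) (flatten G - flatten H) =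
      -inner ℝ (flatten g) (flatten H - flatten G) := by
    rw [← inner_neg_right, neg_sub]
  rw [e]
  nlinarith

end Subgradient

/-! ### Gaussian random variables -/

section Gaussian

theorem integral_abs_gaussianReal {a : ℝ} (ha : 0 ≤ a) :
    ∫ x, |x| ∂(gaussianReal 0 (Real.toNNReal (a ^ 2))) = Real.sqrt (2 / Real.pi) * a := by
  rcases ha.eq_or_lt with rfl | ha
  · simp [gaussianReal_zero_var]
  have hv : Real.toNNReal (a ^ 2) ≠ 0 := by
    rw [Ne, Real.toNNReal_eq_zero, not_le]; positivity
  rw [integral_gaussianReal_eq_integral_smul hv]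
  obtain ⟨f, hf⟩ : ∃ f : ℝ → ℝ, f = fun y => (Real.sqrt (2 * Real.pi * a ^ 2))⁻¹ *
      (y ^ (1 : ℝ) * Real.exp (-(1 / (2 * a ^ 2)) * y ^ (2 : ℝ))) := ⟨_, rfl⟩
  have h1 : ∀ x : ℝ, gaussianPDFReal 0 (Real.toNNReal (a ^ 2)) x • |x| = f |x| := by
    intro x
    simp only [hf, gaussianPDFReal, smul_eq_mul, Real.coe_toNNReal _ (sq_nonneg a), sub_zero,
      Real.rpow_one, Real.rpow_two, sq_abs]
    rw [show -x ^ 2 / (2 * a ^ 2) = -(1 / (2 * a ^ 2)) * x ^ 2 by ring]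
    ring
  rw [integral_congr_ae (Filter.Eventually.of_forall h1), integral_comp_abs,
    hf, integral_const_mul, integral_rpow_mul_exp_neg_mul_rpow (by norm_num) (by norm_num)
      (by positivity)]
  rw [show (-((1 : ℝ) + 1) / 2) = -1 by norm_num, show ((1 : ℝ) + 1) / 2 = 1 by norm_num,
    Real.Gamma_one, Real.rpow_neg_one, one_div, inv_inv, Real.sqrt_mul (by positivity),
    Real.sqrt_sq ha.le, Real.sqrt_div (by norm_num), Real.sqrt_mul (by norm_num)]
  have h2 : Real.sqrt 2 * Real.sqrt 2 = 2 := Real.mul_self_sqrt (by norm_num)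
  have h3 : 0 < Real.sqrt 2 := by positivity
  have h4 : 0 < Real.sqrt Real.pi := Real.sqrt_pos.2 Real.pi_pos
  field_simp
  nlinarith

variable {Ω : Type*} [MeasurableSpace Ω] {μ : Measure Ω}

theorem integrable_of_map_gaussianReal {X : Ω → ℝ} (hm : Measurable X) {v : NNReal}
    (h : μ.map X = gaussianReal 0 v) {f : ℝ → ℝ} (hf : Integrable f (gaussianReal 0 v)) :
    Integrable (fun ω => f (X ω)) μ := by
  rw [← h] at hf
  exact (integrable_map_measure hf.aestronglyMeasurable hm.aemeasurable).1 hf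

theorem integrable_exp_mul_of_map_gaussianReal {X : Ω → ℝ} (hm : Measurable X) {v : NNReal}
    (h : μ.map X = gaussianReal 0 v) (t : ℝ) : Integrable (fun ω => Real.exp (t * X ω)) μ :=
  integrable_of_map_gaussianReal hm h (integrable_exp_mul_gaussianReal t)

theorem integrable_abs_of_map_gaussianReal {X : Ω → ℝ} (hm : Measurable X) {v : NNReal}
    (h : μ.map X = gaussianReal 0 v) : Integrable (fun ω => |X ω|) μ :=
  (integrable_of_map_gaussianReal hm h
    ((memLp_id_gaussianReal 1).integrable le_rfl)).abs

theorem integral_abs_of_map_gaussianReal {X : Ω → ℝ} (hm : Measurable X) {a : ℝ} (ha : 0 ≤ a)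
    (h : μ.map X = gaussianReal 0 (Real.toNNReal (a ^ 2))) :
    ∫ ω, |X ω| ∂μ = Real.sqrt (2 / Real.pi) * a := by
  rw [← integral_abs_gaussianReal ha, ← h, integral_map hm.aemeasurable]
  exact measurable_abs.aestronglyMeasurable

theorem integrable_vecNorm_of_dotProduct {κ : Type*} [Fintype κ] {U : Ω → κ → ℝ} (hU : Measurable U)
    (hi : ∀ z, Integrable (fun ω => |z ⬝ᵥ U ω|) μ) : Integrable (fun ω => vecNorm (U ω)) μ := by
  classical
  refine Integrable.mono' (g := fun ω => ∑ c, |Pi.single c 1 ⬝ᵥ U ω|)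
    (integrable_finsetSum _ fun c _ => hi _)
    (measurable_vecNorm.comp hU).aestronglyMeasurable
    (Filter.Eventually.of_forall fun ω => ?_)
  rw [Real.norm_of_nonneg (vecNorm_nonneg _)]
  simpa using vecNorm_le_sum_abs (U ω)

/-- A lower bound for the mean of `‖M U‖₂`. The rows `M i` of `M` are weighted by
`‖M i‖₂ / ‖M‖_F`, which reduces the claim to the scalar variables `⟨M i, U⟩`. -/
theorem mul_frobNorm_le_integral_vecNorm {ι κ : Type*} [Fintype ι] [Fintype κ] {U : Ω → κ → ℝ}
    (hU : Measurable U)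
    (hi : ∀ z, Integrable (fun ω => |z ⬝ᵥ U ω|) μ) {C : ℝ}
    (hC : ∀ z, ∫ ω, |z ⬝ᵥ U ω| ∂μ = C * vecNorm z) (M : Matrix ι κ ℝ) :
    C * frobNorm M ≤ ∫ ω, vecNorm (M.mulVec (U ω)) ∂μ := by
  rcases (frobNorm_nonneg M).eq_or_lt with h0 | hpos
  · rw [← h0, mul_zero]
    exact integral_nonneg fun ω => vecNorm_nonneg _
  have hmv : Measurable fun ω => vecNorm (M.mulVec (U ω)) := by
    refine measurable_vecNorm.comp ?_
    unfold Matrix.mulVec dotProduct; fun_prop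
  have hle : ∑ i, vecNorm (M i) * ∫ ω, |M i ⬝ᵥ U ω| ∂μ ≤
      frobNorm M * ∫ ω, vecNorm (M.mulVec (U ω)) ∂μ := by
    have hi' : ∀ i, Integrable (fun ω => vecNorm (M i) * |M i ⬝ᵥ U ω|) μ :=
      fun i => (hi _).const_mul _
    simp_rw [← integral_const_mul]
    rw [← integral_finsetSum Finset.univ fun i _ => hi' i]
    refine integral_mono (integrable_finsetSum _ fun i _ => hi' i) ?_ fun ω => ?_
    · refine (((integrable_vecNorm_of_dotProduct hU hi).const_mul (frobNorm M)).mono'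
        hmv.aestronglyMeasurable (Filter.Eventually.of_forall fun ω => ?_)).const_mul _
      rw [Real.norm_of_nonneg (vecNorm_nonneg _)]
      exact vecNorm_mulVec_le_frobNorm _ _
    · apply le_of_sq_le_sq _ (mul_nonneg hpos.le (vecNorm_nonneg _))
      rw [mul_pow, frobNorm_sq_rows, vecNorm_sq]
      refine (Finset.sum_mul_sq_le_sq_mul_sq _ _ _).trans (le_of_eq ?_)
      simp [Matrix.mulVec]
  simp_rw [hC] at hle
  have e : ∑ i, vecNorm (M i) * (C * vecNorm (M i)) = frobNorm M * (C * frobNorm M) := by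
    have : frobNorm M * (C * frobNorm M) = C * frobNorm M ^ 2 := by ring
    rw [this, frobNorm_sq_rows, Finset.mul_sum]
    exact Finset.sum_congr rfl fun i _ => by ring
  rw [e] at hle
  exact le_of_mul_le_mul_left hle hpos

variable [IsProbabilityMeasure μ]

theorem map_sum_gaussianReal {ι : Type*} {X : ι → Ω → ℝ} (hX : iIndepFun X μ)
    (hm : ∀ i, Measurable (X i)) {v : ι → NNReal} (hv : ∀ i, μ.map (X i) = gaussianReal 0 (v i))
    (s : Finset ι) : μ.map (∑ i ∈ s, X i) = gaussianReal 0 (∑ i ∈ s, v i) := by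
  classical
  induction s using Finset.induction_on with
  | empty => simp [gaussianReal_zero_var, Measure.map_const, Pi.zero_def]
  | insert i s hi ih =>
    rw [Finset.sum_insert hi, Finset.sum_insert hi]
    have := gaussianReal_add_gaussianReal_of_indepFun
      (hX.indepFun_finsetSum_of_notMem hm hi).symm (hv i) ih
    rwa [add_zero] at this

/-- The exponential moment of a Gaussian variable's absolute value with an independent random
sign. It equals `E cosh (l X) - E τ · E sinh (l |X|)`, and `sinh x ≥ x`. -/
theorem integral_exp_neg_sign_mul_abs_le {X τ : Ω → ℝ} (hX : Measurable X) (hτm : Measurable τ)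
    (hind : IndepFun X τ μ) (hτ : ∀ ω, τ ω = 1 ∨ τ ω = -1) {a : ℝ} (ha : 0 ≤ a)
    (hlaw : μ.map X = gaussianReal 0 (Real.toNNReal (a ^ 2))) {l : ℝ} (hl : 0 ≤ l)
    (hθ : 0 ≤ ∫ ω, τ ω ∂μ) :
    Integrable (fun ω => Real.exp (-l * (τ ω * |X ω|))) μ ∧
    ∫ ω, Real.exp (-l * (τ ω * |X ω|)) ∂μ ≤
      Real.exp (a ^ 2 * l ^ 2 / 2) - l * (∫ ω, τ ω ∂μ) * (Real.sqrt (2 / Real.pi) * a) := by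
  have hexp := integrable_exp_mul_of_map_gaussianReal hX hlaw
  have habs := integrable_abs_of_map_gaussianReal hX hlaw
  have e1 : ∀ ω, Real.exp (-l * (τ ω * |X ω|)) =
      Real.cosh (l * X ω) - τ ω * Real.sinh (l * |X ω|) := by
    intro ω
    have hc : Real.cosh (l * X ω) = Real.cosh (l * |X ω|) := by
      rw [← Real.cosh_abs, abs_mul, abs_of_nonneg hl]
    rw [hc]
    rcases hτ ω with h | h <;> rw [h]
    · rw [one_mul, one_mul, Real.cosh_sub_sinh, neg_mul]
    · rw [neg_one_mul, neg_one_mul, sub_neg_eq_add, Real.cosh_add_sinh, neg_mul_neg]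
  have hcosh : Integrable (fun ω => Real.cosh (l * X ω)) μ := by
    simp_rw [Real.cosh_eq]
    exact ((hexp l).add (by simpa using hexp (-l))).div_const 2
  have hsinh : Integrable (fun ω => Real.sinh (l * |X ω|)) μ := by
    simp_rw [Real.sinh_eq]
    refine ((integrable_exp_mul_abs (hexp l) (hexp (-l))).sub ?_).div_const 2
    have := integrable_exp_mul_abs (t := -l) (hexp (-l)) (by simpa using hexp l)
    simpa using this
  have hτi : Integrable τ μ := Integrable.of_bound hτm.aestronglyMeasurable 1
    (Filter.Eventually.of_forall fun ω => by rcases hτ ω with h | h <;> simp [h])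
  have hind' : IndepFun τ (fun ω => Real.sinh (l * |X ω|)) μ :=
    (hind.comp (φ := fun x => Real.sinh (l * |x|)) (ψ := id)
      (Real.measurable_sinh.comp (measurable_const.mul measurable_abs)) measurable_id).symm
  have hprod : Integrable (fun ω => τ ω * Real.sinh (l * |X ω|)) μ := hind'.integrable_mul hτi hsinh
  simp_rw [e1]
  refine ⟨hcosh.sub hprod, ?_⟩
  rw [integral_sub hcosh hprod,
    hind'.integral_fun_mul_eq_mul_integral hτi.aestronglyMeasurable hsinh.aestronglyMeasurable]
  have hmgf : ∀ t : ℝ, ∫ ω, Real.exp (t * X ω) ∂μ = Real.exp (a ^ 2 * t ^ 2 / 2) := fun t => by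
    have := mgf_gaussianReal hlaw t
    rw [Real.coe_toNNReal _ (sq_nonneg a), zero_mul, zero_add] at this
    exact this
  have h1 : ∫ ω, Real.cosh (l * X ω) ∂μ = Real.exp (a ^ 2 * l ^ 2 / 2) := by
    simp_rw [Real.cosh_eq]
    have h := hexp (-l)
    have h' := hmgf (-l)
    simp only [neg_mul] at h h'
    rw [integral_div, integral_add (hexp l) h, hmgf, h', neg_sq]
    ring
  have h2 : l * (Real.sqrt (2 / Real.pi) * a) ≤ ∫ ω, Real.sinh (l * |X ω|) ∂μ := by
    rw [← integral_abs_of_map_gaussianReal hX ha hlaw, ← integral_const_mul]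
    exact integral_mono (habs.const_mul l) hsinh
      fun ω => Real.self_le_sinh_iff.2 (mul_nonneg hl (abs_nonneg _))
  rw [h1]
  have := mul_le_mul_of_nonneg_left h2 hθ
  linarith

/-- Integrating out an independent variable gives a lower bound for an expectation. -/
theorem integral_le_integral_of_indepFun {α β : Type*} [MeasurableSpace α] [MeasurableSpace β]
    {X : Ω → α} {Y : Ω → β} (hX : Measurable X) (hY : Measurable Y) (hind : IndepFun X Y μ)
    {f : α × β → ℝ} (hf : Measurable f) (hfi : Integrable (fun ω => f (X ω, Y ω)) μ)
    {φ : α → ℝ} (hφ : Measurable φ) (hφi : Integrable (fun ω => φ (X ω)) μ)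
    (h : ∀ x, φ x ≤ ∫ ω, f (x, Y ω) ∂μ) :
    ∫ ω, φ (X ω) ∂μ ≤ ∫ ω, f (X ω, Y ω) ∂μ := by
  have hmap := (indepFun_iff_map_prod_eq_prod_map_map hX.aemeasurable hY.aemeasurable).1 hind
  have hfi' : Integrable f ((μ.map X).prod (μ.map Y)) := by
    rw [← hmap]
    exact (integrable_map_measure hf.aestronglyMeasurable (hX.prodMk hY).aemeasurable).2 hfi
  have e : ∫ ω, f (X ω, Y ω) ∂μ = ∫ x, ∫ y, f (x, y) ∂(μ.map Y) ∂(μ.map X) := by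
    rw [← integral_prod f hfi', ← hmap, integral_map (hX.prodMk hY).aemeasurable
      hf.aestronglyMeasurable]
  rw [e, ← integral_map hX.aemeasurable hφ.aestronglyMeasurable]
  refine integral_mono
    ((integrable_map_measure hφ.aestronglyMeasurable hX.aemeasurable).2 hφi)
    hfi'.integral_prod_left fun x => ?_
  refine (h x).trans (le_of_eq ?_)
  exact (integral_map hY.aemeasurable (f := fun y => f (x, y))
    (hf.comp measurable_prodMk_left).aestronglyMeasurable).symm

theorem map_dotProduct_gaussianReal {κ : Type*} [Fintype κ] {X : κ → Ω → ℝ} (hX : iIndepFun X μ)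
    (hm : ∀ c, Measurable (X c)) {σ : ℝ}
    (hlaw : ∀ c, μ.map (X c) = gaussianReal 0 (Real.toNNReal (σ ^ 2))) (z : κ → ℝ) :
    μ.map (fun ω => z ⬝ᵥ fun c => X c ω) =
      gaussianReal 0 (Real.toNNReal ((σ * vecNorm z) ^ 2)) := by
  have hind : iIndepFun (fun c ω => z c * X c ω) μ :=
    hX.comp (fun c x => z c * x) fun c => measurable_const_mul _
  have hsum := map_sum_gaussianReal hind (fun c => (hm c).const_mul _)
    (v := fun c => Real.toNNReal ((σ * z c) ^ 2)) (fun c => by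
      have e : (fun ω => z c * X c ω) = (fun x => z c * x) ∘ X c := rfl
      rw [e, ← Measure.map_map (measurable_const_mul _) (hm c), hlaw, gaussianReal_map_const_mul,
        mul_zero]
      congr 1
      ext
      rw [NNReal.coe_mul, Real.coe_toNNReal _ (sq_nonneg _), Real.coe_toNNReal _ (sq_nonneg _)]
      simp only [NNReal.coe_mk]
      ring) Finset.univ
  have e : (∑ c, fun ω => z c * X c ω) = fun ω => z ⬝ᵥ fun c => X c ω := by
    ext ω; simp [dotProduct]
  rw [e] at hsum
  rw [hsum]
  congr 1
  rw [← Real.toNNReal_sum_of_nonneg fun _ _ => sq_nonneg _, mul_pow, vecNorm_sq, Finset.mul_sum]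
  simp_rw [mul_pow]

end Gaussian

/-! ### Windows of inputs and attack indicators -/

namespace Data

variable {Ω : Type*} {n m : ℕ} (Z : Data Ω n m)

/-- The stacked inputs `U_{s+k-1}^{(k)}`, made of the inputs at the times `s, …, s + k - 1`. -/
def window (k s : ℕ) (ω : Ω) : Fin k × Fin m → ℝ := stackedInput k (Z.input ω) (s + (k - 1))

/-- `1` if there is no attack time among `s, …, s + k - 2`, and `-1` otherwise. An attack at the
last time `s + k - 1` of the window does not affect the observation at that time. -/
def windowSign (k s : ℕ) (ω : Ω) : ℝ :=
  open Classical in if ∀ i < k - 1, Z.ξ (s + i) ω = false then 1 else -1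

theorem windowSign_eq (k s : ℕ) (ω : Ω) : Z.windowSign k s ω = 1 ∨ Z.windowSign k s ω = -1 := by
  unfold windowSign; split_ifs <;> simp

theorem abs_windowSign (k s : ℕ) (ω : Ω) : |Z.windowSign k s ω| = 1 := by
  rcases Z.windowSign_eq k s ω with h | h <;> simp [h]

theorem measurable_window {m' : MeasurableSpace Ω} {k s : ℕ}
    (h : ∀ i < k, Measurable[m'] (Z.u (s + i))) : Measurable[m'] (Z.window k s) := by
  refine measurable_pi_iff.2 fun c => ?_
  have hc := c.1.2
  have := (measurable_pi_apply c.2).comp (h (k - 1 - c.1) (by omega))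
  rwa [show s + (k - 1 - (c.1 : ℕ)) = s + (k - 1) - c.1 by omega] at this

theorem measurable_windowSign {m' : MeasurableSpace Ω} {k s : ℕ}
    (h : ∀ i < k - 1, Measurable[m'] (Z.ξ (s + i))) : Measurable[m'] (Z.windowSign k s) := by
  refine Measurable.ite ?_ measurable_const measurable_const
  have e : {ω | ∀ i < k - 1, Z.ξ (s + i) ω = false} =
      ⋂ i ∈ Finset.range (k - 1), Z.ξ (s + i) ⁻¹' {false} := by
    ext ω; simp
  rw [e]
  exact Finset.measurableSet_biInter _ fun i hi =>
    h i (Finset.mem_range.1 hi) (measurableSet_singleton _)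

theorem measurable_u_future {t s : ℕ} (h : t ≤ s) : Measurable[Z.future t] (Z.u s) :=
  measurable_iff_comap_le.2 (le_iSup₂_of_le s h le_sup_left)

theorem measurable_ξ_future {t s : ℕ} (h : t ≤ s) : Measurable[Z.future t] (Z.ξ s) :=
  measurable_iff_comap_le.2 (le_iSup₂_of_le s h le_sup_right)

theorem measurable_u_history {t s : ℕ} (h : s < t) : Measurable[Z.history t] (Z.u s) :=
  measurable_iff_comap_le.2
    (le_sup_of_le_right (le_iSup₂_of_le s h (le_sup_of_le_left le_sup_right)))

theorem measurable_ξ_history {t s : ℕ} (h : s < t) : Measurable[Z.history t] (Z.ξ s) :=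
  measurable_iff_comap_le.2 (le_sup_of_le_right (le_iSup₂_of_le s h le_sup_right))

theorem history_mono {s t : ℕ} (h : s ≤ t) : Z.history s ≤ Z.history t :=
  sup_le_sup le_rfl (iSup₂_le fun i hi => le_iSup₂_of_le i (hi.trans_le h) le_rfl)

theorem measurable_window_future (k s : ℕ) : Measurable[Z.future s] (Z.window k s) :=
  Z.measurable_window fun i _ => Z.measurable_u_future (Nat.le_add_right s i)

theorem measurable_windowSign_future (k s : ℕ) : Measurable[Z.future s] (Z.windowSign k s) :=
  Z.measurable_windowSign fun i _ => Z.measurable_ξ_future (Nat.le_add_right s i)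

end Data

namespace DataAssumptions

variable {Ω : Type*} [mΩ : MeasurableSpace Ω] {μ : Measure Ω} {n m : ℕ}
  {Z : Data Ω n m} {σ η p : ℝ}

theorem history_le (h : DataAssumptions μ Z σ η p) (t : ℕ) : Z.history t ≤ mΩ :=
  sup_le h.meas_x₀.comap_le (iSup₂_le fun s _ =>
    sup_le (sup_le (h.meas_w s).comap_le (h.meas_u s).comap_le) (h.meas_ξ s).comap_le)

theorem measurable_window (h : DataAssumptions μ Z σ η p) (k s : ℕ) : Measurable (Z.window k s) :=
  Z.measurable_window fun _ _ => h.meas_u _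

theorem measurable_windowSign (h : DataAssumptions μ Z σ η p) (k s : ℕ) :
    Measurable (Z.windowSign k s) :=
  Z.measurable_windowSign fun _ _ => h.meas_ξ _

theorem indepFun_window_windowSign (h : DataAssumptions μ Z σ η p) (k s : ℕ) :
    IndepFun (Z.window k s) (Z.windowSign k s) μ := by
  rw [IndepFun_iff_Indep]
  refine indep_of_indep_of_le h.indep_u_ξ ?_ ?_
  · exact measurable_iff_comap_le.1 (Z.measurable_window fun i _ =>
      measurable_iff_comap_le.2 (le_iSup (fun t => MeasurableSpace.comap (Z.u t) _) (s + i)))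
  · exact measurable_iff_comap_le.1 (Z.measurable_windowSign fun i _ =>
      measurable_iff_comap_le.2 (le_iSup (fun t => MeasurableSpace.comap (Z.ξ t) _) (s + i)))

theorem measurable_u_apply (h : DataAssumptions μ Z σ η p) (t : ℕ) (a : Fin m) :
    Measurable fun ω => Z.u t ω a :=
  (measurable_pi_apply a).comp (h.meas_u t)

theorem measurable_dotProduct_window (h : DataAssumptions μ Z σ η p) (k s : ℕ)
    (z : Fin k × Fin m → ℝ) : Measurable fun ω => z ⬝ᵥ Z.window k s ω := by
  have := h.measurable_window k s
  unfold dotProduct; fun_prop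

theorem map_u_apply (h : DataAssumptions μ Z σ η p) (t : ℕ) (a : Fin m) :
    μ.map (fun ω => Z.u t ω a) = gaussianReal 0 (Real.toNNReal (σ ^ 2)) := by
  have e : (fun ω => Z.u t ω a) = (fun v : Fin m → ℝ => v a) ∘ Z.u t := rfl
  rw [e, ← Measure.map_map (measurable_pi_apply a) (h.meas_u t), h.gaussian_u]
  exact (measurePreserving_eval _ a).map_eq

variable [IsProbabilityMeasure μ]

theorem iIndepFun_u_apply (h : DataAssumptions μ Z σ η p) :
    iIndepFun (fun (q : ℕ × Fin m) ω => Z.u q.1 ω q.2) μ := by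
  refine iIndepFun_uncurry' (X := fun t a ω => Z.u t ω a)
    h.measurable_u_apply h.indep_u fun t => ?_
  rw [iIndepFun_iff_map_fun_eq_pi_map fun a => (h.measurable_u_apply t a).aemeasurable]
  simp_rw [h.map_u_apply t]
  exact h.gaussian_u t

theorem map_dotProduct_window (h : DataAssumptions μ Z σ η p) (k s : ℕ) (z : Fin k × Fin m → ℝ) :
    μ.map (fun ω => z ⬝ᵥ Z.window k s ω) =
      gaussianReal 0 (Real.toNNReal ((σ * vecNorm z) ^ 2)) := by
  have hinj : Function.Injective
      (fun c : Fin k × Fin m => (s + (k - 1) - (c.1 : ℕ), c.2)) := by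
    rintro ⟨i, a⟩ ⟨j, b⟩ hij
    simp only [Prod.mk.injEq] at hij
    have hi := i.2
    have hj := j.2
    have hij' := hij.1
    exact Prod.ext (Fin.ext (by dsimp only at hij' ⊢; omega)) hij.2
  exact map_dotProduct_gaussianReal (h.iIndepFun_u_apply.precomp hinj)
    (fun c => h.measurable_u_apply _ _) (fun c => h.map_u_apply _ _) z

theorem integral_windowSign (h : DataAssumptions μ Z σ η p) (hp : 0 ≤ p) (k s : ℕ) :
    ∫ ω, Z.windowSign k s ω ∂μ = 1 - 2 * attackProb k p := by
  set F : Set Ω := ⋂ i ∈ Finset.range (k - 1), Z.ξ (s + i) ⁻¹' {false} with hF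
  have hFm : MeasurableSet F := Finset.measurableSet_biInter _ fun i _ =>
    h.meas_ξ _ (measurableSet_singleton _)
  have hp1 : p ≤ 1 := by
    rw [← ENNReal.ofReal_le_one, ← h.bernoulli_ξ 0]; exact prob_le_one
  have hfalse : ∀ t, μ (Z.ξ t ⁻¹' {false}) = ENNReal.ofReal (1 - p) := by
    intro t
    have e : Z.ξ t ⁻¹' {false} = {ω | Z.ξ t ω = true}ᶜ := by ext ω; simp
    have hm : MeasurableSet {ω | Z.ξ t ω = true} := h.meas_ξ t (measurableSet_singleton true)
    rw [e, prob_compl_eq_one_sub hm, h.bernoulli_ξ,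
      ENNReal.ofReal_sub _ hp, ENNReal.ofReal_one]
  have hμF : μ.real F = (1 - p) ^ (k - 1) := by
    have hind := (h.indep_ξ.precomp (add_right_injective s)).meas_biInter
      (S := Finset.range (k - 1)) (s := fun i => Z.ξ (s + i) ⁻¹' {false})
      fun i _ => ⟨{false}, measurableSet_singleton _, rfl⟩
    rw [measureReal_def, hF, hind]
    simp [hfalse, ← ENNReal.ofReal_pow (sub_nonneg.2 hp1),
      ENNReal.toReal_ofReal (pow_nonneg (sub_nonneg.2 hp1) _)]
  have e : Z.windowSign k s = fun ω => F.indicator (fun _ => (2 : ℝ)) ω - 1 := by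
    funext ω
    have : ω ∈ F ↔ ∀ i < k - 1, Z.ξ (s + i) ω = false := by simp [hF]
    unfold Data.windowSign
    by_cases hω : ω ∈ F
    · rw [if_pos (this.1 hω), Set.indicator_of_mem hω]; norm_num
    · rw [if_neg fun h' => hω (this.2 h'), Set.indicator_of_notMem hω]; norm_num
  rw [e, integral_sub ((integrable_const _).indicator hFm) (integrable_const _),
    integral_indicator_const _ hFm, hμF]
  simp [attackProb]
  ring

theorem integrable_abs_dotProduct_window (h : DataAssumptions μ Z σ η p) (k s : ℕ)
    (z : Fin k × Fin m → ℝ) : Integrable (fun ω => |z ⬝ᵥ Z.window k s ω|) μ :=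
  integrable_abs_of_map_gaussianReal (h.measurable_dotProduct_window k s z)
    (h.map_dotProduct_window k s z)

theorem integrable_vecNorm_window (h : DataAssumptions μ Z σ η p) (k s : ℕ) :
    Integrable (fun ω => vecNorm (Z.window k s ω)) μ :=
  integrable_vecNorm_of_dotProduct (h.measurable_window k s)
    (h.integrable_abs_dotProduct_window k s)

theorem sqrt_mul_frobNorm_le_integral (h : DataAssumptions μ Z σ η p) (hσ : 0 ≤ σ) {ι : Type*}
    [Fintype ι] (k s : ℕ) (M : Matrix ι (Fin k × Fin m) ℝ) :
    Real.sqrt (2 / Real.pi) * σ * frobNorm M ≤ ∫ ω, vecNorm (M.mulVec (Z.window k s ω)) ∂μ :=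
  mul_frobNorm_le_integral_vecNorm (h.measurable_window k s)
    (h.integrable_abs_dotProduct_window k s) (fun z => by
      rw [integral_abs_of_map_gaussianReal (h.measurable_dotProduct_window k s z)
        (mul_nonneg hσ (vecNorm_nonneg z)) (h.map_dotProduct_window k s z), mul_assoc]) M

theorem integral_windowSign_mul_ge (h : DataAssumptions μ Z σ η p) (hσ : 0 ≤ σ) (hp : 0 ≤ p)
    {ι : Type*} [Fintype ι] (k s : ℕ) (hq : 0 ≤ 1 - 2 * attackProb k p)
    (M : Matrix ι (Fin k × Fin m) ℝ) :
    (1 - 2 * attackProb k p) * (Real.sqrt (2 / Real.pi) * σ * frobNorm M) ≤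
      ∫ ω, Z.windowSign k s ω * vecNorm (M.mulVec (Z.window k s ω)) ∂μ := by
  have hmv : Measurable fun v : Fin k × Fin m → ℝ => vecNorm (M.mulVec v) := by
    refine measurable_vecNorm.comp ?_
    unfold Matrix.mulVec dotProduct; fun_prop
  have hind := ((h.indepFun_window_windowSign k s).comp hmv measurable_id).symm
  have := hind.integral_fun_mul_eq_mul_integral (h.measurable_windowSign k s).aestronglyMeasurable
    (hmv.comp (h.measurable_window k s)).aestronglyMeasurable
  simp only [id, Function.comp_apply] at this
  rw [this, h.integral_windowSign hp]
  exact mul_le_mul_of_nonneg_left (h.sqrt_mul_frobNorm_le_integral hσ k s M) hq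

end DataAssumptions

/-! ### Moments of the data -/

namespace SubGaussianNormLE

variable {Ω : Type*} {F : MeasurableSpace Ω} [mΩ : MeasurableSpace Ω] {μ : Measure Ω} {n : ℕ}
  {X : Ω → Fin n → ℝ} {η : ℝ}

theorem integral_exp_le [IsProbabilityMeasure μ] (h : SubGaussianNormLE μ F X η) (hF : F ≤ mΩ) :
    ∫ ω, Real.exp (vecNorm (X ω) ^ 2 / η ^ 2) ∂μ ≤ 2 := by
  rw [← integral_condExp hF]
  refine (integral_mono_ae integrable_condExp (integrable_const 2) h.2).trans ?_
  simp

theorem vecNorm_le_exp {Ω : Type*} {n : ℕ} {X : Ω → Fin n → ℝ} {η : ℝ} (hη : 0 < η) (ω : Ω) :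
    vecNorm (X ω) ≤ η / 2 * Real.exp (vecNorm (X ω) ^ 2 / η ^ 2) := by
  have h1 := Real.add_one_le_exp (vecNorm (X ω) ^ 2 / η ^ 2)
  have h2 : 2 * (vecNorm (X ω) / η) ≤ vecNorm (X ω) ^ 2 / η ^ 2 + 1 := by
    rw [← div_pow]; nlinarith [sq_nonneg (vecNorm (X ω) / η - 1)]
  calc vecNorm (X ω) = η / 2 * (2 * (vecNorm (X ω) / η)) := by field_simp
    _ ≤ _ := by gcongr; linarith

theorem integrable_vecNorm (h : SubGaussianNormLE μ F X η) (hη : 0 < η) (hX : Measurable X) :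
    Integrable (fun ω => vecNorm (X ω)) μ :=
  (h.1.const_mul (η / 2)).mono' (measurable_vecNorm.comp hX).aestronglyMeasurable
    (Filter.Eventually.of_forall fun ω => by
      rw [Real.norm_of_nonneg (vecNorm_nonneg _)]; exact vecNorm_le_exp hη ω)

theorem integral_vecNorm_le [IsProbabilityMeasure μ] (h : SubGaussianNormLE μ F X η) (hη : 0 < η)
    (hX : Measurable X) (hF : F ≤ mΩ) : ∫ ω, vecNorm (X ω) ∂μ ≤ η := by
  refine (integral_mono (h.integrable_vecNorm hη hX) (h.1.const_mul (η / 2))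
    fun ω => vecNorm_le_exp hη ω).trans ?_
  rw [integral_const_mul]
  have := h.integral_exp_le hF
  nlinarith

end SubGaussianNormLE

namespace Data

variable {Ω : Type*} {n m : ℕ} (Z : Data Ω n m)

/-- The dominating recursion `stateBound` along the random data. -/
def stateBound (ψ ρ b : ℝ) (t : ℕ) (ω : Ω) : ℝ :=
  SysId.stateBound ψ ρ b (vecNorm (Z.x₀ ω)) (fun s => vecNorm (Z.u s ω))
    (fun s => vecNorm (Z.w s ω)) t

end Data

namespace DataAssumptions

variable {Ω : Type*} [mΩ : MeasurableSpace Ω] {μ : Measure Ω} {n m : ℕ}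
  {Z : Data Ω n m} {σ η p : ℝ}

theorem attackFiltration_le (h : DataAssumptions μ Z σ η p) (t : ℕ) : Z.attackFiltration t ≤ mΩ :=
  sup_le h.meas_x₀.comap_le (iSup₂_le fun s _ => (h.meas_w s).comap_le)

theorem integrable_vecNorm_u (h : DataAssumptions μ Z σ η p) (t : ℕ) :
    Integrable (fun ω => vecNorm (Z.u t ω)) μ := by
  refine Integrable.mono' (g := fun ω => ∑ a, |Z.u t ω a|)
    (integrable_finsetSum _ fun a _ => integrable_abs_of_map_gaussianReal
      (h.measurable_u_apply t a) (h.map_u_apply t a))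
    (measurable_vecNorm.comp (h.meas_u t)).aestronglyMeasurable
    (Filter.Eventually.of_forall fun ω => ?_)
  rw [Real.norm_of_nonneg (vecNorm_nonneg _)]
  exact vecNorm_le_sum_abs _

theorem integrable_sq_window (h : DataAssumptions μ Z σ η p) (k s : ℕ) :
    Integrable (fun ω => vecNorm (Z.window k s ω) ^ 2) μ ∧
      ∫ ω, vecNorm (Z.window k s ω) ^ 2 ∂μ = k * m * σ ^ 2 := by
  have key : ∀ c : Fin k × Fin m, Integrable (fun ω => Z.window k s ω c ^ 2) μ ∧
      ∫ ω, Z.window k s ω c ^ 2 ∂μ = σ ^ 2 := by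
    intro c
    have hlaw := h.map_u_apply (s + (k - 1) - c.1) c.2
    have hmeas := h.measurable_u_apply (s + (k - 1) - c.1) c.2
    have hint : Integrable (fun x : ℝ => x ^ 2) (gaussianReal 0 (Real.toNNReal (σ ^ 2))) :=
      (memLp_id_gaussianReal 2).integrable_sq
    refine ⟨integrable_of_map_gaussianReal hmeas hlaw hint, ?_⟩
    have hvar := variance_of_integral_eq_zero (X := fun x : ℝ => x)
      (μ := gaussianReal 0 (Real.toNNReal (σ ^ 2))) aemeasurable_id' integral_id_gaussianReal
    rw [variance_fun_id_gaussianReal, Real.coe_toNNReal _ (sq_nonneg σ)] at hvar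
    rw [hvar, ← hlaw, integral_map hmeas.aemeasurable]
    · rfl
    · exact (measurable_id.pow_const 2).aestronglyMeasurable
  simp_rw [vecNorm_sq]
  refine ⟨integrable_finsetSum _ fun c _ => (key c).1, ?_⟩
  rw [integral_finsetSum _ fun c _ => (key c).1]
  simp [(key _).2]

theorem integral_vecNorm_u_le (h : DataAssumptions μ Z σ η p) (hσ : 0 ≤ σ) (t : ℕ) :
    ∫ ω, vecNorm (Z.u t ω) ∂μ ≤ m * σ := by
  have hi : ∀ a, Integrable (fun ω => |Z.u t ω a|) μ := fun a =>
    integrable_abs_of_map_gaussianReal (h.measurable_u_apply t a) (h.map_u_apply t a)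
  refine (integral_mono (h.integrable_vecNorm_u t) (integrable_finsetSum Finset.univ
    fun a _ => hi a) fun ω => vecNorm_le_sum_abs _).trans ?_
  rw [integral_finsetSum _ fun a _ => hi a]
  have e : ∀ a, ∫ ω, |Z.u t ω a| ∂μ ≤ σ := by
    intro a
    have := integral_abs_gaussianReal hσ
    rw [← h.map_u_apply t a, integral_map (h.measurable_u_apply t a).aemeasurable
      measurable_abs.aestronglyMeasurable] at this
    rw [this]
    refine mul_le_of_le_one_left hσ ?_
    rw [Real.sqrt_le_one, div_le_one Real.pi_pos]
    exact Real.two_le_pi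
  calc _ ≤ ∑ _a : Fin m, σ := Finset.sum_le_sum fun a _ => e a
    _ = m * σ := by simp

variable [IsProbabilityMeasure μ]

theorem integral_stateBound_le (h : DataAssumptions μ Z σ η p) (hσ : 0 ≤ σ) (hη : 0 < η)
    {ψ ρ b : ℝ} (hψ : 0 ≤ ψ) (h0 : 0 ≤ ρ) (h1 : ρ < 1) (hb : 0 ≤ b) (t : ℕ) :
    Integrable (Z.stateBound ψ ρ b t) μ ∧
      ∫ ω, Z.stateBound ψ ρ b t ω ∂μ ≤ ψ * (b * (m * σ) + η) / (1 - ρ) := by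
  have hpos : 0 < 1 - ρ := by linarith
  have hV : 0 ≤ b * (m * σ) := by positivity
  induction t with
  | zero =>
    have hi := h.subGaussian_x₀.integrable_vecNorm hη h.meas_x₀
    have hle := h.subGaussian_x₀.integral_vecNorm_le hη h.meas_x₀ bot_le
    refine ⟨hi.const_mul ψ, ?_⟩
    change ∫ ω, ψ * vecNorm (Z.x₀ ω) ∂μ ≤ _
    rw [integral_const_mul, le_div_iff₀ hpos, mul_assoc]
    refine mul_le_mul_of_nonneg_left ?_ hψ
    have : 0 ≤ ∫ ω, vecNorm (Z.x₀ ω) ∂μ := integral_nonneg fun ω => vecNorm_nonneg _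
    nlinarith
  | succ t ih =>
    have hi := (h.subGaussian_w t).integrable_vecNorm hη (h.meas_w t)
    have hle := (h.subGaussian_w t).integral_vecNorm_le hη (h.meas_w t) (h.attackFiltration_le t)
    have hu := h.integrable_vecNorm_u t
    have hule := h.integral_vecNorm_u_le hσ t
    have hi2 : Integrable (fun ω => ψ * (b * vecNorm (Z.u t ω) + vecNorm (Z.w t ω))) μ :=
      ((hu.const_mul b).add hi).const_mul ψ
    refine ⟨(ih.1.const_mul ρ).add hi2, ?_⟩
    change ∫ ω, (ρ * Z.stateBound ψ ρ b t ω +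
      ψ * (b * vecNorm (Z.u t ω) + vecNorm (Z.w t ω))) ∂μ ≤ _
    rw [integral_add (ih.1.const_mul ρ) hi2, integral_const_mul, integral_const_mul,
      integral_add (hu.const_mul b) hi, integral_const_mul]
    have h3 : ψ * (b * ∫ ω, vecNorm (Z.u t ω) ∂μ + ∫ ω, vecNorm (Z.w t ω) ∂μ) ≤
        ψ * (b * (m * σ) + η) := by gcongr
    have h4 := mul_le_mul_of_nonneg_left ih.2 h0
    have e : ψ * (b * (m * σ) + η) / (1 - ρ) =
        ρ * (ψ * (b * (m * σ) + η) / (1 - ρ)) + ψ * (b * (m * σ) + η) := by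
      field_simp; ring
    rw [e]
    linarith

end DataAssumptions

/-! ### The streaming estimate: measurability and drift -/

section Streaming

theorem measurable_of_entries {Ω ι κ : Type*} {_ : MeasurableSpace Ω} {X : Ω → ι → κ → ℝ}
    (hX : ∀ i j, Measurable fun ω => X ω i j) : Measurable X :=
  measurable_pi_iff.2 fun i => measurable_pi_iff.2 fun j => hX i j

theorem measurable_ballProj_apply {Ω ι κ : Type*} [Fintype ι] [Fintype κ] {_ : MeasurableSpace Ω}
    {X : Ω → Matrix ι κ ℝ} (hX : ∀ i j, Measurable fun ω => X ω i j) (R : ℝ) (i : ι) (j : κ) :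
    Measurable fun ω => ballProj R (X ω) i j := by
  have hf : Measurable fun ω => frobNorm (X ω) := by
    unfold frobNorm frobInner
    exact (Finset.measurable_sum _ fun i _ => Finset.measurable_sum _ fun j _ =>
      (hX i j).mul (hX i j)).sqrt
  have e : (fun ω => ballProj R (X ω) i j) = fun ω => if frobNorm (X ω) ≤ R then X ω i j else
      R / frobNorm (X ω) * X ω i j := by
    funext ω
    unfold ballProj
    split_ifs <;> rfl
  rw [e]
  exact Measurable.ite (measurableSet_le hf measurable_const) (hX i j)
    ((measurable_const.div hf).mul (hX i j))

/-- Solution of the recursion of stochastic gradient descent with step sizes `∝ 1 / j`. The product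
`j (j - 1) d_j` telescopes, as `(j + 1) j (1 - 2 / (j + 1)) = j (j - 1)`. -/
theorem mul_le_of_recursion {d : ℕ → ℝ} {a v : ℝ} (hv : 0 ≤ v)
    (h : ∀ j : ℕ, d (j + 1) ≤ (1 - 2 / ((j : ℝ) + 1)) * d j + a / ((j : ℝ) + 1) +
      v / ((j : ℝ) + 1) ^ 2) (j : ℕ) :
    (j : ℝ) * (j - 1) * d j ≤ a / 2 * (j * (j - 1)) + v * j := by
  induction j with
  | zero => simp
  | succ j ih =>
    have hj : (0 : ℝ) < (j : ℝ) + 1 := by positivity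
    have h1 := mul_le_mul_of_nonneg_left (h j) (by positivity : (0 : ℝ) ≤ ((j : ℝ) + 1) * j)
    have e : ((j : ℝ) + 1) * j * ((1 - 2 / ((j : ℝ) + 1)) * d j + a / ((j : ℝ) + 1) +
        v / ((j : ℝ) + 1) ^ 2) = j * (j - 1) * d j + a * j + v * (j / (j + 1)) := by
      field_simp; ring
    have h2 : v * ((j : ℝ) / (j + 1)) ≤ v :=
      mul_le_of_le_one_right hv ((div_le_one hj).2 (by linarith))
    push_cast
    rw [e] at h1
    linarith

theorem integral_sq_le {Ω : Type*} [MeasurableSpace Ω] {μ : Measure Ω} [IsProbabilityMeasure μ]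
    {X : Ω → ℝ} (hX : Integrable X μ) (hX2 : Integrable (fun ω => X ω ^ 2) μ) :
    (∫ ω, X ω ∂μ) ^ 2 ≤ ∫ ω, X ω ^ 2 ∂μ := by
  have h : 0 ≤ ∫ ω, (X ω - ∫ ω, X ω ∂μ) ^ 2 ∂μ := integral_nonneg fun ω => sq_nonneg _
  set c := ∫ ω, X ω ∂μ
  have e : ∀ ω, (X ω - c) ^ 2 = X ω ^ 2 - 2 * c * X ω + c ^ 2 := fun ω => by ring
  simp_rw [e] at h
  have hi : Integrable (fun ω => X ω ^ 2 - 2 * c * X ω) μ := hX2.sub (hX.const_mul _)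
  rw [integral_add hi (integrable_const _), integral_sub hX2 (hX.const_mul _),
    integral_const_mul] at h
  simp at h
  change 0 ≤ _ - 2 * c * c + _ at h
  linarith

variable {Ω : Type*} {n m r k : ℕ} {S : LinSys n m r} {Z : Data Ω n m} {σ η p R β : ℝ}
  {G g : ℕ → Ω → Matrix (Fin r) (Fin k × Fin m) ℝ}

theorem measurable_streaming_history (hR : 0 ≤ R) (hrun : IsStreamingRun S Z R β G g) (j : ℕ)
    (i : Fin r) (c : Fin k × Fin m) : Measurable[Z.history (j * k)] fun ω => G j ω i c := by
  induction j generalizing i c with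
  | zero => simp only [hrun.init]; exact measurable_const
  | succ j ih =>
    have e : (fun ω => G (j + 1) ω i c) = fun ω => ballProj R
        (G j ω - ((k : ℝ) * β / (((j * k : ℕ) : ℝ) + k)) • g j ω) i c := by
      funext ω; rw [eq_ballProj_of_isProjection hR (hrun.step j ω)]
    rw [e]
    refine measurable_ballProj_apply (fun i c => ?_) R i c
    have h1 := (ih i c).mono (Z.history_mono (show j * k ≤ (j + 1) * k by gcongr; omega)) le_rfl
    have h2 := hrun.adapted j i c
    rw [show j * k + k = (j + 1) * k by ring] at h2
    exact h1.sub (h2.const_mul _)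

theorem frobNorm_streaming_le (hR : 0 ≤ R) (hrun : IsStreamingRun S Z R β G g) (j : ℕ) (ω : Ω) :
    frobNorm (G j ω) ≤ R := by
  cases j with
  | zero => rw [hrun.init, frobNorm_zero]; exact hR
  | succ j => exact (hrun.step j ω).1

theorem frobNorm_markov_sub_streaming_le (hR : 0 ≤ R) (hS : frobNorm (S.markov k) ≤ R)
    (hrun : IsStreamingRun S Z R β G g) (j : ℕ) (ω : Ω) :
    frobNorm (S.markov k - G j ω) ≤ 2 * R := by
  have := frobNorm_sub_le (S.markov k) (G j ω)
  have := frobNorm_streaming_le hR hrun j ω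
  linarith

theorem measurable_frobNorm_sub (M : Matrix (Fin r) (Fin k × Fin m) ℝ) :
    Measurable fun x : Fin r → Fin k × Fin m → ℝ => frobNorm (M - Matrix.of x) := by
  unfold frobNorm frobInner
  simp only [Matrix.sub_apply, Matrix.of_apply]
  fun_prop

variable [mΩ : MeasurableSpace Ω] {μ : Measure Ω}

theorem measurable_streaming (h : DataAssumptions μ Z σ η p) (hR : 0 ≤ R)
    (hrun : IsStreamingRun S Z R β G g) (j : ℕ) (i : Fin r) (c : Fin k × Fin m) :
    Measurable fun ω => G j ω i c :=
  (measurable_streaming_history hR hrun j i c).mono (h.history_le _) le_rfl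

theorem measurable_frobNorm_markov_sub (h : DataAssumptions μ Z σ η p) (hR : 0 ≤ R)
    (hrun : IsStreamingRun S Z R β G g) (j : ℕ) :
    Measurable fun ω => frobNorm (S.markov k - G j ω) :=
  (measurable_frobNorm_sub (S.markov k)).comp
    (measurable_of_entries (measurable_streaming h hR hrun j))

variable [IsProbabilityMeasure μ]

theorem integrable_frobNorm_markov_sub (h : DataAssumptions μ Z σ η p) (hR : 0 ≤ R)
    (hS : frobNorm (S.markov k) ≤ R) (hrun : IsStreamingRun S Z R β G g) (j : ℕ) :
    Integrable (fun ω => frobNorm (S.markov k - G j ω)) μ :=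
  Integrable.of_bound (measurable_frobNorm_markov_sub h hR hrun j).aestronglyMeasurable (2 * R)
    (Filter.Eventually.of_forall fun ω => by
      rw [Real.norm_of_nonneg (frobNorm_nonneg _)]
      exact frobNorm_markov_sub_streaming_le hR hS hrun j ω)

theorem integrable_frobNorm_markov_sub_sq (h : DataAssumptions μ Z σ η p) (hR : 0 ≤ R)
    (hS : frobNorm (S.markov k) ≤ R) (hrun : IsStreamingRun S Z R β G g) (j : ℕ) :
    Integrable (fun ω => frobNorm (S.markov k - G j ω) ^ 2) μ :=
  Integrable.of_bound
    ((measurable_frobNorm_markov_sub h hR hrun j).pow_const 2).aestronglyMeasurable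
    ((2 * R) ^ 2) (Filter.Eventually.of_forall fun ω => by
      rw [Real.norm_of_nonneg (sq_nonneg _)]
      exact pow_le_pow_left₀ (frobNorm_nonneg _)
        (frobNorm_markov_sub_streaming_le hR hS hrun j ω) 2)

/-- The mean excess loss of the current estimate is at least a multiple of its mean error, since the
current estimate is independent of the next window. -/
theorem integral_windowSign_mul_streaming_ge (h : DataAssumptions μ Z σ η p) (hσ : 0 ≤ σ)
    (hp : 0 ≤ p) (hq : 0 ≤ 1 - 2 * attackProb k p) (hR : 0 ≤ R) (hS : frobNorm (S.markov k) ≤ R)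
    (hrun : IsStreamingRun S Z R β G g) (j : ℕ) :
    Integrable (fun ω => Z.windowSign k (j * k) ω *
      vecNorm ((S.markov k - G j ω).mulVec (Z.window k (j * k) ω))) μ ∧
    (1 - 2 * attackProb k p) * (Real.sqrt (2 / Real.pi) * σ) *
        ∫ ω, frobNorm (S.markov k - G j ω) ∂μ ≤
      ∫ ω, Z.windowSign k (j * k) ω *
        vecNorm ((S.markov k - G j ω).mulVec (Z.window k (j * k) ω)) ∂μ := by
  set f : (Fin r → Fin k × Fin m → ℝ) × (ℝ × (Fin k × Fin m → ℝ)) → ℝ := fun q =>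
    q.2.1 * vecNorm ((S.markov k - Matrix.of q.1).mulVec q.2.2) with hfdef
  have hf : Measurable f := by
    refine (measurable_fst.comp measurable_snd).mul (measurable_vecNorm.comp
      (measurable_pi_iff.2 fun i => ?_))
    simp only [Matrix.mulVec, dotProduct, Matrix.sub_apply, Matrix.of_apply]
    fun_prop
  have hG : Measurable (fun ω i c => G j ω i c) :=
    measurable_of_entries (measurable_streaming h hR hrun j)
  have hY : Measurable (fun ω => (Z.windowSign k (j * k) ω, Z.window k (j * k) ω)) :=
    (h.measurable_windowSign k _).prodMk (h.measurable_window k _)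
  have hind : IndepFun (fun ω i c => G j ω i c)
      (fun ω => (Z.windowSign k (j * k) ω, Z.window k (j * k) ω)) μ := by
    rw [IndepFun_iff_Indep]
    refine indep_of_indep_of_le (h.nonanticipating (j * k)) ?_ ?_
    · refine measurable_iff_comap_le.1 ?_
      exact measurable_of_entries (measurable_streaming_history hR hrun j)
    · refine measurable_iff_comap_le.1 ?_
      exact (Z.measurable_windowSign_future k _).prodMk (Z.measurable_window_future k _)
  have hfi : Integrable (fun ω => f (fun i c => G j ω i c,
      (Z.windowSign k (j * k) ω, Z.window k (j * k) ω))) μ := by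
    refine ((h.integrable_vecNorm_window k (j * k)).const_mul (2 * R)).mono'
      (hf.comp (hG.prodMk hY)).aestronglyMeasurable (Filter.Eventually.of_forall fun ω => ?_)
    rw [hfdef, norm_mul, Real.norm_eq_abs, Z.abs_windowSign, one_mul,
      Real.norm_of_nonneg (vecNorm_nonneg _)]
    exact (vecNorm_mulVec_le_frobNorm _ _).trans (mul_le_mul_of_nonneg_right
      (frobNorm_markov_sub_streaming_le hR hS hrun j ω) (vecNorm_nonneg _))
  refine ⟨hfi, ?_⟩
  have hφ := (measurable_frobNorm_sub (S.markov k)).const_mul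
    ((1 - 2 * attackProb k p) * (Real.sqrt (2 / Real.pi) * σ))
  have := integral_le_integral_of_indepFun hG hY hind hf hfi hφ
    ((integrable_frobNorm_markov_sub h hR hS hrun j).const_mul _) (fun x => by
      rw [mul_assoc]
      exact h.integral_windowSign_mul_ge hσ hp k (j * k) hq (S.markov k - Matrix.of x))
  rw [← integral_const_mul]
  exact this

end Streaming

/-! ### The streaming estimate: convergence -/

section Convergence

variable {Ω : Type*} [mΩ : MeasurableSpace Ω] {μ : Measure Ω}
  {n m r k : ℕ} {S : LinSys n m r} {Z : Data Ω n m} {σ η p R β ψ ρ b c : ℝ}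
  {G g : ℕ → Ω → Matrix (Fin r) (Fin k × Fin m) ℝ}

theorem integral_linear_combination {X Y V W : Ω → ℝ} (hX : Integrable X μ) (hY : Integrable Y μ)
    (hV : Integrable V μ) (hW : Integrable W μ) (α₁ α₂ α₃ : ℝ) :
    Integrable (fun ω => X ω - α₁ * (Y ω - 2 * (α₃ * V ω)) + α₂ * W ω) μ ∧
    ∫ ω, (X ω - α₁ * (Y ω - 2 * (α₃ * V ω)) + α₂ * W ω) ∂μ =
      ∫ ω, X ω ∂μ - α₁ * (∫ ω, Y ω ∂μ - 2 * (α₃ * ∫ ω, V ω ∂μ)) + α₂ * ∫ ω, W ω ∂μ := by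
  have h1 : Integrable (fun ω => 2 * (α₃ * V ω)) μ := (hV.const_mul α₃).const_mul 2
  have h2 : Integrable (fun ω => α₁ * (Y ω - 2 * (α₃ * V ω))) μ := (hY.sub h1).const_mul α₁
  have h3 : Integrable (fun ω => X ω - α₁ * (Y ω - 2 * (α₃ * V ω))) μ := hX.sub h2
  refine ⟨h3.add (hW.const_mul α₂), ?_⟩
  rw [integral_add h3 (hW.const_mul α₂), integral_sub hX h2, integral_const_mul,
    integral_sub hY h1, integral_const_mul, integral_const_mul, integral_const_mul]

theorem windowSign_dichotomy (h : DataAssumptions μ Z σ η p) (k s : ℕ) (ω : Ω) :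
    Z.windowSign k s ω = -1 ∨ (Z.windowSign k s ω = 1 ∧ ∀ i < k - 1, Z.w (s + i) ω = 0) := by
  unfold Data.windowSign
  split_ifs with hf
  · exact Or.inr ⟨rfl, fun i hi => h.attack_off _ _ (hf i hi)⟩
  · exact Or.inl rfl

theorem frobNorm_streaming_step_le (h : DataAssumptions μ Z σ η p) (hk : 0 < k) (hβ : 0 ≤ β)
    (hψ : 0 ≤ ψ) (h0 : 0 ≤ ρ) (hA : ∀ t : ℕ, specNorm (S.A ^ t) ≤ ψ * ρ ^ t)
    (hB : specNorm S.B ≤ b) (hC : specNorm S.C ≤ c) (hS : frobNorm (S.markov k) ≤ R)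
    (hrun : IsStreamingRun S Z R β G g) (j : ℕ) (ω : Ω) :
    frobNorm (S.markov k - G (j + 1) ω) ^ 2 ≤ frobNorm (S.markov k - G j ω) ^ 2 -
      2 * (β / ((j : ℝ) + 1)) * (Z.windowSign k (j * k) ω *
        vecNorm ((S.markov k - G j ω).mulVec (Z.window k (j * k) ω)) -
          2 * (c * ρ ^ (k - 1) * Z.stateBound ψ ρ b (j * k) ω)) +
      (β / ((j : ℝ) + 1)) ^ 2 * vecNorm (Z.window k (j * k) ω) ^ 2 := by
  have hα : (k : ℝ) * β / (((j * k : ℕ) : ℝ) + k) = β / ((j : ℝ) + 1) := by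
    have : (0 : ℝ) < k := by exact_mod_cast hk
    push_cast
    field_simp
  have hP := hrun.step j ω
  rw [hα] at hP
  have hα0 : 0 ≤ β / ((j : ℝ) + 1) := by positivity
  have h1 := frobNorm_step_sq_le hα0 (hrun.subgradient j ω) hP hS
  have h2 := sampleLoss_sub_ge (u := Z.input ω) (x₀ := Z.x₀ ω) (w := fun t => Z.w t ω) hψ h0 hA hB
    hC hk (j * k) (G j ω) (windowSign_dichotomy h k (j * k) ω)
  have h3 := frobNorm_le_of_isSubgradient_sampleLoss (hrun.subgradient j ω)
  have h4 := mul_le_mul_of_nonneg_left (pow_le_pow_left₀ (frobNorm_nonneg _) h3 2)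
    (sq_nonneg (β / ((j : ℝ) + 1)))
  have h5 := mul_le_mul_of_nonneg_left h2 (mul_nonneg zero_le_two hα0)
  rw [frobNorm_sub_comm (S.markov k), frobNorm_sub_comm (S.markov k) (G j ω)]
  exact h1.trans (add_le_add (sub_le_sub_left h5 _) h4)

variable [IsProbabilityMeasure μ]

/-- The expected squared error contracts in each step: the drift towards the true parameters is
proportional to the error itself, hence, as the error is at most `2R`, to its square. -/
theorem integral_streaming_step_le (h : DataAssumptions μ Z σ η p) (hk : 0 < k) (hσ : 0 ≤ σ)
    (hη : 0 < η) (hp : 0 ≤ p) (hq : 0 ≤ 1 - 2 * attackProb k p) (hR : 0 < R) (hβ : 0 ≤ β)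
    (hβR : 2 * R ≤ β * ((1 - 2 * attackProb k p) * (Real.sqrt (2 / Real.pi) * σ)))
    (hψ : 0 ≤ ψ) (h0 : 0 ≤ ρ) (h1 : ρ < 1) (hA : ∀ t : ℕ, specNorm (S.A ^ t) ≤ ψ * ρ ^ t)
    (hB : specNorm S.B ≤ b) (hC : specNorm S.C ≤ c) (hS : frobNorm (S.markov k) ≤ R)
    (hrun : IsStreamingRun S Z R β G g) (j : ℕ) :
    ∫ ω, frobNorm (S.markov k - G (j + 1) ω) ^ 2 ∂μ ≤
      (1 - 2 / ((j : ℝ) + 1)) * ∫ ω, frobNorm (S.markov k - G j ω) ^ 2 ∂μ +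
        4 * β * (c * ρ ^ (k - 1) * (ψ * (b * (m * σ) + η) / (1 - ρ))) / ((j : ℝ) + 1) +
        β ^ 2 * (k * m * σ ^ 2) / ((j : ℝ) + 1) ^ 2 := by
  have hb : 0 ≤ b := (specNorm_nonneg _).trans hB
  have hc : 0 ≤ c := (specNorm_nonneg _).trans hC
  obtain ⟨hXi, hX⟩ := integral_windowSign_mul_streaming_ge h hσ hp hq hR.le hS hrun j
  obtain ⟨hSi, hSB⟩ := h.integral_stateBound_le hσ hη hψ h0 h1 hb (j * k)
  obtain ⟨hUi, hU⟩ := h.integrable_sq_window k (j * k)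
  have hDi := integrable_frobNorm_markov_sub h hR.le hS hrun j
  have hD2i := integrable_frobNorm_markov_sub_sq h hR.le hS hrun j
  have hD : ∫ ω, frobNorm (S.markov k - G j ω) ^ 2 ∂μ ≤
      2 * R * ∫ ω, frobNorm (S.markov k - G j ω) ∂μ := by
    rw [← integral_const_mul]
    refine integral_mono hD2i (hDi.const_mul _) fun ω => ?_
    have := frobNorm_markov_sub_streaming_le hR.le hS hrun j ω
    have := frobNorm_nonneg (S.markov k - G j ω)
    simp only
    nlinarith
  have hj : (0 : ℝ) < (j : ℝ) + 1 := by positivity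
  set α := β / ((j : ℝ) + 1) with hαdef
  have hα0 : 0 ≤ α := by positivity
  obtain ⟨hci, hcomb⟩ := integral_linear_combination hD2i hXi hSi hUi (2 * α) (α ^ 2)
    (c * ρ ^ (k - 1))
  have hstep := integral_mono (integrable_frobNorm_markov_sub_sq h hR.le hS hrun (j + 1)) hci
    fun ω => frobNorm_streaming_step_le h hk hβ hψ h0 hA hB hC hS hrun j ω
  rw [hcomb, hU] at hstep
  set d := ∫ ω, frobNorm (S.markov k - G j ω) ^ 2 ∂μ
  set e := ∫ ω, frobNorm (S.markov k - G j ω) ∂μ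
  set B := ψ * (b * (m * σ) + η) / (1 - ρ)
  have he : 0 ≤ e := integral_nonneg fun ω => frobNorm_nonneg _
  have hdrift : 2 / ((j : ℝ) + 1) * d ≤
      2 * α * ((1 - 2 * attackProb k p) * (Real.sqrt (2 / Real.pi) * σ) * e) := by
    have e1 : 2 * α * ((1 - 2 * attackProb k p) * (Real.sqrt (2 / Real.pi) * σ) * e) =
        2 / ((j : ℝ) + 1) *
          (β * ((1 - 2 * attackProb k p) * (Real.sqrt (2 / Real.pi) * σ)) * e) := by
      rw [hαdef]; field_simp
    rw [e1]
    refine mul_le_mul_of_nonneg_left (hD.trans ?_) (by positivity)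
    exact mul_le_mul_of_nonneg_right hβR he
  have h6 := mul_le_mul_of_nonneg_left hX (mul_nonneg zero_le_two hα0)
  have h7 := mul_le_mul_of_nonneg_left hSB
    (mul_nonneg (mul_nonneg (by norm_num : (0 : ℝ) ≤ 4) hα0)
      (mul_nonneg hc (pow_nonneg h0 (k - 1))))
  have e2 : 4 * β * (c * ρ ^ (k - 1) * B) / ((j : ℝ) + 1) = 4 * α * (c * ρ ^ (k - 1)) * B := by
    rw [hαdef]; field_simp
  have e3 : β ^ 2 * (k * m * σ ^ 2) / ((j : ℝ) + 1) ^ 2 = α ^ 2 * (k * m * σ ^ 2) := by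
    rw [hαdef]; field_simp
  rw [e2, e3]
  linarith

/-- The mean error of the streaming estimate at time `t`, with `t / k` steps done: a bias due to the
old states, and a fluctuation that decays with `t`. -/
theorem integral_streaming_le (h : DataAssumptions μ Z σ η p) (hk : 2 ≤ k) (hσ : 0 ≤ σ)
    (hη : 0 < η) (hp : 0 ≤ p) (hq : 0 ≤ 1 - 2 * attackProb k p) (hR : 0 < R) (hβ : 0 ≤ β)
    (hβR : 2 * R ≤ β * ((1 - 2 * attackProb k p) * (Real.sqrt (2 / Real.pi) * σ)))
    (hψ : 0 ≤ ψ) (h0 : 0 ≤ ρ) (h1 : ρ < 1) (hA : ∀ t : ℕ, specNorm (S.A ^ t) ≤ ψ * ρ ^ t)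
    (hB : specNorm S.B ≤ b) (hC : specNorm S.C ≤ c) (hS : frobNorm (S.markov k) ≤ R)
    (hrun : IsStreamingRun S Z R β G g) {t : ℕ} (ht : 1 ≤ t) :
    ∫ ω, frobNorm (S.markov k - G (t / k) ω) ∂μ ≤
      Real.sqrt (2 * β * (c * ψ * (b * (m * σ) + η))) *
        (ρ ^ (((k : ℝ) - 1) / 2) / Real.sqrt (1 - ρ)) +
      (2 * R + β * σ * Real.sqrt (3 * m)) * (k / Real.sqrt t) := by
  have hb : 0 ≤ b := (specNorm_nonneg _).trans hB
  have hc : 0 ≤ c := (specNorm_nonneg _).trans hC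
  have hρ1 : 0 < 1 - ρ := by linarith
  have hk0 : (2 : ℝ) ≤ k := by exact_mod_cast hk
  have ht0 : (0 : ℝ) < t := by exact_mod_cast ht
  have hst : 0 < Real.sqrt t := Real.sqrt_pos.2 ht0
  have hrp : 0 ≤ ρ ^ (((k : ℝ) - 1) / 2) := Real.rpow_nonneg h0 _
  have hbias : 0 ≤ Real.sqrt (2 * β * (c * ψ * (b * (m * σ) + η))) *
        (ρ ^ (((k : ℝ) - 1) / 2) / Real.sqrt (1 - ρ)) := by positivity
  have hDi := integrable_frobNorm_markov_sub h hR.le hS hrun (t / k)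
  have htk : t < k * (t / k + 1) := Nat.lt_mul_div_succ t (by omega)
  rcases lt_or_ge (t / k) 2 with hj | hj
  -- fewer than two steps: the trivial bound `2R` suffices, as `t ≤ k²`
  · have hDR : ∫ ω, frobNorm (S.markov k - G (t / k) ω) ∂μ ≤ 2 * R := by
      refine (integral_mono hDi (integrable_const (2 * R)) fun ω =>
        frobNorm_markov_sub_streaming_le hR.le hS hrun _ ω).trans ?_
      simp
    have ht2 : (t : ℝ) ≤ (k : ℝ) ^ 2 := by
      have : t ≤ k * k := htk.le.trans (Nat.mul_le_mul_left _ (by omega))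
      rw [pow_two]; exact_mod_cast this
    have h1k : 1 ≤ (k : ℝ) / Real.sqrt t := by
      rw [one_le_div hst]
      exact Real.sqrt_le_iff.2 ⟨by linarith, ht2⟩
    have h2 : 0 ≤ β * σ * Real.sqrt (3 * m) := by positivity
    have h3 : (2 * R) * 1 ≤ (2 * R + β * σ * Real.sqrt (3 * m)) * (k / Real.sqrt t) :=
      mul_le_mul (by linarith) h1k zero_le_one (by positivity)
    linarith
  · set j := t / k with hjdef
    have hj0 : (2 : ℝ) ≤ j := by exact_mod_cast hj
    have hrec := mul_le_of_recursion (d := fun j => ∫ ω, frobNorm (S.markov k - G j ω) ^ 2 ∂μ)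
      (by positivity : 0 ≤ β ^ 2 * (k * m * σ ^ 2))
      (integral_streaming_step_le h (by omega) hσ hη hp hq hR hβ hβR hψ h0 h1 hA hB hC hS hrun) j
    have hJ := integral_sq_le hDi (integrable_frobNorm_markov_sub_sq h hR.le hS hrun j)
    set e := ∫ ω, frobNorm (S.markov k - G j ω) ∂μ
    set d := ∫ ω, frobNorm (S.markov k - G j ω) ^ 2 ∂μ
    set P := Real.sqrt (2 * β * (c * ψ * (b * (m * σ) + η))) *
        (ρ ^ (((k : ℝ) - 1) / 2) / Real.sqrt (1 - ρ)) with hP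
    have hP2 : P ^ 2 = 2 * β * (c * ρ ^ (k - 1) * (ψ * (b * (m * σ) + η) / (1 - ρ))) := by
      have hr : (ρ ^ (((k : ℝ) - 1) / 2)) ^ 2 = ρ ^ (k - 1) := by
        rw [← Real.rpow_mul_natCast h0, ← Real.rpow_natCast ρ (k - 1)]
        congr 1
        push_cast [Nat.cast_sub (show 1 ≤ k by omega)]
        ring
      rw [hP, mul_pow, div_pow, hr, Real.sq_sqrt (by positivity), Real.sq_sqrt hρ1.le]
      ring
    set Q := β * σ * Real.sqrt (3 * m) * (k / Real.sqrt t) with hQ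
    have hQ2 : Q ^ 2 = 3 * k / t * (β ^ 2 * (k * m * σ ^ 2)) := by
      rw [hQ, mul_pow, mul_pow, mul_pow, div_pow, Real.sq_sqrt (by positivity),
        Real.sq_sqrt ht0.le]
      ring
    have hQ0 : 0 ≤ Q := by positivity
    have hd : d ≤ P ^ 2 + Q ^ 2 := by
      have hjj : (0 : ℝ) < j * (j - 1) := mul_pos (by linarith) (by linarith)
      have hdle : d ≤ (4 * β * (c * ρ ^ (k - 1) * (ψ * (b * (m * σ) + η) / (1 - ρ))) / 2 *
          (j * (j - 1)) + β ^ 2 * (k * m * σ ^ 2) * j) / (j * (j - 1)) := by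
        rw [le_div_iff₀ hjj]; linarith
      refine hdle.trans ?_
      have hj1 : (0 : ℝ) < j - 1 := by linarith
      have e1 : (4 * β * (c * ρ ^ (k - 1) * (ψ * (b * (m * σ) + η) / (1 - ρ))) / 2 *
          (j * (j - 1)) + β ^ 2 * (k * m * σ ^ 2) * j) / (j * (j - 1)) =
          2 * β * (c * ρ ^ (k - 1) * (ψ * (b * (m * σ) + η) / (1 - ρ))) +
            1 / (j - 1) * (β ^ 2 * (k * m * σ ^ 2)) := by
        field_simp
        ring
      rw [e1, hP2, hQ2]
      refine add_le_add le_rfl (mul_le_mul_of_nonneg_right ?_ (by positivity))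
      rw [div_le_div_iff₀ hj1 ht0]
      have h3 : (t : ℝ) ≤ k * (j + 1) := by exact_mod_cast htk.le
      have h4 : (k : ℝ) * (j + 1) ≤ k * (3 * (j - 1)) :=
        mul_le_mul_of_nonneg_left (by linarith) (by linarith)
      rw [one_mul, mul_comm 3 (k : ℝ), mul_assoc]
      exact h3.trans h4
    have he : e ≤ P + Q := by
      apply le_of_sq_le_sq _ (add_nonneg hbias hQ0)
      have := mul_nonneg hbias hQ0
      have e2 : (P + Q) ^ 2 = P ^ 2 + Q ^ 2 + 2 * (P * Q) := by ring
      rw [e2]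
      linarith only [this, hJ, hd]
    have : 0 ≤ 2 * R * (k / Real.sqrt t) := by positivity
    rw [add_mul]
    linarith

end Convergence

/-! ### Concentration over overlapping windows -/

section Concentration

variable {Ω : Type*} [mΩ : MeasurableSpace Ω] {μ : Measure Ω}

/-- If each `X s` is independent of the past and looks at most `k` steps ahead, then the factors at
the times `s ≡ v` modulo `k` can be integrated one after the other. -/
theorem lintegral_prod_le_of_indep {X : ℕ → Ω → ℝ≥0∞} {a : ℝ≥0∞} {k : ℕ} (v : ℕ)
    (hist fut : ℕ → MeasurableSpace Ω) (hhist : ∀ s, hist s ≤ mΩ) (hfut : ∀ s, fut s ≤ mΩ)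
    (hind : ∀ s, Indep (hist s) (fut s) μ) (hXh : ∀ s t, s + k ≤ t → Measurable[hist t] (X s))
    (hXf : ∀ s, Measurable[fut s] (X s)) (hX : ∀ s, ∫⁻ ω, X s ω ∂μ ≤ a)
    [IsProbabilityMeasure μ] (T : ℕ) :
    ∫⁻ ω, ∏ s ∈ (Finset.range T).filter (fun s => s % k = v), X s ω ∂μ ≤
      a ^ ((Finset.range T).filter (fun s => s % k = v)).card := by
  induction T with
  | zero => simp
  | succ T ih =>
    rw [Finset.range_add_one, Finset.filter_insert]
    split_ifs with hT
    · have hnot : T ∉ (Finset.range T).filter (fun s => s % k = v) := by simp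
      simp_rw [Finset.prod_insert hnot]
      rw [Finset.card_insert_of_notMem hnot, pow_succ]
      simp_rw [mul_comm (X T _)]
      have hprod : Measurable[hist T]
          fun ω => ∏ s ∈ (Finset.range T).filter (fun s => s % k = v), X s ω := by
        refine Finset.measurable_prod _ fun s hs => hXh s T ?_
        -- two distinct times in the same class modulo `k` are at least `k` apart
        obtain ⟨hsT, hsv⟩ := Finset.mem_filter.1 hs
        have hsT := Finset.mem_range.1 hsT
        have h1 := Nat.div_add_mod s k
        have h2 := Nat.div_add_mod T k
        have h3 : s / k < T / k := by
          by_contra! hle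
          have := Nat.mul_le_mul_left k hle
          omega
        have := Nat.mul_le_mul_left k (Nat.succ_le_of_lt h3)
        rw [Nat.mul_succ] at this
        omega
      rw [lintegral_mul_eq_lintegral_mul_lintegral_of_independent_measurableSpace (hhist T)
        (hfut T) (hind T) hprod (hXf T)]
      exact mul_le_mul' ih (hX T)
    · exact ih

theorem div_le_card_filter_mod {k v : ℕ} (hv : v < k) (T : ℕ) :
    T / k ≤ ((Finset.range T).filter (fun s => s % k = v)).card := by
  have h := Nat.count_modEq_card (b := T) (r := k) (Nat.zero_lt_of_lt hv) v
  rw [Nat.count_eq_card_filter_range] at h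
  have e : (Finset.range T).filter (fun s => s % k = v) =
      (Finset.range T).filter (fun s => s ≡ v [MOD k]) := by
    refine Finset.filter_congr fun s _ => ?_
    rw [Nat.ModEq, Nat.mod_eq_of_lt hv]
  rw [e, h]
  exact Nat.le_add_right _ _

/-- Splitting a sum into its residue classes modulo `k`: the exponential of the average over the
classes is at most the average of the exponentials. -/
theorem exp_sum_div_le {k : ℕ} (hk : 0 < k) (y : ℕ → ℝ) (T : ℕ) :
    Real.exp ((∑ s ∈ Finset.range T, y s) / k) ≤ (k : ℝ)⁻¹ * ∑ v ∈ Finset.range k,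
      ∏ s ∈ (Finset.range T).filter (fun s => s % k = v), Real.exp (y s) := by
  have hk0 : (0 : ℝ) < k := by exact_mod_cast hk
  have h := convexOn_exp.map_sum_le (t := Finset.range k) (w := fun _ => (k : ℝ)⁻¹)
    (p := fun v => ∑ s ∈ (Finset.range T).filter (fun s => s % k = v), y s)
    (fun _ _ => by positivity) (by simp [hk0.ne']) (fun _ _ => Set.mem_univ _)
  simp only [smul_eq_mul, ← Finset.mul_sum, Real.exp_sum] at h
  rw [Finset.sum_fiberwise_of_maps_to (g := fun s => s % k) (fun s _ =>
    Finset.mem_range.2 (Nat.mod_lt s hk)) y] at h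
  rwa [div_eq_inv_mul]

theorem measure_sum_nonpos_le {k : ℕ} (hk : 0 < k) {Y : ℕ → Ω → ℝ} (hY : ∀ s, Measurable (Y s))
    {a : ℝ≥0∞} (ha : a ≤ 1) (T : ℕ)
    (h : ∀ v < k, ∫⁻ ω, ∏ s ∈ (Finset.range T).filter (fun s => s % k = v),
      ENNReal.ofReal (Real.exp (-Y s ω)) ∂μ ≤
        a ^ ((Finset.range T).filter (fun s => s % k = v)).card) :
    μ {ω | ∑ s ∈ Finset.range T, Y s ω ≤ 0} ≤ a ^ (T / k) := by
  have hk0 : (0 : ℝ) < k := by exact_mod_cast hk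
  have hm : ∀ s, Measurable fun ω => ENNReal.ofReal (Real.exp (-Y s ω)) := fun s =>
    (Real.measurable_exp.comp (hY s).neg).ennreal_ofReal
  have hsub : {ω | ∑ s ∈ Finset.range T, Y s ω ≤ 0} ⊆
      {ω | 1 ≤ ENNReal.ofReal (k : ℝ)⁻¹ * ∑ v ∈ Finset.range k,
        ∏ s ∈ (Finset.range T).filter (fun s => s % k = v),
          ENNReal.ofReal (Real.exp (-Y s ω))} := by
    intro ω hω
    have h1 : 1 ≤ Real.exp ((∑ s ∈ Finset.range T, -Y s ω) / k) := by
      rw [Real.one_le_exp_iff, Finset.sum_neg_distrib]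
      exact div_nonneg (neg_nonneg.2 hω) hk0.le
    have h2 := ENNReal.ofReal_le_ofReal (h1.trans (exp_sum_div_le hk (fun s => -Y s ω) T))
    rw [ENNReal.ofReal_one, ENNReal.ofReal_mul (by positivity), ENNReal.ofReal_sum_of_nonneg
      fun _ _ => Finset.prod_nonneg fun _ _ => (Real.exp_pos _).le] at h2
    simp_rw [ENNReal.ofReal_prod_of_nonneg fun s _ => (Real.exp_pos _).le] at h2
    exact h2
  refine (measure_mono hsub).trans ?_
  have hmark := mul_meas_ge_le_lintegral (μ := μ) (f := fun ω => ENNReal.ofReal (k : ℝ)⁻¹ *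
    ∑ v ∈ Finset.range k, ∏ s ∈ (Finset.range T).filter (fun s => s % k = v),
      ENNReal.ofReal (Real.exp (-Y s ω)))
    ((Finset.measurable_sum _ fun v _ => Finset.measurable_prod _ fun s _ => hm s).const_mul _) 1
  rw [one_mul] at hmark
  refine hmark.trans ?_
  rw [lintegral_const_mul _
    (Finset.measurable_sum _ fun v _ => Finset.measurable_prod _ fun s _ => hm s),
    lintegral_finsetSum _ fun v _ => Finset.measurable_prod _ fun s _ => hm s]
  calc _ ≤ ENNReal.ofReal (k : ℝ)⁻¹ * ∑ _v ∈ Finset.range k, a ^ (T / k) := by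
        refine mul_le_mul_right (Finset.sum_le_sum fun v hv => ?_) _
        have hv := Finset.mem_range.1 hv
        exact (h v hv).trans (pow_le_pow_right_of_le_one' ha (div_le_card_filter_mod hv T))
    _ = a ^ (T / k) := by
        rw [Finset.sum_const, Finset.card_range, nsmul_eq_mul, ← mul_assoc,
          ← ENNReal.ofReal_natCast, ← ENNReal.ofReal_mul (by positivity),
          inv_mul_cancel₀ hk0.ne', ENNReal.ofReal_one, one_mul]

theorem exp_le_one_add_two_mul {x : ℝ} (h0 : 0 ≤ x) (h1 : x ≤ 1) : Real.exp x ≤ 1 + 2 * x := by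
  have := Real.abs_exp_sub_one_sub_id_le (x := x) (by rwa [abs_of_nonneg h0])
  have := (abs_le.1 this).2
  nlinarith

theorem three_quarters_le_sqrt : 3 / 4 ≤ Real.sqrt (2 / Real.pi) := by
  refine Real.le_sqrt_of_sq_le ?_
  rw [le_div_iff₀ Real.pi_pos]
  have := Real.pi_lt_d2
  nlinarith

variable [IsProbabilityMeasure μ] {n m k : ℕ} {Z : Data Ω n m} {σ η p : ℝ}

/-- The exponential moment at the parameter `θ / (4 a)`, where `a = σ‖z‖₂` is the standard
deviation of `⟨z, U⟩`. -/
theorem DataAssumptions.lintegral_exp_window_le (h : DataAssumptions μ Z σ η p) (hσ : 0 < σ)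
    (hp : 0 ≤ p) {θ : ℝ} (hθ : θ = 1 - 2 * attackProb k p) (hθ0 : 0 < θ) (hθ1 : θ ≤ 1)
    {z : Fin k × Fin m → ℝ} (hz : 0 < vecNorm z) (s : ℕ) :
    ∫⁻ ω, ENNReal.ofReal (Real.exp (-(θ / (4 * (σ * vecNorm z)) *
      (Z.windowSign k s ω * |z ⬝ᵥ Z.window k s ω| - θ / 4 * (σ * vecNorm z))))) ∂μ ≤
        ENNReal.ofReal (Real.exp (-(θ ^ 2 / 16))) := by
  have hz' : Measurable fun v : Fin k × Fin m → ℝ => z ⬝ᵥ v := by unfold dotProduct; fun_prop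
  have hind := (h.indepFun_window_windowSign k s).comp hz' measurable_id
  have hlaw := h.map_dotProduct_window k s z
  set a := σ * vecNorm z with ha
  have ha0 : 0 < a := mul_pos hσ hz
  set l := θ / (4 * a) with hl
  have hl0 : 0 ≤ l := by positivity
  obtain ⟨hi, hle⟩ := integral_exp_neg_sign_mul_abs_le (h.measurable_dotProduct_window k s z)
    (h.measurable_windowSign k s) hind (Z.windowSign_eq k s) ha0.le hlaw hl0
    (by rw [h.integral_windowSign hp, ← hθ]; exact hθ0.le)
  have e : ∀ ω, Real.exp (-(l * (Z.windowSign k s ω * |z ⬝ᵥ Z.window k s ω| - θ / 4 * a))) =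
      Real.exp (θ ^ 2 / 16) * Real.exp (-l * (Z.windowSign k s ω * |z ⬝ᵥ Z.window k s ω|)) := by
    intro ω
    rw [← Real.exp_add]
    congr 1
    have : l * (θ / 4 * a) = θ ^ 2 / 16 := by rw [hl]; field_simp; norm_num
    linear_combination this
  simp_rw [e]
  rw [← ofReal_integral_eq_lintegral_ofReal (hi.const_mul _)
    (Filter.Eventually.of_forall fun ω => by positivity), integral_const_mul]
  refine ENNReal.ofReal_le_ofReal ?_
  rw [h.integral_windowSign hp, ← hθ] at hle
  have hla : l * a = θ / 4 := by rw [hl]; field_simp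
  have h2 : a ^ 2 * l ^ 2 / 2 = θ ^ 2 / 32 := by
    rw [← mul_pow, mul_comm a l, hla]; ring
  have h3 : Real.exp (a ^ 2 * l ^ 2 / 2) ≤ 1 + θ ^ 2 / 16 := by
    rw [h2]
    exact (exp_le_one_add_two_mul (by positivity) (by nlinarith)).trans (by linarith)
  have h4 : θ ^ 2 / 4 * (3 / 4) ≤ l * θ * (Real.sqrt (2 / Real.pi) * a) := by
    have : l * θ * (Real.sqrt (2 / Real.pi) * a) = θ ^ 2 / 4 * Real.sqrt (2 / Real.pi) := by
      linear_combination (θ * Real.sqrt (2 / Real.pi)) * hla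
    rw [this]
    exact mul_le_mul_of_nonneg_left three_quarters_le_sqrt (by positivity)
  have h5 : ∫ ω, Real.exp (-l * (Z.windowSign k s ω * |z ⬝ᵥ Z.window k s ω|)) ∂μ ≤
      Real.exp (-(θ ^ 2 / 8)) := by
    have := Real.add_one_le_exp (-(θ ^ 2 / 8))
    linarith
  calc _ ≤ Real.exp (θ ^ 2 / 16) * Real.exp (-(θ ^ 2 / 8)) := by gcongr
    _ = _ := by rw [← Real.exp_add]; congr 1; ring

/-- For a fixed direction `z`, the signed sum is large except on an event of exponentially small
probability. Windows whose starting times agree modulo `k` are disjoint and hence independent. -/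
theorem DataAssumptions.measure_sum_window_le (h : DataAssumptions μ Z σ η p) (hσ : 0 < σ)
    (hp : 0 ≤ p) (hk : 0 < k) {θ : ℝ} (hθ : θ = 1 - 2 * attackProb k p) (hθ0 : 0 < θ)
    (hθ1 : θ ≤ 1) {z : Fin k × Fin m → ℝ} (hz : 0 < vecNorm z) (T : ℕ) :
    μ {ω | ∑ s ∈ Finset.range T, Z.windowSign k s ω * |z ⬝ᵥ Z.window k s ω| ≤
        θ / 4 * (σ * vecNorm z) * T} ≤
      ENNReal.ofReal (Real.exp (-(θ ^ 2 / 16))) ^ (T / k) := by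
  have ha0 : 0 < σ * vecNorm z := mul_pos hσ hz
  have hl0 : 0 < θ / (4 * (σ * vecNorm z)) := by positivity
  set f : ℝ × (Fin k × Fin m → ℝ) → ℝ := fun q =>
    θ / (4 * (σ * vecNorm z)) * (q.1 * |z ⬝ᵥ q.2| - θ / 4 * (σ * vecNorm z)) with hfdef
  have hf : Measurable f := by
    unfold f dotProduct
    exact ((measurable_fst.mul (measurable_abs.comp (by fun_prop))).sub_const _).const_mul _
  have hf' : Measurable fun q => ENNReal.ofReal (Real.exp (-f q)) :=
    (Real.measurable_exp.comp hf.neg).ennreal_ofReal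
  set Y : ℕ → Ω → ℝ := fun s ω => f (Z.windowSign k s ω, Z.window k s ω) with hY
  have hfut : ∀ s, Z.future s ≤ mΩ := fun s => iSup₂_le fun t _ =>
    sup_le (h.meas_u t).comap_le (h.meas_ξ t).comap_le
  have hprod := fun v => lintegral_prod_le_of_indep (μ := μ) (k := k)
    (X := fun s ω => ENNReal.ofReal (Real.exp (-Y s ω))) v Z.history Z.future h.history_le hfut
    h.nonanticipating
    (fun s t hst => hf'.comp ((Z.measurable_windowSign fun i hi => Z.measurable_ξ_history
      (by omega)).prodMk (Z.measurable_window fun i hi => Z.measurable_u_history (by omega))))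
    (fun s => hf'.comp ((Z.measurable_windowSign_future k s).prodMk
      (Z.measurable_window_future k s)))
    (fun s => h.lintegral_exp_window_le hσ hp hθ hθ0 hθ1 hz s) T
  refine le_trans (measure_mono fun ω hω => ?_) (measure_sum_nonpos_le hk (Y := Y)
    (fun s => hf.comp ((h.measurable_windowSign k s).prodMk (h.measurable_window k s)))
    (ENNReal.ofReal_le_one.2 (Real.exp_le_one_iff.2 (by nlinarith))) T fun v _ => hprod v)
  simp only [Set.mem_ofPred_eq, hY, hfdef] at hω ⊢
  rw [← Finset.mul_sum, Finset.sum_sub_distrib]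
  refine mul_nonpos_of_nonneg_of_nonpos hl0.le ?_
  simp
  linarith

end Concentration

/-! ### Total size of the inputs and of the attacks -/

section Totals

theorem lintegral_mul_le_of_condExp_le {Ω : Type*} {F : MeasurableSpace Ω} {mΩ : MeasurableSpace Ω}
    {μ : Measure Ω} [IsProbabilityMeasure μ] (hF : F ≤ mΩ) {f : Ω → ℝ≥0∞} (hf : Measurable[F] f)
    {Y : Ω → ℝ} (hY : Integrable Y μ) (hY0 : ∀ ω, 0 ≤ Y ω) {c : ℝ} (hc : 0 ≤ c)
    (h : μ[Y | F] ≤ᵐ[μ] fun _ => c) :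
    ∫⁻ ω, f ω * ENNReal.ofReal (Y ω) ∂μ ≤ ENNReal.ofReal c * ∫⁻ ω, f ω ∂μ := by
  -- compare the measures `Y μ` and `c μ` on the smaller `σ`-algebra
  have hle : (μ.withDensity fun ω => ENNReal.ofReal (Y ω)).trim hF ≤
      ENNReal.ofReal c • μ.trim hF := by
    refine Measure.le_iff.2 fun A hA => ?_
    rw [trim_measurableSet_eq hF hA, withDensity_apply _ (hF A hA), Measure.smul_apply,
      trim_measurableSet_eq hF hA, smul_eq_mul, ← ofReal_integral_eq_lintegral_ofReal
      hY.integrableOn (Filter.Eventually.of_forall hY0), ← setIntegral_condExp hF hY hA,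
      ← ENNReal.ofReal_toReal (measure_ne_top μ A), ← ENNReal.ofReal_mul hc]
    refine ENNReal.ofReal_le_ofReal ((setIntegral_mono_ae integrable_condExp.integrableOn
      (integrable_const c).integrableOn h).trans ?_)
    rw [setIntegral_const, smul_eq_mul, mul_comm]
    exact le_rfl
  calc ∫⁻ ω, f ω * ENNReal.ofReal (Y ω) ∂μ
      = ∫⁻ ω, f ω ∂(μ.withDensity fun ω => ENNReal.ofReal (Y ω)) := by
        rw [lintegral_withDensity_eq_lintegral_mul₀ hY.aemeasurable.ennreal_ofReal
          (hf.mono hF le_rfl).aemeasurable]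
        simp [mul_comm]
    _ = ∫⁻ ω, f ω ∂((μ.withDensity fun ω => ENNReal.ofReal (Y ω)).trim hF) :=
        (lintegral_trim hF hf).symm
    _ ≤ ∫⁻ ω, f ω ∂(ENNReal.ofReal c • μ.trim hF) := lintegral_mono' hle le_rfl
    _ = _ := by rw [lintegral_smul_measure, lintegral_trim hF hf, smul_eq_mul]

variable {Ω : Type*} [mΩ : MeasurableSpace Ω] {μ : Measure Ω} {n m k : ℕ} {Z : Data Ω n m}
  {σ η p : ℝ}

theorem two_mul_exp_half_le : 2 * Real.exp (1 / 2) ≤ Real.exp 2 := by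
  have h1 : (1 / 2 : ℝ) + 1 ≤ Real.exp (1 / 2) := Real.add_one_le_exp _
  have h2 : (3 / 2 : ℝ) + 1 ≤ Real.exp (3 / 2) := Real.add_one_le_exp _
  have e : Real.exp 2 = Real.exp (3 / 2) * Real.exp (1 / 2) := by
    rw [← Real.exp_add]; norm_num
  rw [e]
  nlinarith

theorem lintegral_exp_abs_gaussian_le {X : Ω → ℝ} (hm : Measurable X) (hσ : 0 < σ)
    (h : μ.map X = gaussianReal 0 (Real.toNNReal (σ ^ 2))) :
    ∫⁻ ω, ENNReal.ofReal (Real.exp (|X ω| / σ)) ∂μ ≤ ENNReal.ofReal (Real.exp 2) := by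
  have hexp := integrable_exp_mul_of_map_gaussianReal hm h
  have hmgf : ∀ t : ℝ, ∫ ω, Real.exp (t * X ω) ∂μ = Real.exp (σ ^ 2 * t ^ 2 / 2) := fun t => by
    have := mgf_gaussianReal h t
    rw [Real.coe_toNNReal _ (sq_nonneg σ), zero_mul, zero_add] at this
    exact this
  have hle : ∀ ω, Real.exp (|X ω| / σ) ≤ Real.exp (σ⁻¹ * X ω) + Real.exp (-σ⁻¹ * X ω) := by
    intro ω
    rcases abs_cases (X ω) with ⟨h1, _⟩ | ⟨h1, _⟩ <;> rw [h1]
    · rw [div_eq_inv_mul]; linarith [Real.exp_pos (-σ⁻¹ * X ω)]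
    · rw [div_eq_inv_mul, mul_neg, ← neg_mul]; linarith [Real.exp_pos (σ⁻¹ * X ω)]
  refine (lintegral_mono fun ω => ENNReal.ofReal_le_ofReal (hle ω)).trans ?_
  have hi : Integrable (fun ω => Real.exp (σ⁻¹ * X ω) + Real.exp (-σ⁻¹ * X ω)) μ :=
    (hexp _).add (hexp _)
  rw [← ofReal_integral_eq_lintegral_ofReal hi
    (Filter.Eventually.of_forall fun ω => by positivity),
    integral_add (hexp _) (hexp _), hmgf, hmgf, neg_sq, inv_pow,
    mul_inv_cancel₀ (by positivity)]
  refine ENNReal.ofReal_le_ofReal ?_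
  rw [← two_mul]
  exact two_mul_exp_half_le

/-- Markov's inequality for the exponential of a random variable. -/
theorem measure_lt_le_of_lintegral_exp {X : Ω → ℝ} (hm : Measurable X) {A B : ℝ}
    (h : ∫⁻ ω, ENNReal.ofReal (Real.exp (X ω)) ∂μ ≤ ENNReal.ofReal (Real.exp A)) :
    μ {ω | B < X ω} ≤ ENNReal.ofReal (Real.exp (A - B)) := by
  have hmark := mul_meas_ge_le_lintegral (μ := μ)
    (f := fun ω => ENNReal.ofReal (Real.exp (X ω)))
    (Real.measurable_exp.comp hm).ennreal_ofReal (ENNReal.ofReal (Real.exp B))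
  have hpos : ENNReal.ofReal (Real.exp B) ≠ 0 := by
    rw [Ne, ENNReal.ofReal_eq_zero, not_le]; exact Real.exp_pos B
  have hsub : {ω | B < X ω} ⊆
      {ω | ENNReal.ofReal (Real.exp B) ≤ ENNReal.ofReal (Real.exp (X ω))} := fun ω hω =>
    ENNReal.ofReal_le_ofReal (Real.exp_le_exp.2 (le_of_lt hω))
  refine (measure_mono hsub).trans ?_
  rw [Real.exp_sub, ENNReal.ofReal_div_of_pos (Real.exp_pos B),
    ENNReal.le_div_iff_mul_le (Or.inl hpos) (Or.inl ENNReal.ofReal_ne_top), mul_comm]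
  exact hmark.trans h

/-- The `ℓ₁`-size of the inputs before time `T`. -/
def Data.inputTotal (Z : Data Ω n m) (T : ℕ) (ω : Ω) : ℝ :=
  ∑ t ∈ Finset.range T, ∑ a, |Z.u t ω a|

theorem DataAssumptions.measurable_inputTotal (h : DataAssumptions μ Z σ η p) (T : ℕ) :
    Measurable (Z.inputTotal T) :=
  Finset.measurable_sum _ fun t _ => Finset.measurable_sum _ fun a _ =>
    measurable_abs.comp (h.measurable_u_apply t a)

theorem DataAssumptions.measure_inputTotal_le [IsProbabilityMeasure μ]
    (h : DataAssumptions μ Z σ η p) (hσ : 0 < σ) (T : ℕ) (B : ℝ) :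
    μ {ω | B < Z.inputTotal T ω / σ} ≤ ENNReal.ofReal (Real.exp (2 * (T * m) - B)) := by
  refine measure_lt_le_of_lintegral_exp ((h.measurable_inputTotal T).div_const σ) ?_
  have hind := (h.iIndepFun_u_apply.precomp
    (g := fun q : Fin T × Fin m => ((q.1 : ℕ), q.2)) (fun q q' hq => by
      simp only [Prod.mk.injEq] at hq
      exact Prod.ext (Fin.ext hq.1) hq.2)).comp
    (fun _ x => ENNReal.ofReal (Real.exp (|x| / σ)))
    fun _ => (Real.measurable_exp.comp (measurable_abs.div_const σ)).ennreal_ofReal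
  have hprod := lintegral_prod_eq_prod_lintegral_of_indepFun Finset.univ _ hind
    fun q => (Real.measurable_exp.comp (measurable_abs.div_const σ)).ennreal_ofReal.comp
      (h.measurable_u_apply q.1 q.2)
  have e : ∀ ω, ENNReal.ofReal (Real.exp (Z.inputTotal T ω / σ)) =
      ∏ q : Fin T × Fin m, ENNReal.ofReal (Real.exp (|Z.u q.1 ω q.2| / σ)) := by
    intro ω
    rw [← ENNReal.ofReal_prod_of_nonneg fun _ _ => (Real.exp_pos _).le, ← Real.exp_sum,
      ← Finset.sum_div, Fintype.sum_prod_type, Data.inputTotal,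
      ← Fin.sum_univ_eq_sum_range (fun t => ∑ a, |Z.u t ω a|)]
  simp_rw [e]
  refine hprod.le.trans ((Finset.prod_le_prod' fun q _ => lintegral_exp_abs_gaussian_le
    (h.measurable_u_apply q.1 q.2) hσ (h.map_u_apply q.1 q.2)).trans (le_of_eq ?_))
  rw [Finset.prod_const, ← ENNReal.ofReal_pow (Real.exp_pos _).le, ← Real.exp_nat_mul]
  simp [mul_comm]

/-- The normalized squared size of the initial state and of the attacks before time `T`. -/
def Data.attackTotal (Z : Data Ω n m) (η : ℝ) (T : ℕ) (ω : Ω) : ℝ :=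
  vecNorm (Z.x₀ ω) ^ 2 / η ^ 2 + ∑ t ∈ Finset.range T, vecNorm (Z.w t ω) ^ 2 / η ^ 2

theorem Data.measurable_attackTotal_attackFiltration {Ω : Type*} {n m : ℕ} (Z : Data Ω n m)
    (η : ℝ) (T : ℕ) :
    Measurable[Z.attackFiltration T] (Z.attackTotal η T) := by
  have hx : Measurable[Z.attackFiltration T] Z.x₀ :=
    measurable_iff_comap_le.2 le_sup_left
  have hw : ∀ t < T, Measurable[Z.attackFiltration T] (Z.w t) := fun t ht =>
    measurable_iff_comap_le.2 (le_sup_of_le_right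
      (le_iSup₂_of_le (f := fun s (_ : s < T) => MeasurableSpace.comap (Z.w s) inferInstance)
        t ht le_rfl))
  exact (((measurable_vecNorm.comp hx).pow_const 2).div_const _).add
    (Finset.measurable_sum _ fun t ht => ((measurable_vecNorm.comp
      (hw t (Finset.mem_range.1 ht))).pow_const 2).div_const _)

/-- The bound follows by conditioning on the past, one time step after the other. -/
theorem DataAssumptions.lintegral_exp_attackTotal_le [IsProbabilityMeasure μ]
    (h : DataAssumptions μ Z σ η p) (T : ℕ) :
    ∫⁻ ω, ENNReal.ofReal (Real.exp (Z.attackTotal η T ω)) ∂μ ≤ 2 ^ (T + 1) := by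
  induction T with
  | zero =>
    have h2 := h.subGaussian_x₀.integral_exp_le bot_le
    have e : ∀ ω, Z.attackTotal η 0 ω = vecNorm (Z.x₀ ω) ^ 2 / η ^ 2 := fun ω => by
      simp [Data.attackTotal]
    simp_rw [e]
    rw [← ofReal_integral_eq_lintegral_ofReal h.subGaussian_x₀.1
      (Filter.Eventually.of_forall fun ω => (Real.exp_pos _).le)]
    refine (ENNReal.ofReal_le_ofReal h2).trans (le_of_eq ?_)
    simp
  | succ T ih =>
    have hm := Z.measurable_attackTotal_attackFiltration η T
    have e : ∀ ω, ENNReal.ofReal (Real.exp (Z.attackTotal η (T + 1) ω)) =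
        ENNReal.ofReal (Real.exp (Z.attackTotal η T ω)) *
          ENNReal.ofReal (Real.exp (vecNorm (Z.w T ω) ^ 2 / η ^ 2)) := by
      intro ω
      rw [← ENNReal.ofReal_mul (Real.exp_pos _).le, ← Real.exp_add, Data.attackTotal,
        Data.attackTotal, Finset.sum_range_succ, ← add_assoc]
    simp_rw [e]
    refine (lintegral_mul_le_of_condExp_le (h.attackFiltration_le T)
      (Real.measurable_exp.comp hm).ennreal_ofReal (h.subGaussian_w T).1
      (fun ω => (Real.exp_pos _).le) two_pos.le (h.subGaussian_w T).2).trans ?_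
    rw [pow_succ' _ (T + 1), ENNReal.ofReal_ofNat]
    exact mul_le_mul_right ih _

theorem DataAssumptions.measurable_attackTotal (h : DataAssumptions μ Z σ η p) (T : ℕ) :
    Measurable (Z.attackTotal η T) :=
  (Z.measurable_attackTotal_attackFiltration η T).mono (h.attackFiltration_le T) le_rfl

theorem DataAssumptions.measure_attackTotal_le [IsProbabilityMeasure μ]
    (h : DataAssumptions μ Z σ η p) (T : ℕ) (B : ℝ) :
    μ {ω | B < Z.attackTotal η T ω} ≤ ENNReal.ofReal (Real.exp ((T + 1) - B)) := by
  refine measure_lt_le_of_lintegral_exp (h.measurable_attackTotal T)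
    ((h.lintegral_exp_attackTotal_le T).trans ?_)
  have h2 : (2 : ℝ) ≤ Real.exp 1 := by
    have := Real.add_one_le_exp (1 : ℝ); linarith
  have e : Real.exp ((T : ℝ) + 1) = Real.exp 1 ^ (T + 1) := by
    rw [← Real.exp_nat_mul]; push_cast; rw [mul_one]
  rw [e, ENNReal.ofReal_pow (Real.exp_pos _).le]
  refine pow_le_pow_left' ?_ _
  rw [← ENNReal.ofReal_ofNat]
  exact ENNReal.ofReal_le_ofReal h2

/-- A bound for the states on the event that the totals are not too large. -/
theorem Data.sum_stateBound_le {Ω : Type*} (Z : Data Ω n m) (hη : 0 < η) {ψ ρ b : ℝ}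
    (hψ : 0 ≤ ψ) (h0 : 0 ≤ ρ) (h1 : ρ < 1) (hb : 0 ≤ b) {T : ℕ} (hT : 1 ≤ T) {ω : Ω} {V : ℝ}
    (hV : Z.inputTotal T ω ≤ V * T) (hW : Z.attackTotal η T ω ≤ 3 * T) :
    ∑ s ∈ Finset.range T, Z.stateBound ψ ρ b s ω ≤ ψ * (b * V + 3 * η) * T / (1 - ρ) := by
  have hT' : (1 : ℝ) ≤ T := by exact_mod_cast hT
  refine (SysId.sum_stateBound_le hψ h0 h1 hb (vecNorm_nonneg _) (fun t => vecNorm_nonneg _)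
    (fun t => vecNorm_nonneg _) T).trans ?_
  have hu : ∑ t ∈ Finset.range T, vecNorm (Z.u t ω) ≤ V * T :=
    (Finset.sum_le_sum fun t _ => vecNorm_le_sum_abs _).trans hV
  have hone : ∀ x : ℝ, x ≤ η / 2 * (1 + x ^ 2 / η ^ 2) := by
    intro x
    have e : η / 2 * (1 + x ^ 2 / η ^ 2) - x = (x - η) ^ 2 / (2 * η) := by field_simp; ring
    have : 0 ≤ (x - η) ^ 2 / (2 * η) := by positivity
    linarith
  have hw : vecNorm (Z.x₀ ω) + ∑ t ∈ Finset.range T, vecNorm (Z.w t ω) ≤ 3 * η * T := by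
    refine (add_le_add (hone _) (Finset.sum_le_sum fun t _ => hone (vecNorm (Z.w t ω)))).trans ?_
    rw [← Finset.mul_sum, ← mul_add, Finset.sum_add_distrib]
    have hW' := hW
    rw [Data.attackTotal] at hW'
    simp only [Finset.sum_const, Finset.card_range, nsmul_eq_mul, mul_one]
    calc _ ≤ η / 2 * (1 + T + 3 * T) :=
          mul_le_mul_of_nonneg_left (by linarith) (by positivity)
      _ ≤ _ := by nlinarith
  have hρ1 : 0 < 1 - ρ := by linarith
  rw [mul_assoc]
  gcongr
  have := mul_le_mul_of_nonneg_left hu hb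
  linarith

end Totals

/-! ### From finitely many directions to all matrices -/

section Net

variable {ι κ : Type*} [Fintype ι] [Fintype κ]

/-- The points of the grid `{-N, …, N} ^ κ / N`. -/
def gridPoint (N : ℕ) (v : κ → Fin (2 * N + 1)) : κ → ℝ := fun c => ((v c : ℝ) - N) / N

theorem exists_gridPoint {κ : Type*} {N : ℕ} (hN : 0 < N) (z : κ → ℝ) (hz : ∀ c, |z c| ≤ 1) :
    ∃ v : κ → Fin (2 * N + 1), ∀ c, |z c - gridPoint N v c| ≤ 1 / N := by
  have hN0 : (0 : ℝ) < N := by exact_mod_cast hN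
  have h : ∀ c, ∃ i : Fin (2 * N + 1), |z c - ((i : ℝ) - N) / N| ≤ 1 / N := by
    intro c
    obtain ⟨h1, h2⟩ := abs_le.1 (hz c)
    have hlo : -(N : ℤ) ≤ ⌊N * z c⌋ := Int.le_floor.2 (by push_cast; nlinarith)
    have hhi : ⌊N * z c⌋ ≤ N := by
      have : (⌊N * z c⌋ : ℝ) ≤ N := (Int.floor_le _).trans (by nlinarith)
      exact_mod_cast this
    refine ⟨⟨(⌊N * z c⌋ + N).toNat, by omega⟩, ?_⟩
    have e : (((⌊N * z c⌋ + N).toNat : ℕ) : ℝ) = ⌊N * z c⌋ + N := by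
      have : (((⌊N * z c⌋ + N).toNat : ℕ) : ℤ) = ⌊N * z c⌋ + N := Int.toNat_of_nonneg (by omega)
      exact_mod_cast this
    simp only [e, add_sub_cancel_right]
    have h3 := Int.floor_le (N * z c)
    have h4 := Int.lt_floor_add_one (N * z c)
    have e2 : z c - (⌊N * z c⌋ : ℝ) / N = (N * z c - ⌊N * z c⌋) / N := by field_simp
    rw [e2, abs_of_nonneg (div_nonneg (by linarith) hN0.le)]
    gcongr
    linarith
  choose v hv using h
  exact ⟨v, hv⟩

/-- A lower bound at the grid points extends to all vectors. The grid is fine enough for a grid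
point `x` next to a unit vector `z` to satisfy `‖x‖ ≥ 1/2`, and for the change of the sum to be at
most `A`; this leaves `4 A · 1/2 - A = A`. -/
theorem lower_bound_of_gridPoint {N T : ℕ} (hN : 2 * Fintype.card κ ≤ N) (hN0 : 0 < N) {τ : ℕ → ℝ}
    (hτ : ∀ s, |τ s| = 1) {U : ℕ → κ → ℝ} {A : ℝ}
    (hgrid : ∀ v : κ → Fin (2 * N + 1), 0 < vecNorm (gridPoint N v) →
      4 * A * vecNorm (gridPoint N v) ≤ ∑ s ∈ Finset.range T, τ s * |gridPoint N v ⬝ᵥ U s|)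
    (hU : ∑ s ∈ Finset.range T, ∑ c, |U s c| ≤ A * N) (z : κ → ℝ) :
    A * vecNorm z ≤ ∑ s ∈ Finset.range T, τ s * |z ⬝ᵥ U s| := by
  have hN1 : (0 : ℝ) < N := by exact_mod_cast hN0
  have hA : 0 ≤ A := by
    have : 0 ≤ A * N := (Finset.sum_nonneg fun s _ => Finset.sum_nonneg fun c _ =>
      abs_nonneg _).trans hU
    exact nonneg_of_mul_nonneg_left this hN1
  rcases (vecNorm_nonneg z).eq_or_lt with h0 | hpos
  · rw [vecNorm_eq_zero h0.symm]; simp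
  set y := (vecNorm z)⁻¹ • z with hy
  have hyn : vecNorm y = 1 := by
    rw [hy, vecNorm_smul, abs_of_pos (inv_pos.2 hpos), inv_mul_cancel₀ hpos.ne']
  obtain ⟨v, hv⟩ := exists_gridPoint hN0 y fun c => (abs_apply_le_vecNorm y c).trans hyn.le
  set x := gridPoint N v
  have hdist : vecNorm (y - x) ≤ 1 / 2 := by
    refine (vecNorm_le_sum_abs _).trans ((Finset.sum_le_sum fun c _ => hv c).trans ?_)
    have : 2 * (Fintype.card κ : ℝ) ≤ N := by exact_mod_cast hN
    rw [Finset.sum_const, nsmul_eq_mul, Finset.card_univ, mul_one_div, div_le_div_iff₀ hN1 two_pos]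
    linarith
  have hx : 1 / 2 ≤ vecNorm x := by
    have := vecNorm_add_le (y - x) x
    rw [sub_add_cancel, hyn] at this
    linarith
  have h1 := hgrid v (by linarith)
  have hterm : ∀ s, τ s * |x ⬝ᵥ U s| - 1 / N * ∑ c, |U s c| ≤ τ s * |y ⬝ᵥ U s| := by
    intro s
    have h2 : |x ⬝ᵥ U s - y ⬝ᵥ U s| ≤ 1 / N * ∑ c, |U s c| := by
      rw [← sub_dotProduct, dotProduct, Finset.mul_sum]
      refine (Finset.abs_sum_le_sum_abs _ _).trans (Finset.sum_le_sum fun c _ => ?_)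
      rw [abs_mul, Pi.sub_apply, abs_sub_comm]
      exact mul_le_mul_of_nonneg_right (hv c) (abs_nonneg _)
    have h3 : |τ s * (|x ⬝ᵥ U s| - |y ⬝ᵥ U s|)| ≤ 1 / N * ∑ c, |U s c| := by
      rw [abs_mul, hτ, one_mul]
      exact (abs_abs_sub_abs_le_abs_sub _ _).trans h2
    have := (abs_le.1 h3).2
    linarith
  have h4 := Finset.sum_le_sum fun s (_ : s ∈ Finset.range T) => hterm s
  rw [Finset.sum_sub_distrib, ← Finset.mul_sum] at h4
  have h5 : 1 / N * ∑ s ∈ Finset.range T, ∑ c, |U s c| ≤ A := by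
    rw [one_div, inv_mul_le_iff₀ hN1]; linarith
  have h6 : A ≤ ∑ s ∈ Finset.range T, τ s * |y ⬝ᵥ U s| := by nlinarith
  have h7 : ∀ s, τ s * |z ⬝ᵥ U s| = vecNorm z * (τ s * |y ⬝ᵥ U s|) := by
    intro s
    rw [hy, smul_dotProduct, smul_eq_mul, abs_mul, abs_of_pos (inv_pos.2 hpos)]
    field_simp
  simp_rw [h7]
  rw [← Finset.mul_sum, mul_comm]
  exact mul_le_mul_of_nonneg_left h6 hpos.le

/-- A lower bound for vectors extends to matrices with any number of rows, without loss: if `g` is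
a standard Gaussian vector, then `‖v‖₂` is proportional to the mean of `|⟨v, g⟩|`, and
`⟨M u, g⟩ = ⟨Mᵀ g, u⟩`. -/
theorem lower_bound_matrix {T : ℕ} {τ : ℕ → ℝ} {U : ℕ → κ → ℝ} {A : ℝ} (hA : 0 ≤ A)
    (h : ∀ z, A * vecNorm z ≤ ∑ s ∈ Finset.range T, τ s * |z ⬝ᵥ U s|) (M : Matrix ι κ ℝ) :
    A * frobNorm M ≤ ∑ s ∈ Finset.range T, τ s * vecNorm (M.mulVec (U s)) := by
  set ν : Measure (ι → ℝ) := Measure.pi fun _ => gaussianReal 0 (Real.toNNReal (1 ^ 2)) with hν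
  set C := Real.sqrt (2 / Real.pi)
  have hC : 0 < C := Real.sqrt_pos.2 (by positivity)
  have hind : iIndepFun (fun (i : ι) (x : ι → ℝ) => x i) ν :=
    iIndepFun_pi (X := fun _ x => x) fun _ => aemeasurable_id'
  have hlaw : ∀ z : ι → ℝ, ν.map (fun x => z ⬝ᵥ x) =
      gaussianReal 0 (Real.toNNReal ((1 * vecNorm z) ^ 2)) := fun z =>
    map_dotProduct_gaussianReal hind measurable_pi_apply
      (fun i => (measurePreserving_eval _ i).map_eq) z
  have hmeas : ∀ z : ι → ℝ, Measurable fun x : ι → ℝ => z ⬝ᵥ x := fun z => by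
    unfold dotProduct; fun_prop
  have hint : ∀ z : ι → ℝ, Integrable (fun x => |z ⬝ᵥ x|) ν := fun z =>
    integrable_abs_of_map_gaussianReal (hmeas z) (hlaw z)
  have hval : ∀ z : ι → ℝ, ∫ x, |z ⬝ᵥ x| ∂ν = C * vecNorm z := fun z => by
    rw [integral_abs_of_map_gaussianReal (hmeas z)
      (mul_nonneg zero_le_one (vecNorm_nonneg z)) (hlaw z), one_mul]
  have hfrob : C * frobNorm M ≤ ∫ x, vecNorm (M.transpose.mulVec x) ∂ν := by
    have : frobNorm M = frobNorm M.transpose := by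
      unfold frobNorm frobInner
      rw [Finset.sum_comm]
      rfl
    rw [this]
    exact mul_frobNorm_le_integral_vecNorm measurable_id hint hval M.transpose
  have hnorm : Integrable (fun x => vecNorm (M.transpose.mulVec x)) ν := by
    refine ((integrable_vecNorm_of_dotProduct measurable_id hint).const_mul
      (frobNorm M.transpose)).mono' (measurable_vecNorm.comp ?_).aestronglyMeasurable
      (Filter.Eventually.of_forall fun x => ?_)
    · unfold Matrix.mulVec dotProduct; fun_prop
    · rw [Real.norm_of_nonneg (vecNorm_nonneg _)]
      exact vecNorm_mulVec_le_frobNorm _ _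
  have hdot : ∀ s x, |M.transpose.mulVec x ⬝ᵥ U s| = |M.mulVec (U s) ⬝ᵥ x| := fun s x => by
    rw [Matrix.mulVec_transpose, ← Matrix.dotProduct_mulVec, dotProduct_comm]
  have hsumi : ∀ s, Integrable (fun x => τ s * |M.mulVec (U s) ⬝ᵥ x|) ν := fun s =>
    (hint _).const_mul _
  have hmono : ∫ x, A * vecNorm (M.transpose.mulVec x) ∂ν ≤
      ∫ x, ∑ s ∈ Finset.range T, τ s * |M.mulVec (U s) ⬝ᵥ x| ∂ν :=
    integral_mono (hnorm.const_mul A) (integrable_finsetSum _ fun s _ => hsumi s) fun x => by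
      simp only [← hdot]
      exact h _
  rw [integral_const_mul, integral_finsetSum _ fun s _ => hsumi s] at hmono
  simp_rw [integral_const_mul, hval] at hmono
  have e : ∑ s ∈ Finset.range T, τ s * (C * vecNorm (M.mulVec (U s))) =
      C * ∑ s ∈ Finset.range T, τ s * vecNorm (M.mulVec (U s)) := by
    rw [Finset.mul_sum]
    exact Finset.sum_congr rfl fun s _ => by ring
  rw [e] at hmono
  have := mul_le_mul_of_nonneg_left hfrob hA
  refine le_of_mul_le_mul_left ?_ hC
  linarith

end Net

/-! ### The directions on the grid -/

section Grid

variable {Ω : Type*} [mΩ : MeasurableSpace Ω] {μ : Measure Ω} {n m k : ℕ} {Z : Data Ω n m}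
  {σ η p : ℝ}

theorem sum_abs_window_le {Ω : Type*} (Z : Data Ω n m) (hk : 0 < k) (T : ℕ) (ω : Ω) :
    ∑ s ∈ Finset.range T, ∑ c, |Z.window k s ω c| ≤ k * Z.inputTotal (T + (k - 1)) ω := by
  have e : ∀ s, ∑ c, |Z.window k s ω c| =
      ∑ j : Fin k, ∑ a, |Z.u (s + (k - 1 - (j : ℕ))) ω a| := by
    intro s
    rw [Fintype.sum_prod_type]
    refine Finset.sum_congr rfl fun j _ => Finset.sum_congr rfl fun a _ => ?_
    have := j.2
    simp only [Data.window, stackedInput, Data.input]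
    rw [show s + (k - 1) - (j : ℕ) = s + (k - 1 - j) by omega]
  simp_rw [e]
  rw [Finset.sum_comm]
  have hj : ∀ j ∈ (Finset.univ : Finset (Fin k)), ∑ s ∈ Finset.range T,
      ∑ a, |Z.u (s + (k - 1 - (j : ℕ))) ω a| ≤ Z.inputTotal (T + (k - 1)) ω := by
    intro j _
    rw [Finset.range_eq_Ico, Finset.sum_Ico_add' (fun t => ∑ a, |Z.u t ω a|), Data.inputTotal]
    refine Finset.sum_le_sum_of_subset_of_nonneg (fun t ht => ?_)
      fun _ _ _ => Finset.sum_nonneg fun _ _ => abs_nonneg _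
    have := Finset.mem_Ico.1 ht
    exact Finset.mem_range.2 (by omega)
  refine (Finset.sum_le_sum hj).trans (le_of_eq ?_)
  simp

/-- The event that the signed sum exceeds its threshold in all directions of the grid. -/
def gridEvent (Z : Data Ω n m) (k N T : ℕ) (A : ℝ) : Set Ω :=
  {ω | ∀ v : Fin k × Fin m → Fin (2 * N + 1), 0 < vecNorm (gridPoint N v) →
    A * vecNorm (gridPoint N v) * T <
      ∑ s ∈ Finset.range T, Z.windowSign k s ω * |gridPoint N v ⬝ᵥ Z.window k s ω|}

theorem DataAssumptions.measurableSet_gridEvent (h : DataAssumptions μ Z σ η p) (k N T : ℕ)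
    (A : ℝ) : MeasurableSet (gridEvent Z k N T A) := by
  have e : gridEvent Z k N T A = ⋂ v : Fin k × Fin m → Fin (2 * N + 1),
      ⋂ _ : 0 < vecNorm (gridPoint N v), {ω | A * vecNorm (gridPoint N v) * T <
      ∑ s ∈ Finset.range T, Z.windowSign k s ω * |gridPoint N v ⬝ᵥ Z.window k s ω|} := by
    ext ω; simp [gridEvent]
  rw [e]
  exact MeasurableSet.iInter fun v => MeasurableSet.iInter fun _ =>
    measurableSet_lt measurable_const (Finset.measurable_sum _ fun s _ =>
      (h.measurable_windowSign k s).mul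
        (measurable_abs.comp (h.measurable_dotProduct_window k s _)))

theorem DataAssumptions.measure_compl_gridEvent_le [IsProbabilityMeasure μ]
    (h : DataAssumptions μ Z σ η p) (hσ : 0 < σ) (hp : 0 ≤ p) (hk : 0 < k) {θ : ℝ}
    (hθ : θ = 1 - 2 * attackProb k p) (hθ0 : 0 < θ) (hθ1 : θ ≤ 1) (N T : ℕ) :
    μ (gridEvent Z k N T (θ / 4 * σ))ᶜ ≤ ENNReal.ofReal
      ((2 * N + 1) ^ (k * m) * Real.exp (-(θ ^ 2 / 16)) ^ (T / k)) := by
  have hsub : (gridEvent Z k N T (θ / 4 * σ))ᶜ ⊆ ⋃ v : Fin k × Fin m → Fin (2 * N + 1),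
      {ω | 0 < vecNorm (gridPoint N v) ∧ ∑ s ∈ Finset.range T,
        Z.windowSign k s ω * |gridPoint N v ⬝ᵥ Z.window k s ω| ≤
          θ / 4 * (σ * vecNorm (gridPoint N v)) * T} := by
    intro ω hω
    simp only [gridEvent, Set.mem_compl_iff, Set.mem_ofPred_eq, not_forall, not_lt] at hω
    obtain ⟨v, hv, hle⟩ := hω
    refine Set.mem_iUnion.2 ⟨v, hv, hle.trans (le_of_eq ?_)⟩
    ring
  refine (measure_mono hsub).trans ((measure_iUnion_fintype_le _ _).trans ?_)
  calc _ ≤ ∑ _v : Fin k × Fin m → Fin (2 * N + 1),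
        ENNReal.ofReal (Real.exp (-(θ ^ 2 / 16))) ^ (T / k) := by
        refine Finset.sum_le_sum fun v _ => ?_
        by_cases hv : 0 < vecNorm (gridPoint N v)
        · simp only [hv, true_and]
          exact h.measure_sum_window_le hσ hp hk hθ hθ0 hθ1 hv T
        · simp [hv]
    _ = _ := by
        rw [Finset.sum_const, Finset.card_univ, nsmul_eq_mul, ENNReal.ofReal_mul (by positivity),
          ENNReal.ofReal_pow (Real.exp_pos _).le]
        congr 1
        rw [← ENNReal.ofReal_natCast]
        congr 1
        simp

end Grid

/-! ### The batch estimate -/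

section Recovery

/-- The number of grid points per axis is polynomial in `d / θ`. -/
theorem log_grid_le {d θ : ℝ} (hd : 2 ≤ d) (hθ0 : 0 < θ) (hθ1 : θ ≤ 1) :
    Real.log (2 * (⌈96 * d / θ⌉₊ : ℝ) + 1) ≤ 9 * Real.log (d / θ) := by
  have hx : 2 ≤ d / θ := by rw [le_div_iff₀ hθ0]; nlinarith
  have hN : (⌈96 * d / θ⌉₊ : ℝ) ≤ 96 * d / θ + 1 := (Nat.ceil_lt_add_one (by positivity)).le
  rw [← Real.log_rpow (by linarith)]
  refine Real.log_le_log (by positivity) ?_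
  rw [mul_div_assoc] at hN ⊢
  set x := d / θ
  -- `2 (96 x + 1) + 1 ≤ 2^8 x` for `x ≥ 2`
  have h8 : (2 : ℝ) ^ 8 ≤ x ^ 8 := pow_le_pow_left₀ two_pos.le hx 8
  have e : x ^ (9 : ℝ) = x ^ 8 * x := by
    rw [show (9 : ℝ) = ((9 : ℕ) : ℝ) by norm_num, Real.rpow_natCast]; ring
  rw [e]
  nlinarith

variable {m k T : ℕ} {θ δ : ℝ}

/-- The conditions on the recovery time that the probability bounds need: the recovery event is
an intersection of three events, each of which may fail with probability at most `δ / 3`. -/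
theorem recovery_conditions (hm : 1 ≤ m) (hk : 2 ≤ k) (hθ0 : 0 < θ) (hθ1 : θ ≤ 1) (hδ0 : 0 < δ)
    (hδ1 : δ ≤ 1)
    (hT : 320 * (k / θ ^ 2 * (m * k * Real.log (m * k / θ) + Real.log (1 / δ))) ≤ (T : ℝ)) :
    k ≤ T ∧ Real.exp (-T) ≤ δ / 3 ∧
      (2 * (⌈96 * (m * k : ℝ) / θ⌉₊ : ℝ) + 1) ^ (k * m) * Real.exp (-(θ ^ 2 / 16)) ^ (T / k) ≤
        δ / 3 := by
  have hk2 : (2 : ℝ) ≤ k := by exact_mod_cast hk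
  have hm1 : (1 : ℝ) ≤ m := by exact_mod_cast hm
  have hd : (2 : ℝ) ≤ m * k := by nlinarith
  set d : ℝ := m * k with hddef
  have hx : 2 ≤ d / θ := by rw [le_div_iff₀ hθ0]; nlinarith
  have hL2 : Real.log 2 ≤ Real.log (d / θ) := Real.log_le_log two_pos hx
  have hlog2 := Real.log_two_gt_d9
  have hlog3 : Real.log 3 ≤ 2 * Real.log 2 := by
    rw [← Real.log_rpow two_pos]
    exact Real.log_le_log (by norm_num) (by norm_num)
  set X := d * Real.log (d / θ) with hX
  set y := Real.log (1 / δ) with hy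
  have hy0 : 0 ≤ y := Real.log_nonneg (by rw [le_div_iff₀ hδ0]; linarith)
  have hXlog : 2 * Real.log 2 ≤ X :=
    mul_le_mul hd hL2 (by linarith) (by linarith)
  have hδexp : δ / 3 = Real.exp (-(y + Real.log 3)) := by
    rw [hy, Real.log_div one_ne_zero hδ0.ne', Real.log_one, neg_add, zero_sub, neg_neg,
      ← sub_eq_add_neg, Real.exp_sub, Real.exp_log hδ0, Real.exp_log (by norm_num)]
  have hθ2 : θ ^ 2 ≤ 1 := pow_le_one₀ hθ0.le hθ1
  have hk0 : (0 : ℝ) < k := by linarith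
  have hTk : 320 * (X + y) ≤ θ ^ 2 * (T / k) := by
    have e : 320 * (k / θ ^ 2 * (X + y)) * (θ ^ 2 / k) = 320 * (X + y) := by field_simp
    rw [← e]
    calc _ ≤ (T : ℝ) * (θ ^ 2 / k) := mul_le_mul_of_nonneg_right hT (by positivity)
      _ = _ := by ring
  have hTk' : 320 * (X + y) ≤ T / k := hTk.trans (mul_le_of_le_one_left (by positivity) hθ2)
  have h2k : 2 ≤ (T : ℝ) / k := by linarith
  have hTT : (T : ℝ) / k ≤ T := div_le_self (by positivity) (by linarith)
  refine ⟨?_, ?_, ?_⟩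
  · rw [le_div_iff₀ hk0] at h2k
    have : (k : ℝ) ≤ T := by linarith
    exact_mod_cast this
  · rw [hδexp]
    exact Real.exp_le_exp.2 (by linarith)
  · have hfloor : (T : ℝ) / k / 2 ≤ ((T / k : ℕ) : ℝ) := by
      have h1 : (T : ℝ) / k < ((T / k : ℕ) : ℝ) + 1 := by
        rw [div_lt_iff₀ hk0]
        have := Nat.lt_mul_div_succ T (show 0 < k by omega)
        rw [mul_comm]
        exact_mod_cast this
      linarith
    have hg := log_grid_le hd hθ0 hθ1
    have hpos : (0 : ℝ) < 2 * (⌈96 * d / θ⌉₊ : ℝ) + 1 := by positivity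
    rw [hδexp, ← Real.exp_log hpos, ← Real.exp_nat_mul, ← Real.exp_nat_mul, ← Real.exp_add]
    refine Real.exp_le_exp.2 ?_
    have h1 : ((k * m : ℕ) : ℝ) * Real.log (2 * (⌈96 * d / θ⌉₊ : ℝ) + 1) ≤ 9 * X := by
      have e : ((k * m : ℕ) : ℝ) = d := by rw [hddef]; push_cast; ring
      rw [e, hX]
      nlinarith
    have h2 := mul_le_mul_of_nonneg_left hfloor (by positivity : (0 : ℝ) ≤ θ ^ 2 / 16)
    linarith

end Recovery

section Batch

variable {Ω : Type*} [mΩ : MeasurableSpace Ω] {μ : Measure Ω} {n m r k : ℕ} {Z : Data Ω n m}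
  {σ η p : ℝ}

/-- The event on which the batch estimate succeeds: the signed sums are large on the grid, and the
inputs and the attacks are not too large. -/
def recoveryEvent (Z : Data Ω n m) (k T : ℕ) (σ η θ : ℝ) : Set Ω :=
  gridEvent Z k ⌈96 * (m * k : ℝ) / θ⌉₊ T (θ / 4 * σ) ∩
    ({ω | Z.inputTotal (T + (k - 1)) ω / σ ≤ 6 * (m * T)} ∩ {ω | Z.attackTotal η T ω ≤ 3 * T})

theorem DataAssumptions.measurableSet_recoveryEvent (h : DataAssumptions μ Z σ η p) (k T : ℕ)
    (θ : ℝ) : MeasurableSet (recoveryEvent Z k T σ η θ) :=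
  (h.measurableSet_gridEvent _ _ _ _).inter
    ((measurableSet_le ((h.measurable_inputTotal _).div_const _) measurable_const).inter
      (measurableSet_le (h.measurable_attackTotal _) measurable_const))

theorem DataAssumptions.le_measure_recoveryEvent [IsProbabilityMeasure μ]
    (h : DataAssumptions μ Z σ η p) (hσ : 0 < σ) (hp : 0 ≤ p) {θ δ : ℝ}
    (hθ : θ = 1 - 2 * attackProb k p) (hθ0 : 0 < θ) (hθ1 : θ ≤ 1) (hm : 1 ≤ m) (hk : 2 ≤ k)
    (hδ0 : 0 < δ) (hδ1 : δ ≤ 1) {T : ℕ}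
    (hT : 320 * (k / θ ^ 2 * (m * k * Real.log (m * k / θ) + Real.log (1 / δ))) ≤ (T : ℝ)) :
    ENNReal.ofReal (1 - δ) ≤ μ (recoveryEvent Z k T σ η θ) := by
  obtain ⟨hkT, hexp, hgrid⟩ := recovery_conditions hm hk hθ0 hθ1 hδ0 hδ1 hT
  have hm1 : (1 : ℝ) ≤ m := by exact_mod_cast hm
  have hT1 : (1 : ℝ) ≤ T := by exact_mod_cast (by omega : 1 ≤ T)
  have h1 := (h.measure_compl_gridEvent_le hσ hp (by omega) hθ hθ0 hθ1
    ⌈96 * (m * k : ℝ) / θ⌉₊ T).trans (ENNReal.ofReal_le_ofReal hgrid)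
  have h2 : μ {ω | 6 * (m * T) < Z.inputTotal (T + (k - 1)) ω / σ} ≤ ENNReal.ofReal (δ / 3) := by
    refine (h.measure_inputTotal_le hσ _ _).trans
      (ENNReal.ofReal_le_ofReal ((Real.exp_le_exp.2 ?_).trans hexp))
    have : ((T + (k - 1) : ℕ) : ℝ) ≤ 2 * T := by exact_mod_cast (by omega : T + (k - 1) ≤ 2 * T)
    nlinarith
  have h3 : μ {ω | 3 * T < Z.attackTotal η T ω} ≤ ENNReal.ofReal (δ / 3) := by
    refine (h.measure_attackTotal_le T _).trans
      (ENNReal.ofReal_le_ofReal ((Real.exp_le_exp.2 ?_).trans hexp))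
    linarith
  have hcompl : μ (recoveryEvent Z k T σ η θ)ᶜ ≤ ENNReal.ofReal δ := by
    rw [recoveryEvent, Set.compl_inter, Set.compl_inter]
    refine (measure_union_le _ _).trans ((add_le_add h1 ((measure_union_le _ _).trans
      (add_le_add (le_of_eq_of_le ?_ h2) (le_of_eq_of_le ?_ h3)))).trans (le_of_eq ?_))
    · congr 1; ext ω; simp
    · congr 1; ext ω; simp
    · rw [← ENNReal.ofReal_add (by positivity) (by positivity),
        ← ENNReal.ofReal_add (by positivity) (by positivity)]
      congr 1; ring
  have hE := h.measurableSet_recoveryEvent k T θ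
  have := prob_compl_eq_one_sub (μ := μ) hE.compl
  rw [compl_compl] at this
  rw [this, ENNReal.ofReal_sub _ hδ0.le, ENNReal.ofReal_one]
  exact tsub_le_tsub_left hcompl _

/-- On the recovery event the batch estimate is exact up to the influence of the old states. -/
theorem frobNorm_markov_sub_batch_le (h : DataAssumptions μ Z σ η p) {S : LinSys n m r}
    (hσ : 0 < σ) (hη : 0 < η) {θ : ℝ} (hθ0 : 0 < θ) (hθ1 : θ ≤ 1) (hm : 1 ≤ m) (hk : 2 ≤ k)
    {T : ℕ} (hT : 1 ≤ T) {ψ ρ b c : ℝ} (hψ : 0 ≤ ψ) (h0 : 0 ≤ ρ) (h1 : ρ < 1)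
    (hA : ∀ t : ℕ, specNorm (S.A ^ t) ≤ ψ * ρ ^ t) (hB : specNorm S.B ≤ b)
    (hC : specNorm S.C ≤ c) {ω : Ω} (hω : ω ∈ recoveryEvent Z k T σ η θ)
    {G : Matrix (Fin r) (Fin k × Fin m) ℝ} (hG : IsL2Estimate (Z.input ω) (Z.obs S ω) T G) :
    frobNorm (S.markov k - G) ≤
      32 * (c * ψ * (b * (6 * m * σ) + 3 * η)) / (θ * σ) * (ρ ^ (k - 1) / (1 - ρ)) := by
  have hb : 0 ≤ b := (specNorm_nonneg _).trans hB
  have hc : 0 ≤ c := (specNorm_nonneg _).trans hC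
  obtain ⟨hgrid, hin, hat⟩ := hω
  have hk0 : (0 : ℝ) < k := by exact_mod_cast (by omega : 0 < k)
  have hm1 : (1 : ℝ) ≤ m := by exact_mod_cast hm
  have hT0 : (0 : ℝ) < T := by exact_mod_cast hT
  have hd1 : (1 : ℝ) ≤ m * k := by
    have : (1 : ℝ) ≤ k := by exact_mod_cast (by omega : 1 ≤ k)
    nlinarith
  set N := ⌈96 * (m * k : ℝ) / θ⌉₊ with hN
  have hNle : 96 * (m * k : ℝ) / θ ≤ N := Nat.le_ceil _
  have hNθ : 96 * (m * k : ℝ) ≤ N * θ := (div_le_iff₀ hθ0).1 hNle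
  have hNbig : 2 * (m * k : ℝ) ≤ N := by nlinarith
  have hN0 : 0 < N := by
    have : (0 : ℝ) < N := by linarith
    exact_mod_cast this
  have hin' : Z.inputTotal (T + (k - 1)) ω ≤ 6 * m * σ * T := by
    have := (div_le_iff₀ hσ).1 hin
    linarith
  -- a quarter of the threshold `θ / 4 * σ * T` of the grid event
  set A := θ * σ * T / 16 with hAdef
  have hA0 : 0 < A := by positivity
  have hvec : ∀ z, A * vecNorm z ≤
      ∑ s ∈ Finset.range T, Z.windowSign k s ω * |z ⬝ᵥ Z.window k s ω| := by
    refine lower_bound_of_gridPoint (N := N) ?_ hN0 (fun s => Z.abs_windowSign k s ω)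
      (fun v hv => ?_) ?_
    · rw [Fintype.card_prod, Fintype.card_fin, Fintype.card_fin]
      have : ((2 * (k * m) : ℕ) : ℝ) ≤ N := by push_cast; linarith
      exact_mod_cast this
    · refine (le_of_eq ?_).trans (hgrid v hv).le
      rw [hAdef]; ring
    · refine (sum_abs_window_le Z (by omega) T ω).trans ?_
      calc (k : ℝ) * Z.inputTotal (T + (k - 1)) ω ≤ k * (6 * m * σ * T) := by gcongr
        _ = 96 * (m * k) * (σ * T / 16) := by ring
        _ ≤ N * θ * (σ * T / 16) := by gcongr
        _ = A * N := by rw [hAdef]; ring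
  -- compare the losses at the minimizer and at the true parameters
  have hmat := lower_bound_matrix hA0.le hvec (S.markov k - G)
  have hloss : ∑ s ∈ Finset.range T, (Z.windowSign k s ω *
      vecNorm ((S.markov k - G).mulVec (Z.window k s ω)) -
        2 * (c * ρ ^ (k - 1) * Z.stateBound ψ ρ b s ω)) ≤ 0 := by
    refine (Finset.sum_le_sum fun s _ => sampleLoss_sub_ge (u := Z.input ω) (x₀ := Z.x₀ ω)
      (w := fun t => Z.w t ω) hψ h0 hA hB hC (by omega) s G
      (windowSign_dichotomy h k s ω)).trans ?_
    rw [Finset.sum_sub_distrib, sub_nonpos]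
    exact hG (S.markov k)
  rw [Finset.sum_sub_distrib, ← Finset.mul_sum, ← Finset.mul_sum, sub_nonpos] at hloss
  have hinT : Z.inputTotal T ω ≤ 6 * m * σ * T := by
    refine le_trans ?_ hin'
    exact Finset.sum_le_sum_of_subset_of_nonneg
      (Finset.range_mono (Nat.le_add_right _ _))
      fun _ _ _ => Finset.sum_nonneg fun _ _ => abs_nonneg _
  have hst := Z.sum_stateBound_le hη hψ h0 h1 hb hT hinT hat
  have hρ1 : 0 < 1 - ρ := by linarith
  have hfin : A * frobNorm (S.markov k - G) ≤
      2 * (c * ρ ^ (k - 1) * (ψ * (b * (6 * m * σ) + 3 * η) * T / (1 - ρ))) :=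
    hmat.trans (hloss.trans (by gcongr))
  rw [mul_comm, ← le_div_iff₀ hA0] at hfin
  refine hfin.trans (le_of_eq ?_)
  rw [hAdef]
  field_simp
  ring

end Batch

/-! ### Assembling the bounds -/

section Constants

variable {k : ℕ} {σ R β κ p θ : ℝ}

theorem attackProb_margin_le_one (hp : 0 ≤ p) (hp1 : p ≤ 1) :
    1 - 2 * attackProb k p ≤ 1 := by
  have : (1 - p) ^ (k - 1) ≤ 1 := pow_le_one₀ (by linarith) (by linarith)
  unfold attackProb
  linarith

/-- The step-size condition in the form used for the streaming estimate. -/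
theorem two_mul_radius_le_of_step (hσ : 0 < σ) (hκ : 0 < κ) (hκθ : κ ≤ θ) (hβ0 : 0 ≤ β)
    (hβ : Real.sqrt (2 * Real.pi) * R / (κ * σ) < β) :
    2 * R ≤ β * (θ * (Real.sqrt (2 / Real.pi) * σ)) := by
  have hπ : Real.sqrt (2 * Real.pi) * Real.sqrt (2 / Real.pi) = 2 := by
    rw [← Real.sqrt_mul (by positivity),
      show 2 * Real.pi * (2 / Real.pi) = 2 ^ 2 by field_simp]
    exact Real.sqrt_sq two_pos.le
  rw [div_lt_iff₀ (by positivity)] at hβ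
  calc 2 * R = Real.sqrt (2 * Real.pi) * R * Real.sqrt (2 / Real.pi) := by
        rw [mul_right_comm, hπ]
    _ ≤ β * (κ * σ) * Real.sqrt (2 / Real.pi) := by gcongr
    _ = β * (κ * (Real.sqrt (2 / Real.pi) * σ)) := by ring
    _ ≤ _ := by gcongr

end Constants

section Bounds

variable {Ω : Type*} [MeasurableSpace Ω] {μ : Measure Ω} {n m r k : ℕ} {S : LinSys n m r}
  {ψ b c ρ : ℝ}

/-- An integral bound on the Frobenius error bounds the expected errors of `D` and of the Hankel
matrix. -/
theorem lintegral_errors_le {G : Ω → Matrix (Fin r) (Fin k × Fin m) ℝ} {M : ℝ} (hk : 2 ≤ k)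
    (hψ : 0 ≤ ψ) (h0 : 0 ≤ ρ) (h1 : ρ < 1) (hA : ∀ t : ℕ, specNorm (S.A ^ t) ≤ ψ * ρ ^ t)
    (hB : specNorm S.B ≤ b) (hC : specNorm S.C ≤ c) [IsProbabilityMeasure μ]
    (hG : Integrable (fun ω => frobNorm (S.markov k - G ω)) μ)
    (hM : ∫ ω, frobNorm (S.markov k - G ω) ∂μ ≤ M) :
    ∫⁻ ω, ENNReal.ofReal (specNorm (S.D - estD (G ω))) ∂μ ≤ ENNReal.ofReal M ∧
      ∫⁻ ω, infSpecNorm (S.hankel - estHankel (G ω)) ∂μ ≤ ENNReal.ofReal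
        (3 * (c * ψ * b) * (ρ ^ ((k : ℝ) / 2) / (1 - ρ ^ 2)) + Real.sqrt k * M) := by
  constructor
  · calc _ ≤ ∫⁻ ω, ENNReal.ofReal (frobNorm (S.markov k - G ω)) ∂μ :=
          lintegral_mono fun ω =>
            ENNReal.ofReal_le_ofReal (specNorm_sub_estD_le S (by omega) (G ω))
      _ = ENNReal.ofReal (∫ ω, frobNorm (S.markov k - G ω) ∂μ) :=
          (ofReal_integral_eq_lintegral_ofReal hG
            (Filter.Eventually.of_forall fun _ => frobNorm_nonneg _)).symm
      _ ≤ _ := ENNReal.ofReal_le_ofReal hM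
  · set a := 3 * (c * ψ * b) * (ρ ^ ((k : ℝ) / 2) / (1 - ρ ^ 2))
    have ha : 0 ≤ a := by
      have hb : 0 ≤ b := (specNorm_nonneg _).trans hB
      have hc : 0 ≤ c := (specNorm_nonneg _).trans hC
      have : 0 < 1 - ρ ^ 2 := by nlinarith
      have := Real.rpow_nonneg h0 ((k : ℝ) / 2)
      positivity
    have hi : Integrable (fun ω => a + Real.sqrt k * frobNorm (S.markov k - G ω)) μ :=
      (integrable_const a).add (hG.const_mul _)
    calc _ ≤ ∫⁻ ω, ENNReal.ofReal (a + Real.sqrt k * frobNorm (S.markov k - G ω)) ∂μ :=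
          lintegral_mono fun ω => infSpecNorm_sub_estHankel_le S hψ h0 h1 hA hB hC hk (G ω)
      _ = ENNReal.ofReal (∫ ω, (a + Real.sqrt k * frobNorm (S.markov k - G ω)) ∂μ) :=
          (ofReal_integral_eq_lintegral_ofReal hi (Filter.Eventually.of_forall fun _ =>
            add_nonneg ha (mul_nonneg (Real.sqrt_nonneg _) (frobNorm_nonneg _)))).symm
      _ ≤ _ := by
          refine ENNReal.ofReal_le_ofReal ?_
          rw [integral_add (integrable_const a) (hG.const_mul _), integral_const,
            probReal_univ, one_smul, integral_const_mul]
          gcongr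

end Bounds

end SysId

end

/-- `c₀` is an absolute constant; `K` depends only on `m, σ, η, ψ, R, β`, on bounds `b, c` of
`‖B‖₂, ‖C‖₂`, and on a lower bound `κ` of `1 - 2q`. In particular it does not depend on `ρ`, `k`,
`t`, `δ`, `Tstar`, `n`, `r`, `p`, nor on the system. -/
theorem theorem5 :
    ∃ c₀ : ℝ, 0 < c₀ ∧
      ∀ (m : ℕ) (σ η ψ R β b c κ : ℝ), 1 ≤ m → 0 < σ → 0 < η → 0 < ψ → 0 < R → 0 < κ →
        Real.sqrt (2 * Real.pi) * R / (κ * σ) < β →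
      ∃ K : ℝ, 0 < K ∧
        ∀ (n r k : ℕ) (S : SysId.LinSys n m r) (ρ p δ : ℝ) (Tstar : ℕ), 2 ≤ k →
          0 ≤ ρ → ρ < 1 → (∀ t : ℕ, SysId.specNorm (S.A ^ t) ≤ ψ * ρ ^ t) →
          SysId.specNorm S.B ≤ b → SysId.specNorm S.C ≤ c →
          SysId.frobNorm (S.markov k) ≤ R →
          0 ≤ p → p < 1 / (2 * ((k : ℝ) - 1)) → κ ≤ 1 - 2 * SysId.attackProb k p →
          0 < δ → δ ≤ 1 →
          c₀ * SysId.recoveryTime m k (SysId.attackProb k p) δ ≤ (Tstar : ℝ) →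
        ∀ (Ω : Type*) [MeasurableSpace Ω] (μ : MeasureTheory.Measure Ω)
          [MeasureTheory.IsProbabilityMeasure μ] (Z : SysId.Data Ω n m),
          SysId.DataAssumptions μ Z σ η p →
        ∀ (G g : ℕ → Ω → Matrix (Fin r) (Fin k × Fin m) ℝ)
          (Gbatch : Ω → Matrix (Fin r) (Fin k × Fin m) ℝ),
          SysId.IsStreamingRun S Z R β G g →
          (∀ ω, SysId.IsL2Estimate (Z.input ω) (Z.obs S ω) Tstar (Gbatch ω)) →
          (∀ t : ℕ, 1 ≤ t → t < Tstar →
            (∫⁻ ω, ENNReal.ofReal (SysId.specNorm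
                (S.D - SysId.estD (SysId.hybridEstimate Tstar G Gbatch t ω))) ∂μ
              ≤ ENNReal.ofReal (K *
                ((k : ℝ) ^ (1 / 4 : ℝ) * ρ ^ (((k : ℝ) - 1) / 2) / Real.sqrt (1 - ρ)
                  + k / Real.sqrt t))) ∧
            (∫⁻ ω, SysId.infSpecNorm
                (S.hankel - SysId.estHankel (SysId.hybridEstimate Tstar G Gbatch t ω)) ∂μ
              ≤ ENNReal.ofReal (K *
                (ρ ^ ((k : ℝ) / 2) / (1 - ρ ^ 2)
                  + (k : ℝ) ^ (3 / 4 : ℝ) * ρ ^ (((k : ℝ) - 1) / 2) / Real.sqrt (1 - ρ)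
                  + (k : ℝ) ^ (3 / 2 : ℝ) / Real.sqrt t)))) ∧
          ∃ E : Set Ω, MeasurableSet E ∧ ENNReal.ofReal (1 - δ) ≤ μ E ∧ ∀ ω ∈ E,
            SysId.specNorm (S.D - SysId.estD (SysId.hybridEstimate Tstar G Gbatch Tstar ω))
              ≤ K * (ρ ^ (k - 1) / (1 - ρ)) ∧
            SysId.infSpecNorm
                (S.hankel - SysId.estHankel (SysId.hybridEstimate Tstar G Gbatch Tstar ω))
              ≤ ENNReal.ofReal (K *
                (ρ ^ ((k : ℝ) / 2) / (1 - ρ ^ 2)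
                  + Real.sqrt k * ρ ^ (k - 1) / (1 - ρ))) := by
  refine ⟨320, by norm_num, fun m σ η ψ R β b c κ hm hσ hη hψ hR hκ hβ => ?_⟩
  have hβ0 : 0 ≤ β := le_trans (by positivity) hβ.le
  -- the constants of the Hankel truncation (`K₀`), of the bias and the fluctuation of the streaming
  -- estimate (`K₁`, `K₂`), and of the batch error (`K₃`); only a system whose norms `b` and `c`
  -- bound shows that both are nonnegative, but `K` is chosen before it, whence the absolute values
  set K₀ : ℝ := 3 * (|c| * ψ * |b|) with hK₀
  set K₁ : ℝ := Real.sqrt (2 * β * (|c| * ψ * (|b| * (m * σ) + η))) with hK₁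
  set K₂ : ℝ := 2 * R + β * σ * Real.sqrt (3 * m) with hK₂
  set K₃ : ℝ := 32 * (|c| * ψ * (|b| * (6 * m * σ) + 3 * η)) / (κ * σ) with hK₃
  have p₀ : 0 ≤ K₀ := by positivity
  have p₁ : 0 ≤ K₁ := by positivity
  have p₂ : 0 ≤ K₂ := by positivity
  have p₃ : 0 ≤ K₃ := by positivity
  refine ⟨1 + K₀ + K₁ + K₂ + K₃, by positivity, ?_⟩
  intro n r k S ρ p δ Tstar hk h0 h1 hA hB hC hS hp hp1 hκq hδ0 hδ1 hT Ω _ μ _ Z h G g Gbatch hrun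
    hbatch
  set K := 1 + K₀ + K₁ + K₂ + K₃ with hK
  have hb : 0 ≤ b := (SysId.specNorm_nonneg _).trans hB
  have hc : 0 ≤ c := (SysId.specNorm_nonneg _).trans hC
  rw [abs_of_nonneg hb, abs_of_nonneg hc] at hK₀ hK₁ hK₃
  have hk2 : (2 : ℝ) ≤ k := by exact_mod_cast hk
  have hk0 : (0 : ℝ) ≤ k := by linarith
  have hρ1 : 0 < 1 - ρ := by linarith
  have hρ2 : 0 < 1 - ρ ^ 2 := by nlinarith
  have hp1' : p ≤ 1 := hp1.le.trans (by rw [div_le_one (by linarith)]; linarith)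
  have hθ0 : 0 < 1 - 2 * SysId.attackProb k p := hκ.trans_le hκq
  have hθ1 := SysId.attackProb_margin_le_one (k := k) hp hp1'
  have hβR := SysId.two_mul_radius_le_of_step hσ hκ hκq hβ0 hβ
  unfold SysId.recoveryTime at hT
  have hrt : 0 ≤ ρ ^ ((k : ℝ) / 2) / (1 - ρ ^ 2) :=
    div_nonneg (Real.rpow_nonneg h0 _) hρ2.le
  refine ⟨fun t ht htT => ?_, SysId.recoveryEvent Z k Tstar σ η (1 - 2 * SysId.attackProb k p),
    h.measurableSet_recoveryEvent _ _ _,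
    h.le_measure_recoveryEvent hσ hp rfl hθ0 hθ1 hm hk hδ0 hδ1 hT, fun ω hω => ?_⟩
  · have hest : ∀ ω, SysId.hybridEstimate Tstar G Gbatch t ω = G (t / k) ω := fun ω => if_pos htT
    simp only [hest]
    have hint := SysId.integral_streaming_le h hk hσ.le hη hp hθ0.le hR hβ0 hβR hψ.le h0 h1 hA hB
      hC hS hrun ht
    rw [← hK₁, ← hK₂] at hint
    have hx : 0 ≤ ρ ^ (((k : ℝ) - 1) / 2) / Real.sqrt (1 - ρ) :=
      div_nonneg (Real.rpow_nonneg h0 _) (Real.sqrt_nonneg _)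
    have hy : 0 ≤ (k : ℝ) / Real.sqrt t := by positivity
    obtain ⟨hD, hH⟩ := SysId.lintegral_errors_le hk hψ.le h0 h1 hA hB hC
      (SysId.integrable_frobNorm_markov_sub h hR.le hS hrun (t / k)) hint
    rw [← hK₀] at hH
    refine ⟨hD.trans (ENNReal.ofReal_le_ofReal ?_), hH.trans (ENNReal.ofReal_le_ofReal ?_)⟩
    · have hk14 : 1 ≤ (k : ℝ) ^ (1 / 4 : ℝ) := Real.one_le_rpow (by linarith) (by norm_num)
      rw [mul_add, mul_div_assoc]
      refine add_le_add (mul_le_mul (by linarith) (le_mul_of_one_le_left hx hk14) hx (by linarith))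
        (mul_le_mul_of_nonneg_right (by linarith) hy)
    · have hk34 : Real.sqrt k ≤ (k : ℝ) ^ (3 / 4 : ℝ) := by
        rw [Real.sqrt_eq_rpow]
        exact Real.rpow_le_rpow_of_exponent_le (by linarith) (by norm_num)
      have hk32 : (k : ℝ) ^ (3 / 2 : ℝ) = Real.sqrt k * k := by
        rw [Real.sqrt_eq_rpow, ← Real.rpow_add_one (by linarith)]
        norm_num
      rw [hk32, mul_div_assoc _ _ (Real.sqrt (1 - ρ)), mul_div_assoc (Real.sqrt k)]
      have e₁ : K₀ * (ρ ^ ((k : ℝ) / 2) / (1 - ρ ^ 2)) ≤ K * (ρ ^ ((k : ℝ) / 2) / (1 - ρ ^ 2)) :=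
        mul_le_mul_of_nonneg_right (by linarith) hrt
      have e₂ : K₁ * (Real.sqrt k * (ρ ^ (((k : ℝ) - 1) / 2) / Real.sqrt (1 - ρ))) ≤
          K * ((k : ℝ) ^ (3 / 4 : ℝ) * (ρ ^ (((k : ℝ) - 1) / 2) / Real.sqrt (1 - ρ))) :=
        mul_le_mul (by linarith) (mul_le_mul_of_nonneg_right hk34 hx)
          (mul_nonneg (Real.sqrt_nonneg _) hx) (by linarith)
      have e₃ : K₂ * (Real.sqrt k * (k / Real.sqrt t)) ≤ K * (Real.sqrt k * (k / Real.sqrt t)) :=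
        mul_le_mul_of_nonneg_right (by linarith) (mul_nonneg (Real.sqrt_nonneg _) hy)
      linarith
  · have hest : SysId.hybridEstimate Tstar G Gbatch Tstar ω = Gbatch ω := if_neg (lt_irrefl _)
    rw [hest]
    have hT1 : 1 ≤ Tstar := by
      have := (SysId.recovery_conditions hm hk hθ0 hθ1 hδ0 hδ1 hT).1
      omega
    have hx : 0 ≤ ρ ^ (k - 1) / (1 - ρ) := by positivity
    have herr : SysId.frobNorm (S.markov k - Gbatch ω) ≤ K₃ * (ρ ^ (k - 1) / (1 - ρ)) := by
      refine (SysId.frobNorm_markov_sub_batch_le h hσ hη hθ0 hθ1 hm hk hT1 hψ.le h0 h1 hA hB hC hω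
        (hbatch ω)).trans (mul_le_mul_of_nonneg_right ?_ hx)
      rw [hK₃]
      gcongr
    refine ⟨(SysId.specNorm_sub_estD_le S (by omega) _).trans
      (herr.trans (mul_le_mul_of_nonneg_right (by linarith) hx)),
      (SysId.infSpecNorm_sub_estHankel_le S hψ.le h0 h1 hA hB hC hk _).trans
        (ENNReal.ofReal_le_ofReal ?_)⟩
    rw [← hK₀, mul_div_assoc, mul_add]
    refine add_le_add (mul_le_mul_of_nonneg_right (by linarith) hrt) ?_
    calc Real.sqrt k * SysId.frobNorm (S.markov k - Gbatch ω)
        ≤ Real.sqrt k * (K₃ * (ρ ^ (k - 1) / (1 - ρ))) := by gcongr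
      _ = K₃ * (Real.sqrt k * (ρ ^ (k - 1) / (1 - ρ))) := by ring
      _ ≤ _ := mul_le_mul_of_nonneg_right (by linarith) (mul_nonneg (Real.sqrt_nonneg _) hx)
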